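/- Let $F$ be a local field of characteristic zero, and let $\underline G$ be the group of $F$-points of a simply connected, simply-laced split simple Chevalley group over $F$ (type $A$, $D$ or $E$), realised as follows: $\mathfrak g$ is a split simple Lie algebra over $F$ with splitting Cartan subalgebra $\mathfrak h$, simply-laced root system $\Phi$, simple roots $\Delta$ and root vectors $X_\alpha$ ($\alpha\in\Phi$) of a Chevalley basis; $V$ is a finite-dimensional representation of $\mathfrak g$ whose weights generate the full lattice of integral weights; and $\underline G\subset GL(V)$ is generated by all $\underline x_\alpha(t)=\exp(tX_\alpha)$, $\alpha\in\Phi$, $t\in F$. Let $$1\to\mu_2\to G\to\underline G\to 1$$ be a nontrivial (that is, non-split) central extension. For $\alpha\in\Phi$ let $t\mapsto x_\alpha(t)$ be the unique homomorphism $F\to G$ lifting $t\mapsto \underline x_\alpha(t)$, and for $t\in F^\times$ put $$w_\alpha(t)=x_\alpha(t)x_{-\alpha}(-t^{-1})x_\alpha(t),\qquad h_\alpha(t)=w_\alpha(t)w_\alpha(-1).$$ Let $T$ be the subgroup of $G$ generated by all $h_\alpha(t)$, let $Z_T$ be the center of $T$, let $T^2$ be the subgroup generated by all $h_\alpha(t^2)$,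 and let $N$ be the subgroup generated by all $w_\alpha(t)$ ($\alpha\in\Phi$, $t\in F^\times$). Then $T^2\subset Z_T$ and $N$ normalizes $T$. The Weyl group $W$ is $N/T$, acting through conjugation. Call a set $S$ of vertices of the Dynkin diagram admissible if no two vertices in $S$ are adjacent and every vertex not in $S$ is adjacent to an even number of vertices in $S$; for such $S$ and $t\in F^\times$ put $h_S(t)=\prod_{\alpha\in S}h_\alpha(t)$ (the product being taken in any order). Then: 1. for every admissible $S$, every $\alpha\in\Delta$ and every $t\in F^\times$, $$w_\alpha(1)\,h_S(t)\,w_\alpha(1)^{-1}\equiv h_S(t)\pmod{T^2};$$ 2. $W$ fixes $Z_T/T^2$ pointwise: $n z n^{-1}z^{-1}\in T^2$ for all $n\in N$ and $z\in Z_T$. -/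

import Mathlib

open LieAlgebra LieAlgebra.IsKilling

namespace Metaplectic

section NilpotentExp

variable {F V : Type*} [Field F] [CharZero F] [AddCommGroup V] [Module F V]

/-- The exponential `∑ Aᵏ / k!` of a nilpotent endomorphism of a vector space over a field of
characteristic zero. -/
noncomputable def nilExp (A : Module.End F V) : Module.End F V :=
  letI : Module ℚ (Module.End F V) := Module.compHom (Module.End F V) (algebraMap ℚ F)
  IsNilpotent.exp A

theorem isUnit_nilExp {A : Module.End F V} (hA : IsNilpotent A) : IsUnit (nilExp A) := by
  let _ : Module ℚ (Module.End F V) := Module.compHom (Module.End F V) (algebraMap ℚ F)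
  exact IsNilpotent.isUnit_exp hA

theorem nilExp_add {A B : Module.End F V} (h : Commute A B) (hA : IsNilpotent A)
    (hB : IsNilpotent B) : nilExp (A + B) = nilExp A * nilExp B := by
  let _ : Module ℚ (Module.End F V) := Module.compHom (Module.End F V) (algebraMap ℚ F)
  exact IsNilpotent.exp_add_of_commute h hA hB

theorem nilExp_zero : nilExp (0 : Module.End F V) = 1 := by
  let _ : Module ℚ (Module.End F V) := Module.compHom (Module.End F V) (algebraMap ℚ F)
  exact IsNilpotent.exp_zero

/-- An endomorphism `A` of a finite-dimensional space with `D * A - A * D = 2 A` is nilpotent. -/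
theorem isNilpotent_of_commutator [FiniteDimensional F V] {A D : Module.End F V}
    (h : D * A - A * D = (2 : F) • A) : IsNilpotent A := by
  by_contra hn
  let f : Module.End F (Module.End F V) := LinearMap.mulLeft F D - LinearMap.mulRight F D
  have hpow : ∀ n : ℕ, f (A ^ n) = (2 * n : F) • A ^ n := by
    intro n
    induction n with
    | zero => simp [f]
    | succ n ih =>
      have h1 : D * A = A * D + (2 : F) • A := by rw [← h]; abel
      have ih' : D * A ^ n - A ^ n * D = (2 * n : F) • A ^ n := by simpa [f] using ih
      have e : f (A ^ (n + 1)) = (D * A ^ n - A ^ n * D) * A + A ^ n * (D * A - A * D) := by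
        simp only [f, LinearMap.sub_apply, LinearMap.mulLeft_apply, LinearMap.mulRight_apply,
          pow_succ]
        noncomm_ring
      rw [e, ih', h, smul_mul_assoc, mul_smul_comm, ← pow_succ, ← add_smul]
      congr 1
      push_cast
      ring
  have hne : ∀ n : ℕ, A ^ n ≠ 0 := fun n hz => hn ⟨n, hz⟩
  have hev : ∀ n : ℕ, f.HasEigenvalue (2 * n : F) := fun n =>
    Module.End.hasEigenvalue_of_hasEigenvector
      ⟨Module.End.mem_eigenspace_iff.mpr (hpow n), hne n⟩
  have hinj : Function.Injective (fun n : ℕ => (2 * n : F)) := by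
    intro a b hab
    simpa using hab
  have hfin : Set.Finite (f.HasEigenvalue) := Module.End.finite_hasEigenvalue f
  exact (Set.infinite_of_injective_forall_mem (s := {μ | f.HasEigenvalue μ}) hinj hev) hfin

end NilpotentExp

section ChevalleyGroup

variable {F L : Type*} [Field F] [CharZero F] [LieRing L] [LieAlgebra F L]
  [FiniteDimensional F L] [IsKilling F L] {H : LieSubalgebra F L} [H.IsCartanSubalgebra]
  [LieModule.IsTriangularizable F H L]

/-- The root `-α`. -/
def negRoot (α : H.root) : H.root :=
  ⟨-α.1, by
    have h := α.2
    simp only [LieSubalgebra.root, Finset.mem_filter, Finset.mem_univ, true_and] at h ⊢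
    exact h.neg⟩

variable (H) in
/-- The root vectors `X_α` of a Chevalley basis of `L` relative to the splitting Cartan
subalgebra `H`: `[X_α, X_{-α}]` is the coroot of `α`, and `[X_α, X_β] = ±(r + 1) X_{α+β}` whenever
`α`, `β`, `α + β` are roots, where `r` is the largest integer such that `β - r α` is a root.
(The other members of the basis are the simple coroots.) -/
structure ChevalleyBasis where
  X : H.root → L
  X_mem : ∀ α : H.root, X α ∈ rootSpace H α.1
  lie_X_neg : ∀ α : H.root, ⁅X α, X (negRoot α)⁆ = (coroot α.1 : L)
  lie_X_X : ∀ α β γ : H.root, (γ.1 : H → F) = α.1 + β.1 →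
    ⁅X α, X β⁆ = (LieModule.chainBotCoeff α.1 β.1 + 1) • X γ ∨
    ⁅X α, X β⁆ = -((LieModule.chainBotCoeff α.1 β.1 + 1) • X γ)

variable (H) in
/-- The weights of the `L`-module `V` generate the lattice of all integral weights, that is, of
all linear forms on `H` which are integral on every coroot. This is the condition on `V` under
which the Chevalley group attached to `V` is the simply connected one. -/
def HasFullWeightLattice (V : Type*) [AddCommGroup V] [Module F V] [LieRingModule L V]
    [LieModule F L V] : Prop :=
  ∀ μ : Module.Dual F H, (∀ α : H.root, ∃ n : ℤ, μ (coroot α.1) = n) →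
    μ ∈ AddSubgroup.closure
      {ν : Module.Dual F H | LieModule.weightSpace V (ν : H → F) ≠ ⊥}

namespace ChevalleyBasis

variable (B : ChevalleyBasis H)
variable (V : Type*) [AddCommGroup V] [Module F V] [LieRingModule L V]
  [LieModule F L V] [FiniteDimensional F V]

theorem isNilpotent_toEnd (α : H.root) (t : F) :
    IsNilpotent (t • LieModule.toEnd F L V (B.X α)) := by
  have hα : α.1.IsNonZero := by
    have h := α.2
    simpa only [LieSubalgebra.root, Finset.mem_filter, Finset.mem_univ, true_and] using h
  have h1 : ⁅(coroot α.1 : L), B.X α⁆ = (2 : F) • B.X α := by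
    have := lie_eq_smul_of_mem_rootSpace (B.X_mem α) (coroot α.1)
    rwa [root_apply_coroot hα] at this
  have h2 : LieModule.toEnd F L V (coroot α.1 : L) * LieModule.toEnd F L V (B.X α) -
      LieModule.toEnd F L V (B.X α) * LieModule.toEnd F L V (coroot α.1 : L) =
      (2 : F) • LieModule.toEnd F L V (B.X α) := by
    ext v
    have h3 : ⁅⁅(coroot α.1 : L), B.X α⁆, v⁆ = (2 : F) • ⁅B.X α, v⁆ := by rw [h1, smul_lie]
    rw [lie_lie] at h3
    simpa using h3
  exact (isNilpotent_of_commutator h2).smul t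

/-- The linear automorphism `exp (t X_α)` of `V`. -/
noncomputable def rootElt (α : H.root) (t : F) : LinearMap.GeneralLinearGroup F V :=
  (isUnit_nilExp (B.isNilpotent_toEnd V α t)).unit

/-- The Chevalley group attached to the `L`-module `V`: the group of linear automorphisms
of `V` generated by all `exp (t X_α)`. -/
def group : Subgroup (LinearMap.GeneralLinearGroup F V) :=
  Subgroup.closure {g | ∃ (α : H.root) (t : F), g = B.rootElt V α t}

/-- The one-parameter subgroup `t ↦ x_α(t) = exp (t X_α)` of the Chevalley group. -/
noncomputable def x (α : H.root) : Multiplicative F →* B.group V where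
  toFun t := ⟨B.rootElt V α t.toAdd, Subgroup.subset_closure ⟨α, t.toAdd, rfl⟩⟩
  map_one' := by
    ext1
    apply Units.ext
    simp [rootElt, nilExp_zero]
  map_mul' s t := by
    ext1
    apply Units.ext
    have hc : Commute (s.toAdd • LieModule.toEnd F L V (B.X α))
        (t.toAdd • LieModule.toEnd F L V (B.X α)) :=
      ((Commute.refl _).smul_left _).smul_right _
    simpa [rootElt, add_smul] using
      nilExp_add hc (B.isNilpotent_toEnd V α _) (B.isNilpotent_toEnd V α _)

end ChevalleyBasis

end ChevalleyGroup

section Lift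

variable {F G Q : Type*} [Field F] [CharZero F] [Group G] [Group Q]
  (S : GroupExtension (rootsOfUnity 2 F) G Q)

/-- The extension is central. -/
def IsCentral : Prop := S.inl.range ≤ Subgroup.center G

variable {S}

/-- A homomorphism from the additive group of `F` to `Q` lifts uniquely to a central extension
of `Q` by `μ₂`. -/
theorem existsUnique_lift (hS : IsCentral S) (f : Multiplicative F →* Q) :
    ∃! g : Multiplicative F →* G, S.rightHom.comp g = f := by
  have hker : ∀ z : G, S.rightHom z = 1 → z ∈ Subgroup.center G ∧ z * z = 1 := by
    intro z hz
    have hz' : z ∈ S.inl.range := by rw [S.range_inl_eq_ker_rightHom]; exact hz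
    refine ⟨hS hz', ?_⟩
    obtain ⟨ζ, rfl⟩ := hz'
    have hζ : ζ * ζ = 1 := by
      ext1
      have := ζ.2
      rw [mem_rootsOfUnity, pow_two] at this
      exact this
    rw [← map_mul, hζ, map_one]
  have hsq : ∀ a b : G, S.rightHom a = S.rightHom b → a * a = b * b := by
    intro a b hab
    obtain ⟨hc, h1⟩ := hker (a * b⁻¹) (by simp [hab])
    have ha : a = (a * b⁻¹) * b := by group
    have hcomm := Subgroup.mem_center_iff.mp hc b
    calc a * a = ((a * b⁻¹) * b) * ((a * b⁻¹) * b) := by rw [← ha]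
      _ = (a * b⁻¹) * (b * (a * b⁻¹)) * b := by group
      _ = (a * b⁻¹) * ((a * b⁻¹) * b) * b := by rw [hcomm]
      _ = ((a * b⁻¹) * (a * b⁻¹)) * (b * b) := by group
      _ = b * b := by rw [h1, one_mul]
  let half : Multiplicative F → Multiplicative F := fun t => Multiplicative.ofAdd (t.toAdd / 2)
  have half_mul : ∀ t, half t * half t = t := fun t => by
    apply Multiplicative.toAdd.injective
    simp [half]
  have half_map : ∀ s t, half (s * t) = half s * half t := fun s t => by
    apply Multiplicative.toAdd.injective
    simp [half, add_div]
  choose σ hσ using fun t => S.rightHom_surjective (f t)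
  have hcomm : ∀ s t, σ s * (σ t * σ t) = (σ t * σ t) * σ s := by
    intro s t
    have := hsq (σ s * σ t * (σ s)⁻¹) (σ t) (by
      rw [map_mul, map_mul, map_inv, hσ, hσ, ← map_mul, mul_comm s t, map_mul,
        mul_inv_cancel_right])
    calc σ s * (σ t * σ t) = (σ s * σ t * (σ s)⁻¹) * (σ s * σ t * (σ s)⁻¹) * σ s := by group
      _ = σ t * σ t * σ s := by rw [this]
  have hsplit : ∀ s t, σ s * σ t = σ t * σ s := by
    intro s t
    obtain ⟨hc, -⟩ := hker (σ t * (σ (half t) * σ (half t))⁻¹) (by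
      rw [map_mul, map_inv, map_mul, hσ, hσ, ← map_mul, half_mul, mul_inv_cancel])
    have ht : σ t = (σ t * (σ (half t) * σ (half t))⁻¹) * (σ (half t) * σ (half t)) := by group
    have h1 := Subgroup.mem_center_iff.mp hc (σ s)
    rw [ht, ← mul_assoc, h1, mul_assoc, hcomm, ← mul_assoc]
  refine ⟨{ toFun := fun t => σ (half t) * σ (half t), map_one' := ?_, map_mul' := ?_ }, ?_, ?_⟩
  · have := hsq (σ (half 1)) 1 (by
      rw [hσ, map_one]
      have : half 1 = 1 := by
        apply Multiplicative.toAdd.injective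
        simp [half]
      rw [this, map_one])
    simpa using this
  · intro s t
    have h1 := hsq (σ (half (s * t))) (σ (half s) * σ (half t)) (by
      rw [map_mul, hσ, hσ, hσ, half_map, map_mul])
    rw [h1, mul_assoc, ← mul_assoc (σ (half t)), hsplit (half t) (half s)]
    group
  · refine MonoidHom.ext fun t => ?_
    change S.rightHom (σ (half t) * σ (half t)) = f t
    rw [map_mul, hσ, ← map_mul, half_mul]
  · intro g hg
    refine MonoidHom.ext fun t => ?_
    change g t = σ (half t) * σ (half t)
    have h1 : g t = g (half t) * g (half t) := by rw [← map_mul, half_mul]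
    rw [h1]
    apply hsq
    rw [hσ, ← hg]
    rfl

/-- The unique lift of a homomorphism from the additive group of `F` to a central extension
by `μ₂`. -/
noncomputable def lift (hS : IsCentral S) (f : Multiplicative F →* Q) : Multiplicative F →* G :=
  (existsUnique_lift hS f).choose

theorem rightHom_comp_lift (hS : IsCentral S) (f : Multiplicative F →* Q) :
    S.rightHom.comp (lift hS f) = f :=
  (existsUnique_lift hS f).choose_spec.1

end Lift

section Cover

variable {F L : Type*} [Field F] [CharZero F] [LieRing L] [LieAlgebra F L]
  [FiniteDimensional F L] [IsKilling F L] {H : LieSubalgebra F L} [H.IsCartanSubalgebra]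
  [LieModule.IsTriangularizable F H L] {B : ChevalleyBasis H}
  {V : Type*} [AddCommGroup V] [Module F V] [LieRingModule L V]
  [LieModule F L V] [FiniteDimensional F V]
  {G : Type*} [Group G] {S : GroupExtension (rootsOfUnity 2 F) G (B.group V)}
  (hS : IsCentral S)

/-- The lift of `x_α(t)` to the central extension `G`. -/
noncomputable def xLift (α : H.root) (t : F) : G :=
  lift hS (B.x V α) (Multiplicative.ofAdd t)

/-- `w_α(t) = x_α(t) x_{-α}(-t⁻¹) x_α(t)` in `G`. -/
noncomputable def wLift (α : H.root) (t : Fˣ) : G :=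
  xLift hS α t * xLift hS (negRoot α) (-(t⁻¹ : Fˣ)) * xLift hS α t

/-- `h_α(t) = w_α(t) w_α(-1)` in `G`. -/
noncomputable def hLift (α : H.root) (t : Fˣ) : G :=
  wLift hS α t * wLift hS α (-1)

/-- The metaplectic torus `T`, generated by all `h_α(t)`. -/
def torus : Subgroup G :=
  Subgroup.closure {g | ∃ (α : H.root) (t : Fˣ), g = hLift hS α t}

/-- The center `Z_T` of `T`, as a subgroup of `G`. -/
def torusCenter : Subgroup G :=
  torus hS ⊓ Subgroup.centralizer (torus hS : Set G)

/-- The group `T²` generated by all `h_α(t²)`. -/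
def torusSq : Subgroup G :=
  Subgroup.closure {g | ∃ (α : H.root) (t : Fˣ), g = hLift hS α (t ^ 2)}

/-- The group `N` generated by all `w_α(t)`; the Weyl group `W` is the quotient of `N` by `T`, and
it acts on `Z_T` through conjugation by elements of `N`. -/
def weylLift : Subgroup G :=
  Subgroup.closure {g | ∃ (α : H.root) (t : Fˣ), g = wLift hS α t}

/-- The product of the elements `h_α(t)` over a list of roots `α`. For a list enumerating a set `A`
of vertices of the Dynkin diagram this is `h_A(t)`. -/
noncomputable def hProd (l : List H.root) (t : Fˣ) : G :=
  (l.map fun α => hLift hS α t).prod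

end Cover

section Dynkin

variable {ι R M N : Type*} [Finite ι] [Field R] [CharZero R] [AddCommGroup M] [Module R M]
  [AddCommGroup N] [Module R N] {P : RootPairing ι R M N} [P.IsCrystallographic]

/-- The graph underlying the Dynkin diagram: the vertices are the simple roots, and two distinct
vertices are adjacent when the corresponding simple roots are not orthogonal. -/
def dynkinGraph (b : P.Base) : SimpleGraph b.support where
  Adj i j := i ≠ j ∧ b.cartanMatrix i j ≠ 0
  symm := ⟨fun _ _ h => ⟨h.1.symm, fun h0 => h.2 (P.pairingIn_eq_zero_iff.mp h0)⟩⟩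
  loopless := ⟨fun _ h => h.1 rfl⟩

/-- No two vertices in `S` are adjacent, and every vertex not in `S` is adjacent to an even number
of vertices in `S`. -/
def IsAdmissible (b : P.Base) (S : Set b.support) : Prop :=
  (∀ i ∈ S, ∀ j ∈ S, ¬ (dynkinGraph b).Adj i j) ∧
    ∀ i ∉ S, Even {j | j ∈ S ∧ (dynkinGraph b).Adj i j}.ncard

end Dynkin

end Metaplectic

/-! Everything rests on the relation `h_β(t) w_α(u) h_β(t)⁻¹ = w_α(t^⟨α,β⟩ u)`. It holds in `G`
itself, not only in the Chevalley group, because a homomorphism from the additive group of `F` has a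
single lift (`conj_xLift`, `hLift_conj_wLift`). Hence every `z ∈ T` has, for each root `α`, a scalar
`c` with `z w_α(u) z⁻¹ = w_α(c u)`, and then `w_α(1) z w_α(1)⁻¹ z⁻¹ = h_α(c)⁻¹`
(`wLift_conj_mul_inv`). Both claims reduce to `c` being a square. For `h_S(t)` the scalar is `t` to
the power `∑ ⟨α,β⟩` over `β ∈ S`, and admissibility makes this sum even.

Let `z ∈ Z_T`. If all `⟨α,β⟩` are even (as in rank one), `c` is a square at once. Otherwise some
`⟨α,β⟩` is `±1`. Commuting with `h_α(s)` forces `h_α(c s) = h_α(s) h_α(c)`, so `c` lies in the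
radical of the cocycle `κ(s,t) = h_α(s) h_α(t) h_α(st)⁻¹`. This cocycle is also a commutator of
torus elements, hence bimultiplicative, and it satisfies the Steinberg relation
(`exists_steinberg_symbol`).

A nontrivial Steinberg symbol with values in `μ₂` on a local field has only squares in its radical
(`isSquare_of_steinberg`). This is derived from the Steinberg relation alone, separately for
archimedean fields, odd residue characteristic and residue characteristic two.

The symbol is not trivial: triviality for one root spreads to all simple roots, and then the
extension splits (`nonempty_splitting_of_hLift_mul`). Indeed a Bruhat decomposition in `G` reduces
the intersection of the group generated by root elements with `μ₂` to the unipotent group and the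
torus. Both embed in the Chevalley group, the first by a grading of `End V`, the second because the
weights of `V` generate all integral weights.

The action of `h_α(t)` on weight vectors, used throughout, comes from a differential equation for `t
↦ w_α(t)`, treated with Laurent polynomials. -/

set_option linter.unusedSectionVars false

namespace Metaplectic

/-! ### Exponentials of nilpotent elements: conjugation and derivations -/

section Exponential

variable {A : Type*} [Ring A] [Module ℚ A]

/-- This is `exp(a) b exp(-a) = b + [a,b] + ½[a,[a,b]]`; the series stops there because `d =
½[a,[a,b]]` commutes with `a`. Coefficients are compared by means of a closed formula for `a^k b`.
-/
theorem exp_mul_of_commutator {a b c d : A} (ha : IsNilpotent a) (h1 : a * b - b * a = c)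
    (h2 : a * c - c * a = (2 : ℚ) • d) (h3 : Commute a d) :
    IsNilpotent.exp a * b = (b + c + d) * IsNilpotent.exp a := by
  obtain ⟨N, hN⟩ := ha
  have hpow : ∀ k : ℕ, a ^ (k + 2) * b = b * a ^ (k + 2) + ((k : ℚ) + 2) • (c * a ^ (k + 1)) +
      (((k : ℚ) + 2) * (k + 1)) • (d * a ^ k) := by
    have hab : a * b = b * a + c := by rw [← h1]; abel
    have hac : a * c = c * a + (2 : ℚ) • d := by rw [← h2]; abel
    intro k
    induction k with
    | zero =>
      simp only [pow_succ, pow_zero, one_mul, Nat.cast_zero, mul_one]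
      rw [mul_assoc a a b, hab, mul_add, ← mul_assoc a b a, hab, add_mul, hac, mul_assoc b a a]
      module
    | succ k ih =>
      have e : a ^ (k + 1 + 2) * b = a * (a ^ (k + 2) * b) := by rw [← mul_assoc, ← pow_succ']
      rw [e, ih, mul_add, mul_add, mul_smul_comm, mul_smul_comm, ← mul_assoc, ← mul_assoc,
        ← mul_assoc, hab, hac, h3.eq, add_mul, add_mul, smul_mul_assoc,
        mul_assoc b, mul_assoc c, mul_assoc d, ← pow_succ', ← pow_succ', ← pow_succ']
      push_cast
      module
  have hE : ∀ M, N ≤ M → IsNilpotent.exp a =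
      ∑ i ∈ Finset.range M, (i.factorial : ℚ)⁻¹ • a ^ i := fun M hM =>
    IsNilpotent.exp_eq_sum (pow_eq_zero_of_le hM hN)
  have hterm : ∀ k : ℕ, ((k + 2).factorial : ℚ)⁻¹ • a ^ (k + 2) * b =
      b * (((k + 2).factorial : ℚ)⁻¹ • a ^ (k + 2)) +
      c * (((k + 1).factorial : ℚ)⁻¹ • a ^ (k + 1)) + d * ((k.factorial : ℚ)⁻¹ • a ^ k) := by
    intro k
    have e1 : ((k + 1).factorial : ℚ)⁻¹ = ((k + 2).factorial : ℚ)⁻¹ * ((k : ℚ) + 2) := by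
      rw [Nat.factorial_succ (k + 1)]
      push_cast
      have : ((k + 1).factorial : ℚ) ≠ 0 := by positivity
      field_simp
      ring
    have e2 : (k.factorial : ℚ)⁻¹ =
        ((k + 2).factorial : ℚ)⁻¹ * (((k : ℚ) + 2) * (k + 1)) := by
      rw [Nat.factorial_succ (k + 1), Nat.factorial_succ k]
      push_cast
      have : (k.factorial : ℚ) ≠ 0 := by positivity
      field_simp
      ring
    rw [smul_mul_assoc, hpow, e1, e2]
    simp only [mul_smul_comm, smul_add, smul_smul]
  -- The sums for `c` and `d` start one and two terms later, so the truncations end at `N + 2`, `N +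
  -- 1` and `N`; each is long enough to be the full exponential.
  calc IsNilpotent.exp a * b
      = (∑ i ∈ Finset.range N, ((i + 2).factorial : ℚ)⁻¹ • a ^ (i + 2)) * b + a * b + b := by
        rw [hE (N + 2) (by omega), Finset.sum_range_succ', Finset.sum_range_succ']
        simp [add_mul]
    _ = b * (∑ i ∈ Finset.range N, ((i + 2).factorial : ℚ)⁻¹ • a ^ (i + 2)) +
        c * (∑ i ∈ Finset.range N, ((i + 1).factorial : ℚ)⁻¹ • a ^ (i + 1)) +
        d * (∑ i ∈ Finset.range N, (i.factorial : ℚ)⁻¹ • a ^ i) + (b * a + c) + b := by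
        rw [Finset.sum_mul, Finset.sum_congr rfl fun k _ => hterm k, Finset.sum_add_distrib,
          Finset.sum_add_distrib, Finset.mul_sum, Finset.mul_sum, Finset.mul_sum]
        have : a * b = b * a + c := by rw [← h1]; abel
        rw [this]
    _ = b * (∑ i ∈ Finset.range (N + 2), (i.factorial : ℚ)⁻¹ • a ^ i) +
        c * (∑ i ∈ Finset.range (N + 1), (i.factorial : ℚ)⁻¹ • a ^ i) +
        d * (∑ i ∈ Finset.range N, (i.factorial : ℚ)⁻¹ • a ^ i) := by
        rw [Finset.sum_range_succ' _ (N + 1), Finset.sum_range_succ' _ N,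
          Finset.sum_range_succ' _ N]
        simp only [zero_add, Nat.factorial_one, Nat.factorial_zero, Nat.cast_one, inv_one,
          pow_one, pow_zero, one_smul, mul_add, mul_one]
        abel
    _ = (b + c + d) * IsNilpotent.exp a := by
        rw [← hE _ (by omega), ← hE _ (by omega), ← hE _ le_rfl, add_mul, add_mul]

/-- The chain rule for a derivation, valid because `D a` commutes with `a`. -/
theorem map_exp_of_leibniz (D : A →+ A) (hD : ∀ x y, D (x * y) = D x * y + x * D y) {a c : A}
    (ha : IsNilpotent a) (hDa : D a = c) (hc : Commute a c) :
    D (IsNilpotent.exp a) = c * IsNilpotent.exp a := by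
  obtain ⟨N, hN⟩ := ha
  have hD1 : D 1 = 0 := by simpa using hD 1 1
  have hpow : ∀ k : ℕ, D (a ^ (k + 1)) = ((k : ℚ) + 1) • (c * a ^ k) := by
    intro k
    induction k with
    | zero => simp [hDa]
    | succ k ih =>
      rw [pow_succ, hD, ih, hDa, smul_mul_assoc, mul_assoc, ← pow_succ, (hc.pow_left _).eq]
      push_cast
      module
  have hterm : ∀ k : ℕ, D (((k + 1).factorial : ℚ)⁻¹ • a ^ (k + 1)) =
      c * ((k.factorial : ℚ)⁻¹ • a ^ k) := by
    intro k
    rw [map_rat_smul, hpow, smul_smul, mul_smul_comm, Nat.factorial_succ]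
    congr 1
    push_cast
    have : (k.factorial : ℚ) ≠ 0 := by positivity
    field_simp
  conv_lhs => rw [IsNilpotent.exp_eq_sum (pow_eq_zero_of_le (Nat.le_succ N) hN)]
  rw [IsNilpotent.exp_eq_sum hN, map_sum, Finset.sum_range_succ', Finset.mul_sum,
    Finset.sum_congr rfl fun k _ => hterm k]
  simp [hD1]

end Exponential

/-! ### Laurent polynomials over a noncommutative ring -/

section Laurent

open LaurentPolynomial

variable {R : Type*} [Ring R]

/-- The derivation `T d/dT` of the ring of Laurent polynomials. -/
noncomputable def euler (R : Type*) [Ring R] : R[T;T⁻¹] →+ R[T;T⁻¹] where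
  toFun p := .ofCoeff (Finsupp.onFinset p.coeff.support (fun n => n • p.coeff n)
    fun n hn => by
      rw [Finsupp.mem_support_iff]
      rintro h
      simp [h] at hn)
  map_zero' := by
    ext n
    simp
  map_add' p q := by
    ext n
    simp

theorem coeff_euler (p : R[T;T⁻¹]) (n : ℤ) : (euler R p).coeff n = n • p.coeff n := rfl

theorem euler_C_mul_T (a : R) (n : ℤ) : euler R (C a * T n) = n • (C a * T n) := by
  ext m
  rw [coeff_euler, ← single_eq_C_mul_T]
  by_cases h : n = m
  · subst h; simp [-single_eq_C_mul_T]
  · simp [-single_eq_C_mul_T, h]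

theorem euler_mul (p q : R[T;T⁻¹]) : euler R (p * q) = euler R p * q + p * euler R q := by
  induction p using LaurentPolynomial.induction_on' with
  | add p p' hp hp' => simp only [add_mul, map_add, hp, hp']; abel
  | C_mul_T n a =>
    induction q using LaurentPolynomial.induction_on' with
    | add q q' hq hq' => simp only [mul_add, map_add, hq, hq']; abel
    | C_mul_T m b =>
      have e : C a * T n * (C b * T m) = C (a * b) * T (n + m) := by
        rw [T_add, map_mul, mul_assoc, ← mul_assoc (T n), T_mul n (C b)]
        simp only [mul_assoc]
      rw [e, euler_C_mul_T, euler_C_mul_T, euler_C_mul_T, smul_mul_assoc, mul_smul_comm, e,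
        add_smul]

/-- Evaluation of a Laurent polynomial with coefficients in an algebra at an invertible scalar. -/
noncomputable def evalScalar {F : Type*} [Field F] [Algebra F R] (t : Fˣ) : R[T;T⁻¹] →+* R :=
  AddMonoidAlgebra.liftNCRingHom (RingHom.id R)
    ((algebraMap F R : F →* R).comp ((Units.coeHom F).comp (zpowersHom Fˣ t)))
    fun x _ => (Algebra.commutes _ x).symm

theorem evalScalar_C_mul_T {F : Type*} [Field F] [Algebra F R] (t : Fˣ) (a : R) (n : ℤ) :
    evalScalar t (C a * T n) = (t ^ n : F) • a := by
  rw [← single_eq_C_mul_T, Algebra.smul_def, Algebra.commutes]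
  exact (AddMonoidAlgebra.liftNC_single _ _ _ _).trans (by simp)

theorem evalScalar_eq_sum {F : Type*} [Field F] [Algebra F R] (t : Fˣ) (p : R[T;T⁻¹]) :
    evalScalar t p = p.coeff.sum fun n a => (t ^ n : F) • a := by
  induction p using LaurentPolynomial.induction_on' with
  | add p q hp hq =>
    rw [map_add, hp, hq, AddMonoidAlgebra.coeff_add, Finsupp.sum_add_index']
    · simp
    · intros; rw [smul_add]
  | C_mul_T n a =>
    rw [evalScalar_C_mul_T, ← single_eq_C_mul_T]
    simp [-single_eq_C_mul_T]

end Laurent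

/-! ### Weyl elements of an `sl₂`-triple in an associative ring -/

section SlTwoRing

variable {A : Type*} [Ring A] [Module ℚ A] {e f h τ σ : A}

/-- An `sl₂`-triple in an associative ring with nilpotent `e` and `f`. -/
structure IsNilpotentSlTwo (e f h : A) : Prop where
  e_mul_f : e * f - f * e = h
  h_mul_e : h * e - e * h = 2 * e
  h_mul_f : h * f - f * h = -(2 * f)
  nilpotent_e : IsNilpotent e
  nilpotent_f : IsNilpotent f

namespace IsNilpotentSlTwo

omit [Module ℚ A] in
theorem symm (H : IsNilpotentSlTwo e f h) : IsNilpotentSlTwo f e (-h) where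
  e_mul_f := by rw [← H.e_mul_f]; abel
  h_mul_e := by
    have := H.h_mul_f
    rw [neg_mul, mul_neg, ← neg_eq_iff_eq_neg.mpr this]
    abel
  h_mul_f := by
    have := H.h_mul_e
    rw [neg_mul, mul_neg, ← this]
    abel
  nilpotent_e := H.nilpotent_f
  nilpotent_f := H.nilpotent_e

omit [Module ℚ A] in
-- The central element `τ` stands for a scalar as well as for the Laurent variable, so that the
-- identities below serve in both settings.
theorem isNilpotent_mul_e (H : IsNilpotentSlTwo e f h) (hτ : ∀ x, Commute τ x) :
    IsNilpotent (τ * e) :=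
  (hτ e).isNilpotent_mul_left H.nilpotent_e

theorem exp_mul_e (hτ : ∀ x, Commute τ x) :
    IsNilpotent.exp (τ * e) * e = e * IsNilpotent.exp (τ * e) := by
  have hc : Commute (τ * e) e := (hτ e).mul_left (Commute.refl e)
  exact (Commute.sum_left _ _ _ fun i _ => (hc.pow_left i).smul_left _).eq

theorem exp_mul_h (H : IsNilpotentSlTwo e f h) (hτ : ∀ x, Commute τ x) :
    IsNilpotent.exp (τ * e) * h = (h - 2 * (τ * e)) * IsNilpotent.exp (τ * e) := by
  have h1 : (τ * e) * h - h * (τ * e) = -(2 * (τ * e)) := by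
    rw [← mul_assoc h, ← (hτ h).eq, mul_assoc, mul_assoc, ← mul_sub, ← neg_sub, H.h_mul_e,
      two_mul, two_mul, mul_neg, mul_add]
  have := exp_mul_of_commutator (d := 0) (H.isNilpotent_mul_e hτ) h1
    (by rw [mul_neg, neg_mul, two_mul, mul_add, add_mul, sub_self, smul_zero])
    (Commute.zero_right _)
  rw [this]
  abel_nf

theorem exp_mul_f (H : IsNilpotentSlTwo e f h) (hτ : ∀ x, Commute τ x) :
    IsNilpotent.exp (τ * e) * f = (f + τ * h - τ * τ * e) * IsNilpotent.exp (τ * e) := by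
  have h1 : (τ * e) * f - f * (τ * e) = τ * h := by
    rw [← mul_assoc f, ← (hτ f).eq, mul_assoc, mul_assoc, ← mul_sub, H.e_mul_f]
  have h2 : (τ * e) * (τ * h) - (τ * h) * (τ * e) = (2 : ℚ) • (-(τ * τ * e)) := by
    have e1 : (τ * e) * (τ * h) = τ * τ * (e * h) := by
      rw [mul_assoc, ← mul_assoc e, ← (hτ e).eq]; simp only [mul_assoc]
    have e2 : (τ * h) * (τ * e) = τ * τ * (h * e) := by
      rw [mul_assoc, ← mul_assoc h, ← (hτ h).eq]; simp only [mul_assoc]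
    rw [e1, e2, ← mul_sub, ← neg_sub, H.h_mul_e, two_mul, mul_neg, mul_add, two_smul]
    abel
  rw [exp_mul_of_commutator (H.isNilpotent_mul_e hτ) h1 h2
    (((hτ _).mul_left ((((hτ e).symm.mul_right (hτ e).symm).mul_right
      (Commute.refl e)))).neg_right)]
  rw [← sub_eq_add_neg]

/-- The Weyl element `exp (τ e) exp (-τ⁻¹ f) exp (τ e)`. -/
noncomputable def weyl (e f τ σ : A) : A :=
  IsNilpotent.exp (τ * e) * IsNilpotent.exp (-σ * f) * IsNilpotent.exp (τ * e)

variable (H : IsNilpotentSlTwo e f h) (hτ : ∀ x, Commute τ x) (hσ : ∀ x, Commute σ x)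
  (hτσ : τ * σ = 1)

include H hτ hσ hτσ

/-- By `exp_mul_f` for the opposite triple, passing `exp(-σf)` turns `e` into `e + σh - σ²f`.
Passing `exp(τe)` then cancels everything but `-σ²f`, because `τσ = 1`. -/
theorem exp_mul_exp_mul_e :
    IsNilpotent.exp (τ * e) * IsNilpotent.exp (-σ * f) * e =
      -(σ * σ * f) * IsNilpotent.exp (τ * e) * IsNilpotent.exp (-σ * f) := by
  have hσ' : ∀ x, Commute (-σ) x := fun x => (hσ x).neg_left
  have h1 := H.symm.exp_mul_f hσ'
  set E := IsNilpotent.exp (τ * e)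
  set S := IsNilpotent.exp (-σ * f)
  have h2 : E * (e + -σ * -h - -σ * -σ * f) = -(σ * σ * f) * E := by
    have k1 : E * e = e * E := exp_mul_e hτ
    have k2 : E * h = (h - 2 * (τ * e)) * E := H.exp_mul_h hτ
    have k3 : E * f = (f + τ * h - τ * τ * e) * E := H.exp_mul_f hτ
    have k4 : E * (e + -σ * -h - -σ * -σ * f) = E * e + σ * (E * h) - σ * σ * (E * f) := by
      rw [neg_mul_neg, neg_mul_neg, mul_sub, mul_add, ← mul_assoc E, ← (hσ E).eq, ← mul_assoc E,
        ← ((hσ E).mul_left (hσ E)).eq]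
      simp only [mul_assoc]
    have k5 : σ * (2 * (τ * e)) = 2 * e := by
      rw [two_mul, mul_add, ← mul_assoc, ← (hτ σ).eq, hτσ, one_mul, two_mul]
    have k6 : σ * σ * (τ * h) = σ * h := by
      rw [mul_assoc, ← mul_assoc σ τ, ← (hτ σ).eq, hτσ, one_mul]
    have k7 : σ * σ * (τ * τ * e) = e := by
      rw [mul_assoc, mul_assoc τ τ, ← mul_assoc σ τ, ← (hτ σ).eq, hτσ, one_mul, ← mul_assoc,
        ← (hτ σ).eq, hτσ, one_mul]
    rw [k4, k1, k2, k3, ← mul_assoc σ _ E, ← mul_assoc (σ * σ) _ E, mul_sub σ, mul_sub (σ * σ),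
      mul_add (σ * σ), k5, k6, k7, ← add_mul, ← sub_mul]
    congr 1
    rw [two_mul]
    abel
  rw [mul_assoc, h1, ← mul_assoc, h2]

theorem weyl_mul_e : weyl e f τ σ * e = -(σ * σ * f) * weyl e f τ σ := by
  rw [weyl, mul_assoc, exp_mul_e hτ, ← mul_assoc, H.exp_mul_exp_mul_e hτ hσ hτσ]
  simp only [mul_assoc]

/-- The product `exp(τe) exp(-σf)` conjugates `τe` to `-σf`, hence also their exponentials. The
resulting braid relation exchanges `e` and `f`, so facts about one yield facts about the other. -/
theorem weyl_eq : weyl e f τ σ = weyl f e (-σ) (-τ) := by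
  have h1 := H.exp_mul_exp_mul_e hτ hσ hτσ
  have hσ' : ∀ x, Commute (-σ) x := fun x => (hσ x).neg_left
  set E := IsNilpotent.exp (τ * e) with hE
  set S := IsNilpotent.exp (-σ * f) with hS
  have hES : IsUnit (E * S) := (IsNilpotent.isUnit_exp (H.isNilpotent_mul_e hτ)).mul
    (IsNilpotent.isUnit_exp (H.symm.isNilpotent_mul_e hσ'))
  have h2 : E * S * (τ * e) = (-σ * f) * (E * S) := by
    have k : τ * -(σ * σ * f) = -σ * f := by
      rw [mul_neg, ← mul_assoc, ← mul_assoc, hτσ, one_mul, neg_mul]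
    rw [← mul_assoc, ← (hτ (E * S)).eq, mul_assoc τ, h1, ← mul_assoc τ, ← mul_assoc τ, k,
      mul_assoc]
  have h3 : ∀ k : ℕ, E * S * (τ * e) ^ k = (-σ * f) ^ k * (E * S) := by
    intro k
    induction k with
    | zero => simp
    | succ k ih => rw [pow_succ, ← mul_assoc, ih, mul_assoc, h2, ← mul_assoc, ← pow_succ]
  obtain ⟨N, hN⟩ := H.isNilpotent_mul_e hτ
  obtain ⟨M, hM⟩ := H.symm.isNilpotent_mul_e hσ'
  have h4 : E * S * E = S * (E * S) := by
    have e1 : E = ∑ i ∈ Finset.range (N + M), (i.factorial : ℚ)⁻¹ • (τ * e) ^ i :=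
      IsNilpotent.exp_eq_sum (pow_eq_zero_of_le (by omega) hN)
    have e2 : S = ∑ i ∈ Finset.range (N + M), (i.factorial : ℚ)⁻¹ • (-σ * f) ^ i :=
      IsNilpotent.exp_eq_sum (pow_eq_zero_of_le (by omega) hM)
    calc E * S * E = E * S * ∑ i ∈ Finset.range (N + M), (i.factorial : ℚ)⁻¹ • (τ * e) ^ i := by
          rw [← e1]
      _ = (∑ i ∈ Finset.range (N + M), (i.factorial : ℚ)⁻¹ • (-σ * f) ^ i) * (E * S) := by
          rw [Finset.mul_sum, Finset.sum_mul]
          exact Finset.sum_congr rfl fun i _ => by rw [mul_smul_comm, h3, smul_mul_assoc]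
      _ = S * (E * S) := by rw [← e2]
  rw [weyl, weyl, neg_neg, ← hE, ← hS, h4, mul_assoc]

theorem weyl_mul_f : weyl e f τ σ * f = -(τ * τ * e) * weyl e f τ σ := by
  rw [H.weyl_eq hτ hσ hτσ, H.symm.weyl_mul_e (fun x => (hσ x).neg_left)
    (fun x => (hτ x).neg_left) (by rw [neg_mul_neg, ← (hτ σ).eq, hτσ])]
  simp only [neg_mul_neg]

theorem weyl_mul_h : weyl e f τ σ * h = -h * weyl e f τ σ := by
  have k : τ * τ * (σ * σ) = 1 := by
    rw [mul_assoc, ← mul_assoc τ σ, hτσ, one_mul, hτσ]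
  have hτ2 : ∀ x, Commute (τ * τ) x := fun x => (hτ x).mul_left (hτ x)
  have hσ2 : ∀ x, Commute (σ * σ) x := fun x => (hσ x).mul_left (hσ x)
  have h1 := H.weyl_mul_e hτ hσ hτσ
  have h2 := H.weyl_mul_f hτ hσ hτσ
  have e1 : σ * σ * f * (τ * τ * e) = f * e := by
    rw [(hσ2 f).eq, mul_assoc, ← mul_assoc (σ * σ), ← (hτ2 _).eq, k, one_mul]
  have e2 : τ * τ * e * (σ * σ * f) = e * f := by
    rw [(hτ2 e).eq, mul_assoc, ← mul_assoc (τ * τ), k, one_mul]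
  have e3 : weyl e f τ σ * (e * f) = f * e * weyl e f τ σ := by
    rw [← mul_assoc, h1, mul_assoc, h2, ← mul_assoc (-(σ * σ * f)), neg_mul_neg, e1]
  have e4 : weyl e f τ σ * (f * e) = e * f * weyl e f τ σ := by
    rw [← mul_assoc, h2, mul_assoc, h1, ← mul_assoc (-(τ * τ * e)), neg_mul_neg, e2]
  rw [← H.e_mul_f, mul_sub, e3, e4, ← sub_mul, neg_sub]

end IsNilpotentSlTwo

end SlTwoRing

/-! ### Laurent expansion of torus elements -/

section SlTwoLaurent

open LaurentPolynomial

variable {R : Type*} [Ring R] [Module ℚ R] {e f h : R}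

namespace IsNilpotentSlTwo

omit [Module ℚ R] in
theorem map {S : Type*} [Ring S] (H : IsNilpotentSlTwo e f h) (φ : R →+* S) :
    IsNilpotentSlTwo (φ e) (φ f) (φ h) where
  e_mul_f := by rw [← H.e_mul_f, map_sub, map_mul, map_mul]
  h_mul_e := by rw [← map_mul, ← map_mul, ← map_sub, H.h_mul_e, map_mul, map_ofNat]
  h_mul_f := by rw [← map_mul, ← map_mul, ← map_sub, H.h_mul_f, map_neg, map_mul, map_ofNat]
  nilpotent_e := H.nilpotent_e.map φ
  nilpotent_f := H.nilpotent_f.map φ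

/-- In the Leibniz rule, after everything is moved to the left, the three factors contribute `τe`,
`σf + h - τe` and `-σf`, whose sum is `h`. So the Weyl element solves `T dW/dT = h W`. -/
theorem euler_weyl (H : IsNilpotentSlTwo e f h) :
    euler R (weyl (C e) (C f) (T 1) (T (-1))) = C h * weyl (C e) (C f) (T 1) (T (-1)) := by
  have HC := H.map (C : R →+* R[T;T⁻¹])
  have hτ : ∀ x : R[T;T⁻¹], Commute (T 1) x := commute_T 1
  have hσ : ∀ x : R[T;T⁻¹], Commute (T (-1)) x := commute_T (-1)
  have hτσ : (T 1 * T (-1) : R[T;T⁻¹]) = 1 := by rw [← T_add]; simp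
  have hσ' : ∀ x : R[T;T⁻¹], Commute (-T (-1)) x := fun x => (hσ x).neg_left
  have d1 : euler R (T 1 * C e) = T 1 * C e := by
    rw [T_mul, euler_C_mul_T, one_smul]
  have d2 : euler R (-T (-1) * C f) = T (-1) * C f := by
    rw [neg_mul, map_neg, T_mul, euler_C_mul_T, neg_smul, one_smul, neg_neg]
  have hE := map_exp_of_leibniz (euler R) euler_mul (HC.isNilpotent_mul_e hτ) d1 (Commute.refl _)
  have hS := map_exp_of_leibniz (euler R) euler_mul (HC.symm.isNilpotent_mul_e hσ') d2
    (by rw [neg_mul]; exact (Commute.refl _).neg_left)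
  have hwe := HC.weyl_mul_e hτ hσ hτσ
  have hEf := HC.exp_mul_f hτ
  rw [weyl] at hwe ⊢
  set E := IsNilpotent.exp (T 1 * C e : R[T;T⁻¹])
  set S := IsNilpotent.exp (-T (-1) * C f : R[T;T⁻¹])
  have c1 : E * C e = C e * E := exp_mul_e hτ
  have k1 : E * (T (-1) * C f * S) * E = (T (-1) * C f + C h - T 1 * C e) * (E * S * E) := by
    have : E * (T (-1) * C f * S) * E = T (-1) * (E * C f) * (S * E) := by
      rw [← mul_assoc E, ← mul_assoc E, ← (hσ E).eq]; simp only [mul_assoc]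
    rw [this, hEf, ← mul_assoc (T (-1)), mul_sub, mul_add, ← mul_assoc (T (-1)) (T 1),
      ← mul_assoc (T (-1)) (T 1 * T 1), ← mul_assoc (T (-1)) (T 1), ← (hτ _).eq, hτσ, one_mul,
      one_mul]
    simp only [mul_assoc]
  have k2 : E * S * (T 1 * C e * E) = -(T (-1) * C f) * (E * S * E) := by
    have : E * S * (T 1 * C e * E) = T 1 * (E * S * E * C e) := by
      rw [mul_assoc (T 1), ← c1, ← mul_assoc, ← (hτ (E * S)).eq]
      simp only [mul_assoc]
    rw [this, hwe, ← mul_assoc (T 1), mul_neg, ← mul_assoc (T 1), ← mul_assoc (T 1), hτσ, one_mul]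
  rw [euler_mul, euler_mul, hE, hS, add_mul, k1, k2, mul_assoc (T 1 * C e), mul_assoc (T 1 * C e),
    ← add_mul, ← add_mul]
  congr 1
  abel

variable {F : Type*} [Field F] [Algebra F R]

theorem evalScalar_weyl (H : IsNilpotentSlTwo e f h) (t : Fˣ) :
    evalScalar t (weyl (C e) (C f) (T 1) (T (-1)) : R[T;T⁻¹]) =
      weyl e f (algebraMap F R t) (algebraMap F R (t⁻¹ : Fˣ)) := by
  have HC := H.map (C : R →+* R[T;T⁻¹])
  have hτ : ∀ x : R[T;T⁻¹], Commute (T 1) x := commute_T 1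
  have hσ' : ∀ x : R[T;T⁻¹], Commute (-T (-1)) x := fun x => (commute_T (-1) x).neg_left
  have e1 : evalScalar t (T 1 * C e : R[T;T⁻¹]) = algebraMap F R t * e := by
    rw [T_mul, evalScalar_C_mul_T, zpow_one, Algebra.smul_def]
  have e2 : evalScalar t (-T (-1) * C f : R[T;T⁻¹]) = -algebraMap F R (t⁻¹ : Fˣ) * f := by
    rw [neg_mul, map_neg, T_mul, evalScalar_C_mul_T, zpow_neg_one, Algebra.smul_def, neg_mul,
      Units.val_inv_eq_inv_val]
  rw [weyl, weyl, map_mul, map_mul, IsNilpotent.map_exp (HC.isNilpotent_mul_e hτ),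
    IsNilpotent.map_exp (HC.symm.isNilpotent_mul_e hσ'), e1, e2]

/-- The Laurent expansion of the torus element `weyl t * weyl (-1)`. -/
theorem exists_laurent_expansion (H : IsNilpotentSlTwo e f h) (g : R)
    (hg : g * h = -h * g) :
    ∃ a : ℤ →₀ R, (∀ n, h * a n = n • a n) ∧ (∀ n, a n * h = h * a n) ∧
      ∀ t : Fˣ, weyl e f (algebraMap F R t) (algebraMap F R (t⁻¹ : Fˣ)) * g =
        a.sum fun n b => (t ^ n : F) • b := by
  have HC := H.map (C : R →+* R[T;T⁻¹])
  let p : R[T;T⁻¹] := weyl (C e) (C f) (T 1) (T (-1)) * C g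
  have hD : euler R p = C h * p := by
    have : euler R (C g) = 0 := by simpa using euler_C_mul_T g 0
    rw [euler_mul, this, mul_zero, add_zero, H.euler_weyl, mul_assoc]
  have hcomm : p * C h = C h * p := by
    have h1 := HC.weyl_mul_h (commute_T 1) (commute_T (-1)) (by rw [← T_add]; simp)
    have h2 : C g * C h = -C h * C g := by rw [← map_neg, ← map_mul, ← map_mul, hg]
    rw [mul_assoc, h2, neg_mul, mul_neg, ← mul_assoc, h1, neg_mul, neg_mul, neg_neg, mul_assoc]
  have coeff_C_mul : ∀ (x : R) (q : R[T;T⁻¹]) (n : ℤ), (C x * q).coeff n = x * q.coeff n := by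
    intro x q n
    rw [← smul_eq_C_mul]
    rfl
  have coeff_mul_C : ∀ (x : R) (q : R[T;T⁻¹]) (n : ℤ), (q * C x).coeff n = q.coeff n * x := by
    intro x q n
    rw [← single_eq_C]
    exact AddMonoidAlgebra.coeff_mul_single_zero _ _ _
  -- The coefficient of `Tⁿ` in `T dp/dT = h p` says that the `n`-th coefficient of `p` takes values
  -- in the eigenspace of `h` for `n`.
  refine ⟨p.coeff, fun n => ?_, fun n => ?_, fun t => ?_⟩
  · rw [← coeff_C_mul, ← hD, coeff_euler]
  · rw [← coeff_C_mul h p, ← hcomm, coeff_mul_C h p]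
  · rw [← evalScalar_eq_sum, map_mul, H.evalScalar_weyl]
    congr 1
    simpa using (evalScalar_C_mul_T t g 0).symm

end IsNilpotentSlTwo

end SlTwoLaurent

/-! ### Exponentials of endomorphisms over `F` -/

section NilExp

variable {F V : Type*} [Field F] [CharZero F] [AddCommGroup V] [Module F V]

theorem nilExp_conj {A A' g : Module.End F V} (hA : IsNilpotent A) (hA' : IsNilpotent A')
    (h : g * A = A' * g) : g * nilExp A = nilExp A' * g := by
  let _ : Module ℚ (Module.End F V) := Module.compHom (Module.End F V) (algebraMap ℚ F)
  obtain ⟨N, hN⟩ := hA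
  obtain ⟨M, hM⟩ := hA'
  have hk : ∀ k : ℕ, g * A ^ k = A' ^ k * g := by
    intro k
    induction k with
    | zero => simp
    | succ k ih => rw [pow_succ, ← mul_assoc, ih, mul_assoc, h, ← mul_assoc, ← pow_succ]
  have e1 : nilExp A = ∑ i ∈ Finset.range (N + M), (i.factorial : ℚ)⁻¹ • A ^ i :=
    IsNilpotent.exp_eq_sum (pow_eq_zero_of_le (by omega) hN)
  have e2 : nilExp A' = ∑ i ∈ Finset.range (N + M), (i.factorial : ℚ)⁻¹ • A' ^ i :=
    IsNilpotent.exp_eq_sum (pow_eq_zero_of_le (by omega) hM)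
  rw [e1, e2, Finset.mul_sum, Finset.sum_mul]
  exact Finset.sum_congr rfl fun i _ => by rw [mul_smul_comm, hk, smul_mul_assoc]

theorem nilExp_eq_sum {A : Module.End F V} {N : ℕ} (hN : A ^ N = 0) :
    nilExp A = ∑ i ∈ Finset.range N, (i.factorial : F)⁻¹ • A ^ i := by
  let _ : Module ℚ (Module.End F V) := Module.compHom (Module.End F V) (algebraMap ℚ F)
  have e1 : nilExp A = ∑ i ∈ Finset.range N, (i.factorial : ℚ)⁻¹ • A ^ i :=
    IsNilpotent.exp_eq_sum hN
  rw [e1]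
  refine Finset.sum_congr rfl fun i _ => ?_
  change (algebraMap ℚ F (i.factorial : ℚ)⁻¹) • A ^ i = _
  simp

end NilExp

/-! ### Root vectors, Weyl elements and torus elements acting on `V` -/

section Representation

variable {F L : Type*} [Field F] [CharZero F] [LieRing L] [LieAlgebra F L]
  [FiniteDimensional F L] [IsKilling F L] {H : LieSubalgebra F L} [H.IsCartanSubalgebra]
  [LieModule.IsTriangularizable F H L] {B : ChevalleyBasis H}

@[simp]
theorem negRoot_negRoot (α : H.root) : negRoot (negRoot α) = α := by
  ext x
  simp [negRoot]

theorem coe_coroot_negRoot (α : H.root) : coroot (negRoot α).1 = -coroot α.1 :=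
  coroot_neg α.1

theorem isNonZero_root (α : H.root) : α.1.IsNonZero := by
  simpa only [LieSubalgebra.root, Finset.mem_filter, Finset.mem_univ, true_and] using α.2

theorem pairing_eq_cast (α β : H.root) :
    α.1 (coroot β.1) = ((rootSystem H).pairingIn ℤ α β : F) := by
  rw [← rootSystem_pairing_apply, ← (rootSystem H).algebraMap_pairingIn ℤ α β]
  rfl

theorem pairingIn_self (α : H.root) : (rootSystem H).pairingIn ℤ α α = 2 :=
  (rootSystem H).pairingIn_same ℤ α

theorem pairingIn_negRoot_left (α β : H.root) :
    (rootSystem H).pairingIn ℤ (negRoot α) β = -(rootSystem H).pairingIn ℤ α β := by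
  apply Int.cast_injective (α := F)
  rw [Int.cast_neg, ← pairing_eq_cast, ← pairing_eq_cast]
  rfl

theorem pairingIn_negRoot_right (α β : H.root) :
    (rootSystem H).pairingIn ℤ α (negRoot β) = -(rootSystem H).pairingIn ℤ α β := by
  apply Int.cast_injective (α := F)
  rw [Int.cast_neg, ← pairing_eq_cast, ← pairing_eq_cast, coe_coroot_negRoot]
  exact map_neg (LieModule.Weight.toLinear F H L α.1) _

namespace ChevalleyBasis

variable (B)
variable (V : Type*) [AddCommGroup V] [Module F V] [LieRingModule L V]
  [LieModule F L V] [FiniteDimensional F V]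

/-- The action of a root vector on the representation space. -/
noncomputable def rep (α : H.root) : Module.End F V := LieModule.toEnd F L V (B.X α)

variable (H) in
/-- The action of a coroot on the representation space. -/
noncomputable def repCoroot (α : H.root) : Module.End F V := LieModule.toEnd F L V (coroot α.1 : L)

theorem lie_H_X (x : H) (α : H.root) : ⁅(x : L), B.X α⁆ = α.1 x • B.X α :=
  lie_eq_smul_of_mem_rootSpace (B.X_mem α) x

theorem toEnd_mul_rep_sub (x : H) (α : H.root) :
    LieModule.toEnd F L V (x : L) * B.rep V α - B.rep V α * LieModule.toEnd F L V (x : L) =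
      (α.1 x) • B.rep V α := by
  ext v
  have := congrArg (fun y : L => ⁅y, v⁆) (B.lie_H_X x α)
  simp only [lie_lie, smul_lie] at this
  simpa [rep] using this

theorem isNilpotentSlTwo (α : H.root) :
    IsNilpotentSlTwo (B.rep V α) (B.rep V (negRoot α)) (repCoroot H V α) where
  e_mul_f := by
    ext v
    have := congrArg (fun y : L => ⁅y, v⁆) (B.lie_X_neg α)
    simp only [lie_lie] at this
    simpa [rep, repCoroot] using this
  h_mul_e := by
    rw [repCoroot, B.toEnd_mul_rep_sub V, root_apply_coroot (isNonZero_root α), two_smul, two_mul]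
  h_mul_f := by
    have : (negRoot α).1 (coroot α.1) = -2 := by
      rw [← root_apply_coroot (isNonZero_root α)]; rfl
    rw [repCoroot, B.toEnd_mul_rep_sub V, this, neg_smul, two_smul, two_mul]
  nilpotent_e := by simpa [rep] using B.isNilpotent_toEnd V α 1
  nilpotent_f := by simpa [rep] using B.isNilpotent_toEnd V (negRoot α) 1

variable {V} in
/-- The Chevalley group acts on the representation space. -/
def toEnd : B.group V →* Module.End F V :=
  (Units.coeHom _).comp (B.group V).subtype

theorem toEnd_injective : Function.Injective (toEnd B (V := V)) :=
  Units.val_injective.comp Subtype.val_injective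

theorem toEnd_x (α : H.root) (t : F) :
    B.toEnd (B.x V α (Multiplicative.ofAdd t)) = nilExp (t • B.rep V α) := rfl

variable {V}

/-- The Weyl elements of the Chevalley group. -/
noncomputable def w (α : H.root) (t : Fˣ) : B.group V :=
  B.x V α (Multiplicative.ofAdd (t : F)) *
    B.x V (negRoot α) (Multiplicative.ofAdd (-(t⁻¹ : Fˣ) : F)) *
    B.x V α (Multiplicative.ofAdd (t : F))

/-- The torus elements of the Chevalley group. -/
noncomputable def h (α : H.root) (t : Fˣ) : B.group V := B.w α t * B.w α (-1)

theorem toEnd_mul_inv (g : B.group V) : B.toEnd g * B.toEnd g⁻¹ = 1 := by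
  rw [← map_mul, mul_inv_cancel, map_one]

theorem toEnd_inv_mul (g : B.group V) : B.toEnd g⁻¹ * B.toEnd g = 1 := by
  rw [← map_mul, inv_mul_cancel, map_one]

theorem conj_x (g : B.group V) (α β : H.root) (c : F)
    (h : B.toEnd g * B.rep V α = c • (B.rep V β * B.toEnd g)) (t : F) :
    g * B.x V α (Multiplicative.ofAdd t) * g⁻¹ = B.x V β (Multiplicative.ofAdd (c * t)) := by
  rw [mul_inv_eq_iff_eq_mul]
  apply B.toEnd_injective V
  rw [map_mul, map_mul, toEnd_x, toEnd_x]
  refine nilExp_conj (B.isNilpotent_toEnd V α t) (B.isNilpotent_toEnd V β (c * t)) ?_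
  rw [mul_smul_comm, h, smul_mul_assoc, smul_smul, mul_comm c]

theorem toEnd_w [Module ℚ (Module.End F V)] (α : H.root) (t : Fˣ) :
    B.toEnd (B.w α t : B.group V) = IsNilpotentSlTwo.weyl (B.rep V α) (B.rep V (negRoot α))
      (algebraMap F _ (t : F)) (algebraMap F _ ((t⁻¹ : Fˣ) : F)) := by
  have e : ∀ A : Module.End F V, nilExp A = IsNilpotent.exp A := by
    intro A
    unfold nilExp
    congr 1
    -- An additive group carries at most one structure of `ℚ`-module, so the two exponentials agree.
    exact Subsingleton.elim _ _
  rw [w, map_mul, map_mul, toEnd_x, toEnd_x, IsNilpotentSlTwo.weyl, e, e, ← map_neg,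
    ← Algebra.smul_def, ← Algebra.smul_def]

theorem toEnd_w_mul_rep (α : H.root) (t : Fˣ) :
    B.toEnd (B.w α t : B.group V) * B.rep V α =
      (-((t⁻¹ : Fˣ) : F) ^ 2) • (B.rep V (negRoot α) * B.toEnd (B.w α t)) := by
  let _ : Module ℚ (Module.End F V) := Module.compHom (Module.End F V) (algebraMap ℚ F)
  rw [toEnd_w, (B.isNilpotentSlTwo V α).weyl_mul_e (Algebra.commutes _) (Algebra.commutes _)
    (by rw [← map_mul, Units.mul_inv, map_one]), ← map_mul, ← Algebra.smul_def, neg_smul, pow_two,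
    neg_mul, smul_mul_assoc]

theorem toEnd_w_mul_repCoroot (α : H.root) (t : Fˣ) :
    B.toEnd (B.w α t : B.group V) * repCoroot H V α =
      -repCoroot H V α * B.toEnd (B.w α t) := by
  let _ : Module ℚ (Module.End F V) := Module.compHom (Module.End F V) (algebraMap ℚ F)
  rw [toEnd_w]
  exact (B.isNilpotentSlTwo V α).weyl_mul_h (Algebra.commutes _) (Algebra.commutes _)
    (by rw [← map_mul, Units.mul_inv, map_one])

theorem w_neg (α : H.root) (t : Fˣ) : (B.w α (-t) : B.group V) = (B.w α t)⁻¹ := by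
  simp only [w, mul_inv_rev, ← map_inv, ← ofAdd_neg, Units.val_neg, inv_neg, neg_neg, mul_assoc]

theorem h_one (α : H.root) : (B.h α 1 : B.group V) = 1 := by
  rw [h, w_neg, mul_inv_cancel]

include B

/-- The representation space is spanned by integral weight vectors of each coroot, and `h_α(t)`
acts on a vector of weight `n` as multiplication by `tⁿ`. -/
theorem exists_sum_weight_vectors (α : H.root) (v : V) :
    ∃ a : ℤ →₀ V, v = a.sum (fun _ x => x) ∧ ∀ n, repCoroot H V α (a n) = (n : F) • a n := by
  let _ : Module ℚ (Module.End F V) := Module.compHom (Module.End F V) (algebraMap ℚ F)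
  obtain ⟨a, h1, -, h3⟩ := (B.isNilpotentSlTwo V α).exists_laurent_expansion (F := F)
    (B.toEnd (B.w α (-1))) (B.toEnd_w_mul_repCoroot α _)
  refine ⟨a.mapRange (fun b => b v) rfl, ?_, fun n => ?_⟩
  -- At `t = 1` the torus element is the identity, so the Laurent coefficients applied to `v` sum to
  -- `v`.
  · have := h3 1
    rw [← toEnd_w, ← map_mul] at this
    change B.toEnd (B.h α 1) = _ at this
    rw [h_one, map_one] at this
    have := congrArg (fun b : Module.End F V => b v) this
    rw [Finsupp.sum_mapRange_index (fun _ => rfl)]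
    simpa [Finsupp.sum, LinearMap.sum_apply] using this
  · have := congrArg (fun b : Module.End F V => b v) (h1 n)
    simpa [Int.cast_smul_eq_zsmul] using this

theorem toEnd_h_apply (α : H.root) (t : Fˣ) {v : V} {n : ℤ}
    (hv : repCoroot H V α v = (n : F) • v) :
    B.toEnd (B.h α t) v = (t ^ n : F) • v := by
  let _ : Module ℚ (Module.End F V) := Module.compHom (Module.End F V) (algebraMap ℚ F)
  obtain ⟨a, h1, h2, h3⟩ := (B.isNilpotentSlTwo V α).exists_laurent_expansion (F := F)
    (B.toEnd (B.w α (-1))) (B.toEnd_w_mul_repCoroot α _)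
  -- The vector `a m v` has weight `m`, and also weight `n` since `a m` commutes with the coroot.
  -- Only the term `tⁿ` survives, and its coefficient is read off at `t = 1`.
  have hz : ∀ m, m ≠ n → a m v = 0 := by
    intro m hm
    have e1 := congrArg (fun b : Module.End F V => b v) ((h2 m).trans (h1 m))
    simp only [Module.End.mul_apply, hv, map_smul, LinearMap.smul_apply] at e1
    have e2 : ((n : F) - m) • a m v = 0 := by
      rw [sub_smul, e1, Int.cast_smul_eq_zsmul, sub_self]
    refine (smul_eq_zero.mp e2).resolve_left (sub_ne_zero.mpr ?_)
    exact_mod_cast hm.symm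
  have key : ∀ s : Fˣ, B.toEnd (B.h α s) v = (s ^ n : F) • a n v := by
    intro s
    have := h3 s
    rw [← toEnd_w, ← map_mul] at this
    change B.toEnd (B.h α s) = _ at this
    rw [this, Finsupp.sum, LinearMap.sum_apply]
    rw [Finset.sum_eq_single n]
    · rfl
    · intro m _ hm
      rw [LinearMap.smul_apply, hz m hm, smul_zero]
    · intro hn
      rw [Finsupp.notMem_support_iff.mp hn]
      simp
  have h0 := key 1
  rw [h_one, map_one] at h0
  rw [Module.End.one_apply, Units.val_one, one_zpow, one_smul] at h0
  rw [key t, ← h0]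

theorem end_ext_of_weight_vectors (α : H.root) {Y Z : Module.End F V}
    (h : ∀ (n : ℤ) (v : V), repCoroot H V α v = (n : F) • v → Y v = Z v) : Y = Z := by
  ext v
  obtain ⟨a, rfl, ha⟩ := B.exists_sum_weight_vectors α v
  rw [Finsupp.sum, map_sum, map_sum]
  exact Finset.sum_congr rfl fun n _ => h n _ (ha n)

theorem toEnd_h_mul (α : H.root) (t : Fˣ) {Y : Module.End F V} {m : ℤ}
    (hY : repCoroot H V α * Y - Y * repCoroot H V α = (m : F) • Y) :
    B.toEnd (B.h α t) * Y = (t ^ m : F) • (Y * B.toEnd (B.h α t)) := by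
  refine B.end_ext_of_weight_vectors α fun n v hv => ?_
  have h1 : repCoroot H V α (Y v) = ((m + n : ℤ) : F) • Y v := by
    have := congrArg (fun b : Module.End F V => b v) hY
    simp only [LinearMap.sub_apply, Module.End.mul_apply, hv, map_smul,
      LinearMap.smul_apply] at this
    rw [Int.cast_add, add_smul, ← this]
    abel
  rw [Module.End.mul_apply, B.toEnd_h_apply α t h1, LinearMap.smul_apply, Module.End.mul_apply,
    B.toEnd_h_apply α t hv, map_smul, smul_smul, zpow_add₀ t.ne_zero]

theorem toEnd_h_mul_rep (α β : H.root) (t : Fˣ) :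
    B.toEnd (B.h β t) * B.rep V α =
      (t ^ ((rootSystem H).pairingIn ℤ α β) : F) • (B.rep V α * B.toEnd (B.h β t)) := by
  apply B.toEnd_h_mul
  rw [repCoroot, B.toEnd_mul_rep_sub V, pairing_eq_cast]

theorem h_mul (α : H.root) (s t : Fˣ) : (B.h α (s * t) : B.group V) = B.h α s * B.h α t := by
  apply B.toEnd_injective V
  refine B.end_ext_of_weight_vectors α fun n v hv => ?_
  rw [B.toEnd_h_apply α _ hv, map_mul, Module.End.mul_apply, B.toEnd_h_apply α _ hv, map_smul,
    B.toEnd_h_apply α _ hv, smul_smul, Units.val_mul, mul_zpow, mul_comm]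

end ChevalleyBasis

end Representation

/-! ### Relations in the central extension and the action of `N` on `T` -/

section Cover

open scoped commutatorElement

variable {F L : Type*} [Field F] [CharZero F] [LieRing L] [LieAlgebra F L]
  [FiniteDimensional F L] [IsKilling F L] {H : LieSubalgebra F L} [H.IsCartanSubalgebra]
  [LieModule.IsTriangularizable F H L] {B : ChevalleyBasis H}
  {V : Type*} [AddCommGroup V] [Module F V] [LieRingModule L V]
  [LieModule F L V] [FiniteDimensional F V]
  {G : Type*} [Group G] {S : GroupExtension (rootsOfUnity 2 F) G (B.group V)}
  (hS : IsCentral S)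

include hS in
-- The principle by which relations pass from the Chevalley group to `G`: when both sides are
-- homomorphisms in the parameter, no sign from `μ₂` can intervene.
theorem hom_ext_of_rightHom {f g : Multiplicative F →* G}
    (h : S.rightHom.comp f = S.rightHom.comp g) : f = g :=
  (existsUnique_lift hS (S.rightHom.comp g)).unique h rfl

include hS in
theorem mul_comm_of_rightHom_eq_one {z : G} (hz : S.rightHom z = 1) (g : G) :
    g * z = z * g := by
  have hz' : z ∈ S.inl.range := by rw [S.range_inl_eq_ker_rightHom]; exact hz
  exact Subgroup.mem_center_iff.mp (hS hz') g

theorem mul_self_of_rightHom_eq_one {z : G} (hz : S.rightHom z = 1) : z * z = 1 := by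
  have hz' : z ∈ S.inl.range := by rw [S.range_inl_eq_ker_rightHom]; exact hz
  obtain ⟨ζ, rfl⟩ := hz'
  have hζ : ζ * ζ = 1 := by
    ext1
    have := ζ.2
    rw [mem_rootsOfUnity, pow_two] at this
    exact this
  rw [← map_mul, hζ, map_one]

theorem rightHom_xLift (α : H.root) (t : F) :
    S.rightHom (xLift hS α t) = B.x V α (Multiplicative.ofAdd t) :=
  DFunLike.congr_fun (rightHom_comp_lift hS (B.x V α)) (Multiplicative.ofAdd t)

theorem rightHom_wLift (α : H.root) (t : Fˣ) : S.rightHom (wLift hS α t) = B.w α t := by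
  simp only [wLift, map_mul, rightHom_xLift, ChevalleyBasis.w]

theorem rightHom_hLift (α : H.root) (t : Fˣ) : S.rightHom (hLift hS α t) = B.h α t := by
  simp only [hLift, map_mul, rightHom_wLift, ChevalleyBasis.h]

theorem xLift_add (α : H.root) (s t : F) :
    xLift hS α (s + t) = xLift hS α s * xLift hS α t := by
  rw [xLift, ofAdd_add, map_mul]; rfl

theorem xLift_zero (α : H.root) : xLift hS α 0 = 1 := by
  rw [xLift, ofAdd_zero, map_one]

theorem xLift_neg (α : H.root) (t : F) : xLift hS α (-t) = (xLift hS α t)⁻¹ := by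
  rw [xLift, ofAdd_neg, map_inv]; rfl

theorem wLift_neg (α : H.root) (t : Fˣ) : wLift hS α (-t) = (wLift hS α t)⁻¹ := by
  simp only [wLift, mul_inv_rev, ← xLift_neg, Units.val_neg, inv_neg, neg_neg, mul_assoc]

theorem hLift_one (α : H.root) : hLift hS α 1 = 1 := by
  rw [hLift, wLift_neg, mul_inv_cancel]

theorem wLift_mul_inv (α : H.root) (s t : Fˣ) :
    wLift hS α s * (wLift hS α t)⁻¹ = hLift hS α s * (hLift hS α t)⁻¹ := by
  simp only [hLift, mul_inv_rev, mul_assoc, mul_inv_cancel_left]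

variable (S) in
/-- The action of a cover of the Chevalley group on the representation space. -/
noncomputable def proj : G →* Module.End F V := B.toEnd.comp S.rightHom

theorem conj_xLift {g : G} {α β : H.root} {c : F}
    (h : proj S g * B.rep V α = c • (B.rep V β * proj S g)) (t : F) :
    g * xLift hS α t * g⁻¹ = xLift hS β (c * t) := by
  let f₁ : Multiplicative F →* G := (MulAut.conj g).toMonoidHom.comp (lift hS (B.x V α))
  let f₂ : Multiplicative F →* G :=
    (lift hS (B.x V β)).comp (AddMonoidHom.toMultiplicative (AddMonoidHom.mulLeft c))
  have : f₁ = f₂ := by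
    refine hom_ext_of_rightHom hS (MonoidHom.ext fun s => ?_)
    have e1 : S.rightHom (f₁ s) = S.rightHom g * B.x V α s * (S.rightHom g)⁻¹ := by
      change S.rightHom (g * xLift hS α s.toAdd * g⁻¹) = _
      rw [map_mul, map_mul, map_inv, rightHom_xLift]
      rfl
    have e2 : S.rightHom (f₂ s) = B.x V β (Multiplicative.ofAdd (c * s.toAdd)) :=
      rightHom_xLift hS β (c * s.toAdd)
    change S.rightHom (f₁ s) = S.rightHom (f₂ s)
    rw [e1, e2]
    exact B.conj_x _ α β c h s.toAdd
  exact DFunLike.congr_fun this (Multiplicative.ofAdd t)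

theorem conj_wLift {g : G} {α β : H.root} {c : Fˣ}
    (h : proj S g * B.rep V α = (c : F) • (B.rep V β * proj S g))
    (h' : proj S g * B.rep V (negRoot α) =
      ((c⁻¹ : Fˣ) : F) • (B.rep V (negRoot β) * proj S g)) (t : Fˣ) :
    g * wLift hS α t * g⁻¹ = wLift hS β (c * t) := by
  have e : g * wLift hS α t * g⁻¹ = (g * xLift hS α t * g⁻¹) *
      (g * xLift hS (negRoot α) (-(t⁻¹ : Fˣ)) * g⁻¹) * (g * xLift hS α t * g⁻¹) := by
    simp only [wLift]; group
  rw [e, conj_xLift hS h, conj_xLift hS h', wLift, Units.val_mul, mul_inv, Units.val_mul,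
    mul_neg]

theorem proj_hLift (α : H.root) (t : Fˣ) : proj S (hLift hS α t) = B.toEnd (B.h α t) := by
  rw [← rightHom_hLift hS]; rfl

theorem proj_wLift (α : H.root) (t : Fˣ) : proj S (wLift hS α t) = B.toEnd (B.w α t) := by
  rw [← rightHom_wLift hS]; rfl

/-- Conjugation by `h_β(t)` scales `X_α` and `X_{-α}` by inverse factors, which is the input of
`conj_wLift`. No cocycle appears, and this is what makes `T` computable. -/
theorem hLift_conj_wLift (α β : H.root) (t u : Fˣ) :
    hLift hS β t * wLift hS α u * (hLift hS β t)⁻¹ =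
      wLift hS α (t ^ (rootSystem H).pairingIn ℤ α β * u) := by
  refine conj_wLift hS ?_ ?_ u
  · rw [proj_hLift, B.toEnd_h_mul_rep, Units.val_zpow_eq_zpow_val]
  · rw [proj_hLift, B.toEnd_h_mul_rep, pairingIn_negRoot_left, ← zpow_neg,
      Units.val_zpow_eq_zpow_val]

theorem conj_hLift_of_conj_wLift {z : G} {α : H.root} {c : Fˣ}
    (h : ∀ u, z * wLift hS α u * z⁻¹ = wLift hS α (c * u)) (t : Fˣ) :
    z * hLift hS α t * z⁻¹ = hLift hS α (c * t) * (hLift hS α c)⁻¹ := by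
  have : z * hLift hS α t * z⁻¹ =
      (z * wLift hS α t * z⁻¹) * (z * wLift hS α (-1) * z⁻¹) := by
    simp only [hLift]; group
  rw [this, h, h, ← wLift_mul_inv, mul_neg_one, wLift_neg]

theorem hLift_conj_hLift (α β : H.root) (s t : Fˣ) :
    hLift hS β s * hLift hS α t * (hLift hS β s)⁻¹ =
      hLift hS α (s ^ (rootSystem H).pairingIn ℤ α β * t) *
        (hLift hS α (s ^ (rootSystem H).pairingIn ℤ α β))⁻¹ :=
  conj_hLift_of_conj_wLift hS (hLift_conj_wLift hS α β s) t

theorem rightHom_hLift_mul_comm (α β : H.root) (s t : Fˣ) :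
    S.rightHom (hLift hS β s * hLift hS α t) = S.rightHom (hLift hS α t * hLift hS β s) := by
  have := congrArg S.rightHom (hLift_conj_hLift hS α β s t)
  rw [map_mul _ (hLift hS β s * hLift hS α t), mul_comm _ t] at this
  rw [map_mul _ (hLift hS α _), map_inv, map_inv, mul_inv_eq_iff_eq_mul] at this
  simpa only [map_mul, rightHom_hLift, B.h_mul, mul_inv_cancel_right] using this

/-- The commutator of two torus generators lies in the kernel of the cover. -/
theorem rightHom_hLift_commutator (α β : H.root) (s t : Fˣ) :
    S.rightHom ⁅hLift hS β s, hLift hS α t⁆ = 1 := by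
  rw [commutatorElement_def, mul_assoc, ← mul_inv_rev, map_mul, map_inv,
    rightHom_hLift_mul_comm hS α β, mul_inv_cancel]

/-- The failure of multiplicativity of `h_α` lies in the kernel of the cover. -/
theorem rightHom_hLift_cocycle (α : H.root) (s t : Fˣ) :
    S.rightHom (hLift hS α s * hLift hS α t * (hLift hS α (s * t))⁻¹) = 1 := by
  simp only [map_mul, map_inv, rightHom_hLift, B.h_mul, mul_inv_cancel]

theorem commutator_mul_left_of_central {a b c : G} (h : ∀ g, g * ⁅b, c⁆ = ⁅b, c⁆ * g) :
    ⁅a * b, c⁆ = ⁅a, c⁆ * ⁅b, c⁆ := by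
  have e : ⁅a * b, c⁆ = a * ⁅b, c⁆ * c * a⁻¹ * c⁻¹ := by
    simp only [commutatorElement_def]; group
  rw [e, h a, commutatorElement_def a c, mul_assoc _ a c, mul_assoc _ (a * c), mul_assoc _ _ c⁻¹,
    ← h]

theorem commutator_mul_of_central {z b c : G} (h : ∀ g, g * z = z * g) :
    ⁅z * b, c⁆ = ⁅b, c⁆ := by
  have e : ⁅z * b, c⁆ = z * ⁅b, c⁆ * (c * z⁻¹ * c⁻¹) := by
    simp only [commutatorElement_def]; group
  rw [e, ← h, mul_assoc, ← mul_assoc z, ← mul_assoc z, ← h, mul_assoc c z, mul_inv_cancel, mul_one,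
    mul_inv_cancel, mul_one]

/-- The elements `h_β(s s')` and `h_β(s) h_β(s')` differ by a central factor, invisible to
commutators, and commutators of torus generators are central themselves. -/
theorem commutator_hLift_mul (α β : H.root) (s s' t : Fˣ) :
    ⁅hLift hS β (s * s'), hLift hS α t⁆ =
      ⁅hLift hS β s, hLift hS α t⁆ * ⁅hLift hS β s', hLift hS α t⁆ := by
  have hz := mul_comm_of_rightHom_eq_one hS (rightHom_hLift_cocycle hS β s s')
  rw [← commutator_mul_left_of_central
    (mul_comm_of_rightHom_eq_one hS (rightHom_hLift_commutator hS α β s' t)),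
    ← commutator_mul_of_central hz (b := hLift hS β (s * s')), inv_mul_cancel_right]

/-- Commutators of torus generators are multiplicative in each argument with values in `μ₂`, so a
square argument gives a trivial commutator. -/
theorem torusSq_le_torusCenter : torusSq hS ≤ torusCenter hS := by
  rw [torusSq, Subgroup.closure_le]
  rintro _ ⟨α, t, rfl⟩
  refine ⟨Subgroup.subset_closure ⟨α, _, rfl⟩, ?_⟩
  rw [torus, Subgroup.centralizer_closure]
  rintro _ ⟨β, s, rfl⟩
  have h1 : ⁅hLift hS α (t ^ 2), hLift hS β s⁆ = 1 := by
    rw [pow_two, commutator_hLift_mul]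
    exact mul_self_of_rightHom_eq_one (rightHom_hLift_commutator hS β α t s)
  exact (commutatorElement_eq_one_iff_mul_comm.mp h1).symm

/-- Conjugation by an element of the torus rescales the argument of `w_α`. -/
theorem exists_conj_wLift {α : H.root} (D : Subgroup Fˣ)
    (hD : ∀ (β : H.root) (t : Fˣ), t ^ (rootSystem H).pairingIn ℤ α β ∈ D) {z : G}
    (hz : z ∈ torus hS) : ∃ c ∈ D, ∀ u, z * wLift hS α u * z⁻¹ = wLift hS α (c * u) := by
  induction hz using Subgroup.closure_induction with
  | mem x hx =>
    obtain ⟨β, t, rfl⟩ := hx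
    exact ⟨_, hD β t, hLift_conj_wLift hS α β t⟩
  | one => exact ⟨1, D.one_mem, fun u => by simp⟩
  | mul x y _ _ hx hy =>
    obtain ⟨c, hc, h⟩ := hx
    obtain ⟨d, hd, h'⟩ := hy
    refine ⟨c * d, D.mul_mem hc hd, fun u => ?_⟩
    have : x * y * wLift hS α u * (x * y)⁻¹ = x * (y * wLift hS α u * y⁻¹) * x⁻¹ := by group
    rw [this, h', h, mul_assoc]
  | inv x _ hx =>
    obtain ⟨c, hc, h⟩ := hx
    refine ⟨c⁻¹, D.inv_mem hc, fun u => ?_⟩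
    have := h (c⁻¹ * u)
    rw [mul_inv_cancel_left] at this
    rw [← this]
    group

/-- Since `w z w⁻¹ z⁻¹ = w (z w z⁻¹)⁻¹`, the scalar `c` of `z` determines how `w` moves `z`. At `s =
1` the result is `h_α(c)⁻¹`, which lies in `T²` once `c` is a square. -/
theorem wLift_conj_mul_inv {z : G} {α : H.root} {c : Fˣ}
    (h : ∀ u, z * wLift hS α u * z⁻¹ = wLift hS α (c * u)) (s : Fˣ) :
    wLift hS α s * z * (wLift hS α s)⁻¹ * z⁻¹ = hLift hS α s * (hLift hS α (c * s))⁻¹ := by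
  have : wLift hS α s * z * (wLift hS α s)⁻¹ * z⁻¹ =
      wLift hS α s * (z * wLift hS α s * z⁻¹)⁻¹ := by group
  rw [this, h, wLift_mul_inv]

theorem hLift_mem_torus (α : H.root) (t : Fˣ) : hLift hS α t ∈ torus hS :=
  Subgroup.subset_closure ⟨α, t, rfl⟩

theorem wLift_conj_mem_torus (α : H.root) (s : Fˣ) {z : G} (hz : z ∈ torus hS) :
    wLift hS α s * z * (wLift hS α s)⁻¹ ∈ torus hS := by
  obtain ⟨c, -, h⟩ := exists_conj_wLift hS (α := α) ⊤ (fun _ _ => trivial) hz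
  have e := wLift_conj_mul_inv hS h s
  rw [mul_inv_eq_iff_eq_mul] at e
  rw [e]
  exact mul_mem (mul_mem (hLift_mem_torus hS _ _) (inv_mem (hLift_mem_torus hS _ _))) hz

theorem weylLift_le_normalizer :
    weylLift hS ≤ Subgroup.normalizer (torus hS : Set G) := by
  rw [weylLift, Subgroup.closure_le]
  rintro _ ⟨α, s, rfl⟩
  refine Subgroup.mem_normalizer_iff.mpr fun z => ⟨wLift_conj_mem_torus hS α s, fun h => ?_⟩
  have := wLift_conj_mem_torus hS α (-s) h
  rw [wLift_neg] at this
  convert this using 1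
  group

theorem hLift_sq_mem_torusSq (α : H.root) {c : Fˣ} (hc : IsSquare c) :
    hLift hS α c ∈ torusSq hS := by
  obtain ⟨r, rfl⟩ := hc
  exact Subgroup.subset_closure ⟨α, r, by rw [pow_two]⟩

theorem weylLift_conj_mem_torusCenter {n z : G} (hn : n ∈ weylLift hS)
    (hz : z ∈ torusCenter hS) : n * z * n⁻¹ ∈ torusCenter hS := by
  have hN := Subgroup.mem_normalizer_iff.mp (weylLift_le_normalizer hS hn)
  refine ⟨(hN z).mp hz.1, fun y hy => ?_⟩
  have hy' : n⁻¹ * y * n ∈ torus hS := by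
    rw [hN]
    have e : n * (n⁻¹ * y * n) * n⁻¹ = y := by group
    rwa [e]
  have hc : n⁻¹ * y * n * z = z * (n⁻¹ * y * n) := hz.2 _ hy'
  calc y * (n * z * n⁻¹) = n * (n⁻¹ * y * n * z) * n⁻¹ := by group
    _ = n * z * n⁻¹ * y := by rw [hc]; group

/-- If the torus characters of central elements of the torus are squares, then the Weyl group acts
trivially on `Z_T` modulo `T²`. -/
theorem weylLift_conj_mul_inv_mem_torusSq
    (hsq : ∀ (α : H.root), (∃ β : H.root, Odd ((rootSystem H).pairingIn ℤ α β)) → ∀ c : Fˣ,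
      (∀ s, hLift hS α (c * s) = hLift hS α s * hLift hS α c) → IsSquare c)
    {n : G} (hn : n ∈ weylLift hS) : ∀ z ∈ torusCenter hS, n * z * n⁻¹ * z⁻¹ ∈ torusSq hS := by
  induction hn using Subgroup.closure_induction with
  | mem x hx =>
    obtain ⟨α, s, rfl⟩ := hx
    intro z hz
    have hw : ∀ s : Fˣ, wLift hS α s ∈ weylLift hS := fun s =>
      Subgroup.subset_closure ⟨α, s, rfl⟩
    -- The factor `h_α(s)` lies in `T` and so commutes with the conjugate of `z` by `w_α(1)`, which
    -- is again in `Z_T`. Hence `s = 1` suffices.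
    have h1 : wLift hS α s = hLift hS α s * wLift hS α 1 := by
      rw [hLift, wLift_neg, inv_mul_cancel_right]
    have h2 : hLift hS α s * (wLift hS α 1 * z * (wLift hS α 1)⁻¹) =
        wLift hS α 1 * z * (wLift hS α 1)⁻¹ * hLift hS α s :=
      (weylLift_conj_mem_torusCenter hS (hw 1) hz).2 _ (hLift_mem_torus hS α s)
    have h3 : wLift hS α s * z * (wLift hS α s)⁻¹ = wLift hS α 1 * z * (wLift hS α 1)⁻¹ := by
      calc wLift hS α s * z * (wLift hS α s)⁻¹ =
          hLift hS α s * (wLift hS α 1 * z * (wLift hS α 1)⁻¹) * (hLift hS α s)⁻¹ := by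
            rw [h1]; group
        _ = _ := by rw [h2, mul_inv_cancel_right]
    rw [h3]
    by_cases hα : ∃ β : H.root, Odd ((rootSystem H).pairingIn ℤ α β)
    · obtain ⟨c, -, hc⟩ := exists_conj_wLift hS (α := α) ⊤ (fun _ _ => trivial) hz.1
      rw [wLift_conj_mul_inv hS hc, hLift_one, one_mul, mul_one]
      -- As `z` commutes with `h_α(t)`, the conjugation formula becomes the multiplicativity `h_α(c
      -- t) = h_α(t) h_α(c)`.
      refine inv_mem (hLift_sq_mem_torusSq hS α (hsq α hα c fun t => ?_))
      have e := conj_hLift_of_conj_wLift hS hc t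
      have e' : hLift hS α t * z = z * hLift hS α t := hz.2 _ (hLift_mem_torus hS α t)
      rw [← e', mul_inv_cancel_right, eq_mul_inv_iff_mul_eq] at e
      exact e.symm
    -- All exponents `⟨α,β⟩` are even here, so the scalar of any torus element can be kept in the
    -- group of squares, and centrality plays no role.
    · obtain ⟨c, hc', hc⟩ := exists_conj_wLift hS (α := α) (Subgroup.square Fˣ)
        (fun β t => by
          obtain ⟨k, hk⟩ := Int.not_odd_iff_even.mp fun h => hα ⟨β, h⟩
          rw [hk, zpow_add]
          exact ⟨_, rfl⟩) hz.1
      rw [wLift_conj_mul_inv hS hc, hLift_one, one_mul, mul_one]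
      exact inv_mem (hLift_sq_mem_torusSq hS α hc')
  | one => intro z hz; simp
  | mul x y hx hy ihx ihy =>
    intro z hz
    have e : x * y * z * (x * y)⁻¹ * z⁻¹ =
        (x * (y * z * y⁻¹) * x⁻¹ * (y * z * y⁻¹)⁻¹) * (y * z * y⁻¹ * z⁻¹) := by group
    rw [e]
    exact mul_mem (ihx _ (weylLift_conj_mem_torusCenter hS hy hz)) (ihy z hz)
  | inv x hx ih =>
    intro z hz
    have h1 := ih _ (weylLift_conj_mem_torusCenter hS (inv_mem hx) hz)
    have e : x⁻¹ * z * x⁻¹⁻¹ * z⁻¹ =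
        (x * (x⁻¹ * z * x⁻¹⁻¹) * x⁻¹ * (x⁻¹ * z * x⁻¹⁻¹)⁻¹)⁻¹ := by group
    rw [e]
    exact inv_mem h1

theorem hProd_conj_wLift (l : List H.root) (t : Fˣ) (α : H.root) (u : Fˣ) :
    hProd hS l t * wLift hS α u * (hProd hS l t)⁻¹ =
      wLift hS α (t ^ (l.map fun β => (rootSystem H).pairingIn ℤ α β).sum * u) := by
  induction l with
  | nil => simp [hProd]
  | cons β l ih =>
    have e : hProd hS (β :: l) t = hLift hS β t * hProd hS l t := by simp [hProd]
    have e' : hProd hS (β :: l) t * wLift hS α u * (hProd hS (β :: l) t)⁻¹ =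
        hLift hS β t * (hProd hS l t * wLift hS α u * (hProd hS l t)⁻¹) * (hLift hS β t)⁻¹ := by
      rw [e]; group
    rw [e', ih, hLift_conj_wLift, List.map_cons, List.sum_cons, zpow_add, mul_assoc]

theorem wLift_conj_hProd_mem_torusSq (l : List H.root) (α : H.root)
    (hl : Even (l.map fun β => (rootSystem H).pairingIn ℤ α β).sum) (t : Fˣ) :
    wLift hS α 1 * hProd hS l t * (wLift hS α 1)⁻¹ * (hProd hS l t)⁻¹ ∈ torusSq hS := by
  rw [wLift_conj_mul_inv hS (hProd_conj_wLift hS l t α), hLift_one, one_mul, mul_one]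
  obtain ⟨k, hk⟩ := hl
  refine inv_mem (hLift_sq_mem_torusSq hS α ?_)
  rw [hk, zpow_add]
  exact ⟨_, rfl⟩

end Cover

/-! ### The Steinberg symbol attached to a root -/

section SteinbergSymbol

open scoped commutatorElement

variable {F L : Type*} [Field F] [CharZero F] [LieRing L] [LieAlgebra F L]
  [FiniteDimensional F L] [IsKilling F L] {H : LieSubalgebra F L} [H.IsCartanSubalgebra]
  [LieModule.IsTriangularizable F H L] {B : ChevalleyBasis H}
  {V : Type*} [AddCommGroup V] [Module F V] [LieRingModule L V]
  [LieModule F L V] [FiniteDimensional F V]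
  {G : Type*} [Group G] {S : GroupExtension (rootsOfUnity 2 F) G (B.group V)}
  (hS : IsCentral S)

theorem wLift_conj_xLift (α : H.root) (a : Fˣ) (s : F) :
    wLift hS α a * xLift hS α s * (wLift hS α a)⁻¹ =
      xLift hS (negRoot α) (-((a⁻¹ : Fˣ) : F) ^ 2 * s) :=
  conj_xLift hS (by rw [proj_wLift, B.toEnd_w_mul_rep]) s

/-- Conjugation by `w_α(a)` takes `x_α(a)` to `x_{-α}(-a⁻¹)`, so the last factor of `w_α(a)` can be
traded for a factor on the left. -/
theorem wLift_eq (α : H.root) (a : Fˣ) : wLift hS α a = wLift hS (negRoot α) (-a⁻¹) := by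
  have h1 := wLift_conj_xLift hS α a a
  have e : -((a⁻¹ : Fˣ) : F) ^ 2 * a = -(a⁻¹ : Fˣ) := by
    rw [pow_two, neg_mul, mul_assoc, Units.inv_mul, mul_one]
  rw [e] at h1
  have h2 : wLift hS α a = xLift hS (negRoot α) (-(a⁻¹ : Fˣ)) * wLift hS α a *
      (xLift hS α a)⁻¹ := by
    rw [← h1]; group
  rw [h2, wLift, wLift, mul_assoc, mul_inv_cancel_right, negRoot_negRoot, mul_assoc]
  congr 3
  all_goals simp

theorem wLift_conj_xLift_neg (α : H.root) (a : Fˣ) (s : F) :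
    wLift hS α a * xLift hS (negRoot α) s * (wLift hS α a)⁻¹ =
      xLift hS α (-(a : F) ^ 2 * s) := by
  rw [wLift_eq, wLift_conj_xLift, negRoot_negRoot]
  simp

theorem wLift_conj_wLift (α : H.root) (a b : Fˣ) :
    wLift hS α a * wLift hS α b * (wLift hS α a)⁻¹ = wLift hS α (a ^ 2 * b⁻¹) := by
  have e : wLift hS α a * wLift hS α b * (wLift hS α a)⁻¹ =
      (wLift hS α a * xLift hS α b * (wLift hS α a)⁻¹) *
      (wLift hS α a * xLift hS (negRoot α) (-(b⁻¹ : Fˣ)) * (wLift hS α a)⁻¹) *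
      (wLift hS α a * xLift hS α b * (wLift hS α a)⁻¹) := by
    rw [wLift, wLift]; group
  rw [e, wLift_conj_xLift, wLift_conj_xLift_neg, wLift_eq hS α (a ^ 2 * b⁻¹), wLift,
    negRoot_negRoot]
  congr 3 <;> simp [mul_comm]

/-- The source of the Steinberg relation, a computation with `x_α` and `x_{-α}` only: `w(t) w(-1)
w(u)` is rewritten as `w(-u) w(u/t) w(u)`, which is `w(tu)` by `wLift_conj_wLift`. -/
theorem hLift_mul_of_add_eq_one (α : H.root) (t u : Fˣ) (htu : (t : F) + u = 1) :
    hLift hS α t * hLift hS α u = hLift hS α (t * u) := by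
  have ht : (t : F) ≠ 0 := t.ne_zero
  have hu : (u : F) ≠ 0 := u.ne_zero
  have hu1 : (u : F) = 1 - t := by rw [← htu]; ring
  have A : ∀ {a b c : F}, c = a + b → xLift hS α a * xLift hS α b = xLift hS α c := by
    rintro a b c rfl; rw [xLift_add]
  have hc1 : ∀ (a : Fˣ) (s : F), xLift hS (negRoot α) s * wLift hS α a =
      wLift hS α a * xLift hS α (-(a : F) ^ 2 * s) := by
    intro a s
    have := wLift_conj_xLift_neg hS α (-a) s
    rw [wLift_neg] at this
    rw [Units.val_neg, neg_sq] at this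
    rw [← this]
    group
  have hc2 : ∀ (a : Fˣ) (s : F), xLift hS α s * wLift hS α a =
      wLift hS α a * xLift hS (negRoot α) (-((a⁻¹ : Fˣ) : F) ^ 2 * s) := by
    intro a s
    have := wLift_conj_xLift hS α (-a) s
    rw [wLift_neg, inv_neg, Units.val_neg, neg_sq] at this
    rw [← this]
    group
  set X := xLift hS α
  set Y := xLift hS (negRoot α)
  set W := wLift hS α
  have hW : ∀ a : Fˣ, W a = X a * Y (-(a⁻¹ : Fˣ)) * X a := fun a => rfl
  -- Here `t + u = 1` merges neighbouring factors into `X(-u)` and `X(-t)`; splitting `Y(1) = Y(u⁻¹)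
  -- Y(-t/u)` then exposes `W(-u)`.
  have s1 : W t * W (-1) * W u = X t * Y (-(t⁻¹ : Fˣ)) * W (-u) * (X u * Y (-(t : F) / u)) *
      X (-t) * Y (-(u⁻¹ : Fˣ)) * X u := by
    have e1 : W (-u) * X u = X (-u) * Y (u⁻¹ : Fˣ) := by
      have hX : X (-u) * X u = 1 := by
        rw [← xLift_add, neg_add_cancel, xLift_zero]
      rw [hW (-u), Units.val_neg, mul_assoc, hX, mul_one, inv_neg, Units.val_neg, neg_neg]
    have e2 : X t * X (-1) = X (-u) := A (by rw [hu1]; ring)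
    have e3 : X (-1) * X u = X (-t) := A (by rw [hu1]; ring)
    have e4 : Y ((u⁻¹ : Fˣ) : F) * Y (-(t : F) / u) = Y 1 := by
      rw [← xLift_add]
      congr 1
      rw [Units.val_inv_eq_inv_val, hu1]
      rw [hu1] at hu
      field_simp
      ring
    calc W t * W (-1) * W u = X t * Y (-(t⁻¹ : Fˣ)) * (X t * X (-1)) * Y 1 * (X (-1) * X u) *
          Y (-(u⁻¹ : Fˣ)) * X u := by
            rw [hW t, hW (-1), hW u]
            simp only [inv_neg, inv_one, Units.val_neg, Units.val_one, neg_neg, mul_assoc]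
      _ = X t * Y (-(t⁻¹ : Fˣ)) * (X (-u) * Y (u⁻¹ : Fˣ)) * Y (-(t : F) / u) * X (-t) *
          Y (-(u⁻¹ : Fˣ)) * X u := by rw [e2, e3, ← e4]; simp only [mul_assoc]
      _ = _ := by rw [← e1]; simp only [mul_assoc]
  -- Carried across `W(-u)`, the factor `Y(-t⁻¹)` becomes `X(u²/t)`. Since `u²/t + u = u/t`, it
  -- joins `X(u)` to form the first factor of `W(u/t)`.
  have s2 : X t * Y (-(t⁻¹ : Fˣ)) * W (-u) * (X u * Y (-(t : F) / u)) *
      X (-t) * Y (-(u⁻¹ : Fˣ)) * X u =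
      X t * W (-u) * (X ((u / t : Fˣ) : F) * Y (-(((u / t)⁻¹ : Fˣ) : F)) * X ((u / t : Fˣ) : F)) *
      X (-(u / t) - t) * Y (-(u⁻¹ : Fˣ)) * X u := by
    have e1 : X (-((-u : Fˣ) : F) ^ 2 * -(t⁻¹ : Fˣ)) * X u = X ((u / t : Fˣ) : F) := A (by
      rw [Units.val_div_eq_div_val, Units.val_neg, Units.val_inv_eq_inv_val, hu1]
      field_simp
      ring)
    have e2 : X ((u / t : Fˣ) : F) * X (-(u / t) - t) = X (-t) := A (by
      rw [Units.val_div_eq_div_val]; ring)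
    have e3 : Y (-(((u / t)⁻¹ : Fˣ) : F)) = Y (-(t : F) / u) := by
      congr 1
      rw [inv_div, Units.val_div_eq_div_val, neg_div]
    rw [mul_assoc (X t), hc1, ← e2, ← e1, e3]
    simp only [mul_assoc]
  have s3 : X t * W (-u) * W (u / t) * X (-(u / t) - t) = W (-u) * W (u / t) * X u := by
    rw [hc2, mul_assoc (W (-u)), hc1]
    have : X (-((u / t : Fˣ) : F) ^ 2 * (-(((-u)⁻¹ : Fˣ) : F) ^ 2 * t)) * X (-(u / t) - t) = X u :=
      A (by
        rw [Units.val_div_eq_div_val, Units.val_inv_eq_inv_val, Units.val_neg]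
        field_simp
        rw [hu1]
        ring)
    rw [← this]
    simp only [mul_assoc]
  have s4 : W t * W (-1) * W u = W (t * u) := by
    rw [s1, s2, ← hW, s3, mul_assoc, mul_assoc, ← mul_assoc (X u), ← hW]
    have e := wLift_conj_wLift hS α (-u) (u / t)
    rw [← wLift_neg, neg_neg] at e
    change W (-u) * W (u / t) * W u = W _ at e
    rw [e]
    congr 1
    rw [neg_sq, inv_div, pow_two, mul_assoc, mul_div_cancel, mul_comm]
  change W t * W (-1) * (W u * W (-1)) = W (t * u) * W (-1)
  rw [← mul_assoc, s4]

theorem hLift_commutator_eq (α β : H.root) (s t : Fˣ) :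
    ⁅hLift hS β s, hLift hS α t⁆ =
      hLift hS α (s ^ (rootSystem H).pairingIn ℤ α β * t) *
        (hLift hS α (s ^ (rootSystem H).pairingIn ℤ α β))⁻¹ * (hLift hS α t)⁻¹ := by
  rw [commutatorElement_def, hLift_conj_hLift]

/-- With `m = ⟨α,β⟩`, the commutator of `h_β(s)` and `h_α(t)` is `h_α(s^m t) h_α(s^m)⁻¹ h_α(t)⁻¹`.
Putting a power `m` as argument of `h_β` undoes the exponent, as `m² = 1`, so the cocycle inherits
the bimultiplicativity of commutators. -/
theorem hLift_cocycle_eq (α β : H.root) (hm : (rootSystem H).pairingIn ℤ α β *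
    (rootSystem H).pairingIn ℤ α β = 1) (s t : Fˣ) :
    hLift hS α s * hLift hS α t * (hLift hS α (s * t))⁻¹ =
      ⁅hLift hS α s, hLift hS β (t ^ (rootSystem H).pairingIn ℤ α β)⁆ := by
  rw [← commutatorElement_inv, hLift_commutator_eq, ← zpow_mul, hm, zpow_one, mul_comm s t]
  group

theorem commutator_hLift_mul_right (α β : H.root) (s t t' : Fˣ) :
    ⁅hLift hS β s, hLift hS α (t * t')⁆ =
      ⁅hLift hS β s, hLift hS α t⁆ * ⁅hLift hS β s, hLift hS α t'⁆ := by
  rw [← commutatorElement_inv, commutator_hLift_mul, mul_inv_rev, commutatorElement_inv,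
    commutatorElement_inv]
  exact mul_comm_of_rightHom_eq_one hS (rightHom_hLift_commutator hS α β s t) _

/-- If some root pairs to `±1` with `α`, then the failure of multiplicativity of `h_α` is a
Steinberg symbol. -/
theorem exists_steinberg_symbol (α β : H.root) (hm : (rootSystem H).pairingIn ℤ α β *
    (rootSystem H).pairingIn ℤ α β = 1) :
    ∃ κ : Fˣ →* Fˣ →* rootsOfUnity 2 F,
      (∀ s t, S.inl (κ s t) * hLift hS α (s * t) = hLift hS α s * hLift hS α t) ∧
      ∀ s t : Fˣ, (s : F) + t = 1 → κ s t = 1 := by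
  have hmem : ∀ s t, ∃ ζ, S.inl ζ =
      hLift hS α s * hLift hS α t * (hLift hS α (s * t))⁻¹ := by
    intro s t
    have := rightHom_hLift_cocycle hS α s t
    rwa [← MonoidHom.mem_ker, ← S.range_inl_eq_ker_rightHom] at this
  choose k hk using hmem
  refine ⟨MonoidHom.mk' (fun s => MonoidHom.mk' (k s) fun t t' => ?_) fun s s' => ?_,
    fun s t => ?_, fun s t hst => ?_⟩
  · apply S.inl_injective
    rw [map_mul, hk, hk, hk]
    simp only [hLift_cocycle_eq hS α β hm, mul_zpow, commutator_hLift_mul_right]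
  · ext1 t
    apply S.inl_injective
    change S.inl (k (s * s') t) = S.inl (k s t * k s' t)
    rw [map_mul, hk, hk, hk]
    simp only [hLift_cocycle_eq hS α β hm, commutator_hLift_mul]
  · change S.inl (k s t) * _ = _
    rw [hk, inv_mul_cancel_right]
  · apply S.inl_injective
    change S.inl (k s t) = _
    rw [hk, hLift_mul_of_add_eq_one hS α s t hst, mul_inv_cancel, map_one]

/-- Multiplicativity of `h_α` passes to every root `β` that pairs to `±1` with `α`. -/
theorem hLift_mul_of_pairingIn {α β : H.root} (h1 : (rootSystem H).pairingIn ℤ α β *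
    (rootSystem H).pairingIn ℤ α β = 1) (h2 : (rootSystem H).pairingIn ℤ β α *
    (rootSystem H).pairingIn ℤ β α = 1)
    (hα : ∀ s t, hLift hS α (s * t) = hLift hS α s * hLift hS α t) (s t : Fˣ) :
    hLift hS β (s * t) = hLift hS β s * hLift hS β t := by
  -- The cocycles of `α` and of `β` are both given by the commutators of `h_α` with `h_β`.
  have key : ∀ s t, ⁅hLift hS α s, hLift hS β t⁆ = 1 := by
    intro s t
    have := hLift_cocycle_eq hS α β h1 s (t ^ (rootSystem H).pairingIn ℤ α β)
    rwa [hα, mul_inv_cancel, ← zpow_mul, h1, zpow_one, eq_comm] at this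
  have := hLift_cocycle_eq hS β α h2 s t
  rw [← commutatorElement_inv, key, inv_one, mul_inv_eq_one] at this
  exact this.symm

end SteinbergSymbol

/-! ### Formal properties of quadratic Steinberg symbols -/

section Symbol

variable {F A : Type*} [Field F] [CommGroup A]

/-- Steinberg symbols on the nonzero elements of a field with values in an abelian group of
exponent two. -/
structure IsQuadraticSymbol (k : F → F → A) : Prop where
  mul_left : ∀ x x' y, x ≠ 0 → x' ≠ 0 → y ≠ 0 → k (x * x') y = k x y * k x' y
  mul_right : ∀ x y y', x ≠ 0 → y ≠ 0 → y' ≠ 0 → k x (y * y') = k x y * k x y'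
  steinberg : ∀ x y, x ≠ 0 → y ≠ 0 → x + y = 1 → k x y = 1
  mul_self : ∀ x y, k x y * k x y = 1

namespace IsQuadraticSymbol

variable {k : F → F → A} (hk : IsQuadraticSymbol k)
include hk

theorem one_left {y : F} (hy : y ≠ 0) : k 1 y = 1 := by
  have := hk.mul_left 1 1 y one_ne_zero one_ne_zero hy
  rw [mul_one] at this
  exact (mul_eq_left.mp this.symm)

theorem sq_mul_left {s x y : F} (hs : s ≠ 0) (hx : x ≠ 0) (hy : y ≠ 0) :
    k (s ^ 2 * x) y = k x y := by
  rw [hk.mul_left _ _ _ (pow_ne_zero 2 hs) hx hy, pow_two, hk.mul_left _ _ _ hs hs hy, hk.mul_self,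
    one_mul]

theorem sq_left {s y : F} (hs : s ≠ 0) (hy : y ≠ 0) : k (s ^ 2) y = 1 := by
  rw [pow_two, hk.mul_left _ _ _ hs hs hy, hk.mul_self]

theorem sq_mul_right {s x y : F} (hs : s ≠ 0) (hx : x ≠ 0) (hy : y ≠ 0) :
    k x (s ^ 2 * y) = k x y := by
  rw [hk.mul_right _ _ _ hx (pow_ne_zero 2 hs) hy, pow_two, hk.mul_right _ _ _ hx hs hs,
    hk.mul_self, one_mul]

theorem inv_right {x y : F} (hx : x ≠ 0) (hy : y ≠ 0) : k x y⁻¹ = k x y := by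
  rw [← hk.sq_mul_right hy hx (inv_ne_zero hy)]
  congr 1
  field_simp

theorem inv_left {x y : F} (hx : x ≠ 0) (hy : y ≠ 0) : k x⁻¹ y = k x y := by
  rw [← hk.sq_mul_left hx (inv_ne_zero hx) hy]
  congr 1
  field_simp

/-- Compare the Steinberg relations for `x` and `x⁻¹` through `1 - x = -x (1 - x⁻¹)`. -/
theorem self_neg {x : F} (hx : x ≠ 0) : k x (-x) = 1 := by
  by_cases h1 : x = 1
  · subst h1; exact hk.one_left (neg_ne_zero.mpr one_ne_zero)
  have h2 : 1 - x ≠ 0 := sub_ne_zero.mpr (Ne.symm h1)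
  have h3 : 1 - x⁻¹ ≠ 0 := sub_ne_zero.mpr (fun h => h1 (inv_eq_one.mp h.symm))
  have e : 1 - x = -x * (1 - x⁻¹) := by field_simp; ring
  have k1 := hk.steinberg x (1 - x) hx h2 (by ring)
  have k2 := hk.steinberg x⁻¹ (1 - x⁻¹) (inv_ne_zero hx) h3 (by ring)
  rw [hk.inv_left hx h3] at k2
  rwa [e, hk.mul_right _ _ _ hx (neg_ne_zero.mpr hx) h3, k2, mul_one] at k1

/-- Expand `k(xy, -xy) = 1`; exponent two then removes the inverse from the skew-symmetry. -/
theorem symm {x y : F} (hx : x ≠ 0) (hy : y ≠ 0) : k x y = k y x := by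
  have h := hk.self_neg (mul_ne_zero hx hy)
  have hx' := neg_ne_zero.mpr hx
  have hy' := neg_ne_zero.mpr hy
  have e1 : -(x * y) = -x * y := by ring
  have e2 : -x * y = x * -y := by ring
  rw [hk.mul_left _ _ _ hx hy (neg_ne_zero.mpr (mul_ne_zero hx hy)), e1,
    hk.mul_right _ _ _ hx hx' hy, hk.self_neg hx, one_mul, e2, hk.mul_right _ _ _ hy hx hy',
    hk.self_neg hy, mul_one] at h
  rw [eq_inv_of_mul_eq_one_left h, inv_eq_of_mul_eq_one_left (hk.mul_self y x)]

theorem self_self {x : F} (hx : x ≠ 0) : k x x = k x (-1) := by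
  have h1 : (-1 : F) ≠ 0 := neg_ne_zero.mpr one_ne_zero
  calc k x x = k x (-1 * -x) := by congr 1; ring
    _ = k x (-1) := by
      rw [hk.mul_right _ _ _ hx h1 (neg_ne_zero.mpr hx), hk.self_neg hx, mul_one]

/-- The relation coming from `(1 - x)/(1 - x y) + x (1 - y)/(1 - x y) = 1`. -/
theorem one_sub_one_sub {x y : F} (hx : x ≠ 0) (h1x : 1 - x ≠ 0) (h1y : 1 - y ≠ 0)
    (hxy : 1 - x * y ≠ 0) :
    k (1 - x) (1 - y) = k (1 - x) (1 - x * y) * k (1 - x * y) x * k (1 - x * y) (1 - y) *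
      k (1 - x * y) (-1) := by
  have hc := inv_ne_zero hxy
  have h := hk.steinberg ((1 - x) * (1 - x * y)⁻¹) (x * (1 - y) * (1 - x * y)⁻¹)
    (mul_ne_zero h1x hc) (mul_ne_zero (mul_ne_zero hx h1y) hc) (by field_simp; ring)
  have hx0 : k (1 - x) x = 1 := hk.steinberg _ _ h1x hx (by ring)
  rw [hk.mul_left _ _ _ h1x hc (mul_ne_zero (mul_ne_zero hx h1y) hc),
    hk.inv_left hxy (mul_ne_zero (mul_ne_zero hx h1y) hc),
    hk.mul_right _ _ _ h1x (mul_ne_zero hx h1y) hc, hk.mul_right _ _ _ h1x hx h1y,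
    hk.mul_right _ _ _ hxy (mul_ne_zero hx h1y) hc, hk.mul_right _ _ _ hxy hx h1y,
    hk.inv_right h1x hxy, hk.inv_right hxy hxy, hx0, one_mul, hk.self_self hxy] at h
  have e : k (1 - x) (1 - y) * (k (1 - x) (1 - x * y) * k (1 - x * y) x * k (1 - x * y) (1 - y) *
      k (1 - x * y) (-1)) = 1 := by rw [← h]; ac_rfl
  have hsq : ∀ a b : A, b * b = 1 → a * b = 1 → a = b := fun a b hb hab => by
    rw [← hb] at hab; exact mul_right_cancel hab
  refine hsq _ _ ?_ e
  have : ∀ a b c d : A, a * a = 1 → b * b = 1 → c * c = 1 → d * d = 1 →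
      a * b * c * d * (a * b * c * d) = 1 := by
    intro a b c d ha hb hc hd
    calc _ = (a * a) * (b * b) * (c * c) * (d * d) := by ac_rfl
      _ = 1 := by rw [ha, hb, hc, hd]; simp
  exact this _ _ _ _ (hk.mul_self _ _) (hk.mul_self _ _) (hk.mul_self _ _) (hk.mul_self _ _)

theorem zpow_left {x y : F} (hx : x ≠ 0) (hy : y ≠ 0) (n : ℤ) : k (x ^ n) y = k x y ^ n := by
  let φ : Fˣ →* A := MonoidHom.mk' (fun u => k u y) fun a b => by
    simpa using hk.mul_left a b y a.ne_zero b.ne_zero hy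
  have := map_zpow φ (Units.mk0 x hx) n
  simpa [φ] using this

end IsQuadraticSymbol

end Symbol

/-! ### Uniformizers, units and squares in ultrametric local fields -/

section UltrametricField

variable {F : Type*} [NontriviallyNormedField F] [LocallyCompactSpace F] [IsUltrametricDist F]

variable (F) in
/-- A uniformizer of a locally compact ultrametric field. -/
theorem exists_uniformizer : ∃ π : F, 0 < ‖π‖ ∧ ‖π‖ < 1 ∧ ∀ x : F, ‖x‖ < 1 → ‖x‖ ≤ ‖π‖ := by
  have : ProperSpace F := .of_nontriviallyNormedField_of_weaklyLocallyCompactSpace F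
  -- The open unit ball is closed, hence compact, so the norm attains its maximum on it.
  have hc : IsCompact (Metric.ball (0 : F) 1) := by
    refine (isCompact_closedBall (0 : F) 1).of_isClosed_subset ?_ Metric.ball_subset_closedBall
    exact IsUltrametricDist.isClosed_ball 0 1
  obtain ⟨π, hπ, hmax⟩ := hc.exists_isMaxOn ⟨0, Metric.mem_ball_self one_pos⟩
    (continuous_norm.continuousOn)
  obtain ⟨y, hy, hy1⟩ := NormedField.exists_norm_lt_one F
  have hmax' : ∀ x : F, ‖x‖ < 1 → ‖x‖ ≤ ‖π‖ := fun x hx => hmax (mem_ball_zero_iff.mpr hx)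
  exact ⟨π, hy.trans_le (hmax' y hy1), mem_ball_zero_iff.mp hπ, hmax'⟩

theorem norm_sub_eq_left {x y : F} (h : ‖y‖ < ‖x‖) : ‖x - y‖ = ‖x‖ := by
  have := IsUltrametricDist.norm_add_eq_max_of_norm_ne_norm (x := x) (y := -y)
    (by rw [norm_neg]; exact h.ne')
  rw [← sub_eq_add_neg, norm_neg, max_eq_left h.le] at this
  exact this

theorem norm_one_sub {x : F} (h : ‖x‖ < 1) : ‖1 - x‖ = 1 := by
  rw [norm_sub_eq_left (by rwa [norm_one]), norm_one]

theorem one_sub_ne_zero {x : F} (h : ‖x‖ < 1) : 1 - x ≠ 0 := by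
  rw [← norm_ne_zero_iff, norm_one_sub h]; exact one_ne_zero

theorem norm_add_lt {x y : F} {r : ℝ} (hx : ‖x‖ < r) (hy : ‖y‖ < r) : ‖x + y‖ < r :=
  (IsUltrametricDist.norm_add_le_max x y).trans_lt (max_lt hx hy)

theorem norm_add_le' {x y : F} {r : ℝ} (hx : ‖x‖ ≤ r) (hy : ‖y‖ ≤ r) : ‖x + y‖ ≤ r :=
  (IsUltrametricDist.norm_add_le_max x y).trans (max_le hx hy)

theorem norm_sub_le' {x y : F} {r : ℝ} (hx : ‖x‖ ≤ r) (hy : ‖y‖ ≤ r) : ‖x - y‖ ≤ r := by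
  rw [sub_eq_add_neg]; exact norm_add_le' hx (by rwa [norm_neg])

/-- Hensel's lemma for `Z² + Z = w`. -/
theorem exists_sq_add_self_eq {w : F} (hw : ‖w‖ < 1) : ∃ z : F, ‖z‖ ≤ ‖w‖ ∧ z ^ 2 + z = w := by
  have : ProperSpace F := .of_nontriviallyNormedField_of_weaklyLocallyCompactSpace F
  let s := Metric.closedBall (0 : F) ‖w‖
  -- A solution is a fixed point of `f`, which contracts the ball of radius `‖w‖` by the factor `‖w‖
  -- < 1`.
  let f : F → F := fun z => w - z ^ 2
  have hf : Set.MapsTo f s s := by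
    intro z hz
    rw [mem_closedBall_zero_iff] at hz ⊢
    refine norm_sub_le' le_rfl ?_
    rw [norm_pow, pow_two]
    exact (mul_le_mul hz (hz.trans hw.le) (norm_nonneg _) (norm_nonneg _)).trans_eq (mul_one _)
  have hcon : ContractingWith ⟨‖w‖, norm_nonneg w⟩ (hf.restrict f s s) := by
    refine ⟨by exact_mod_cast hw, LipschitzWith.of_dist_le_mul fun a b => ?_⟩
    have ha := mem_closedBall_zero_iff.mp a.2
    have hb := mem_closedBall_zero_iff.mp b.2
    change dist (w - (a : F) ^ 2) (w - (b : F) ^ 2) ≤ ‖w‖ * dist (a : F) (b : F)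
    have e : w - (a : F) ^ 2 - (w - (b : F) ^ 2) = -((a + b) * (a - b) : F) := by ring
    rw [dist_eq_norm, dist_eq_norm, e, norm_neg, norm_mul]
    exact mul_le_mul_of_nonneg_right (norm_add_le' ha hb) (norm_nonneg _)
  obtain ⟨z, hz, hfix, -⟩ := hcon.exists_fixedPoint' Metric.isClosed_closedBall.isComplete hf
    (Metric.mem_closedBall_self (norm_nonneg w)) (edist_ne_top _ _)
  refine ⟨z, mem_closedBall_zero_iff.mp hz, ?_⟩
  have : w - z ^ 2 = z := hfix
  linear_combination -this

/-- The local square theorem. -/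
theorem exists_sq_eq_one_sub [CharZero F] {x : F} (hx : ‖x‖ < ‖(4 : F)‖) :
    ∃ s : F, s ≠ 0 ∧ 1 - x = s ^ 2 := by
  have h4 : (4 : F) ≠ 0 := by norm_num
  have h4' : ‖(4 : F)‖ ≤ 1 := by
    exact_mod_cast IsUltrametricDist.norm_natCast_le_one F 4
  have hx1 : ‖x‖ < 1 := hx.trans_le h4'
  -- Because `(1 + 2z)² = 1 + 4(z² + z)`, the equation to solve is `z² + z = -x/4`.
  obtain ⟨z, -, hz⟩ := exists_sq_add_self_eq (F := F) (w := -x / 4) (by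
    rw [norm_div, norm_neg, div_lt_one (norm_pos_iff.mpr h4)]; exact hx)
  have e : 1 - x = (1 + 2 * z) ^ 2 := by
    field_simp at hz
    linear_combination -hz
  refine ⟨_, fun h => one_sub_ne_zero hx1 ?_, e⟩
  rw [e, h, zero_pow two_ne_zero]

/-- A norm strictly between consecutive powers of `‖π‖` would, after scaling by a power of `π` and
inverting, give an element of norm strictly between `‖π‖` and `1`. -/
theorem exists_zpow_mul {π : F} (h0 : 0 < ‖π‖) (h1 : ‖π‖ < 1)
    (hmax : ∀ x : F, ‖x‖ < 1 → ‖x‖ ≤ ‖π‖) {x : F} (hx : x ≠ 0) :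
    ∃ (n : ℤ) (c : F), ‖c‖ = 1 ∧ x = π ^ n * c := by
  have hπ : π ≠ 0 := norm_pos_iff.mp h0
  obtain ⟨n, hn1, hn2⟩ := exists_mem_Ico_zpow (norm_pos_iff.mpr hx) (one_lt_inv₀ h0 |>.mpr h1)
  refine ⟨-n, x / π ^ (-n), ?_, (mul_div_cancel₀ x (zpow_ne_zero _ hπ)).symm⟩
  have e : ‖x / π ^ (-n)‖ = ‖x‖ * ‖π‖ ^ n := by
    rw [norm_div, norm_zpow, zpow_neg, div_inv_eq_mul]
  have hp : (0 : ℝ) < ‖π‖ ^ n := zpow_pos h0 n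
  have e1 : ‖π‖⁻¹ ^ n * ‖π‖ ^ n = 1 := by rw [← mul_zpow, inv_mul_cancel₀ h0.ne', one_zpow]
  have l1 : 1 ≤ ‖x‖ * ‖π‖ ^ n := by
    rw [← e1]; exact mul_le_mul_of_nonneg_right hn1 hp.le
  have l2 : ‖x‖ * ‖π‖ ^ (n + 1) < 1 := by
    have hp' : (0 : ℝ) < ‖π‖ ^ (n + 1) := zpow_pos h0 _
    have := mul_lt_mul_of_pos_right hn2 hp'
    rwa [← mul_zpow, inv_mul_cancel₀ h0.ne', one_zpow] at this
  rw [e]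
  refine le_antisymm ?_ l1
  by_contra! hgt
  have hlt : ‖(x * π ^ n)⁻¹‖ < 1 := by
    rw [norm_inv, norm_mul, norm_zpow]; exact inv_lt_one_of_one_lt₀ hgt
  have hle := hmax _ hlt
  rw [norm_inv, norm_mul, norm_zpow, inv_le_iff_one_le_mul₀ (by linarith)] at hle
  rw [zpow_add_one₀ h0.ne'] at l2
  nlinarith

end UltrametricField

/-! ### Squares and the Artin–Schreier map in the residue field -/

section ResidueField

open scoped NormedField Valued

variable {F : Type*} [NontriviallyNormedField F] [LocallyCompactSpace F] [IsUltrametricDist F]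

theorem residue_eq_zero_iff_norm_lt_one {x : 𝒪[F]} :
    IsLocalRing.residue 𝒪[F] x = 0 ↔ ‖(x : F)‖ < 1 := by
  rw [IsLocalRing.residue_eq_zero_iff, IsLocalRing.mem_maximalIdeal, mem_nonunits_iff,
    Valued.integer.isUnit_iff_norm_eq_one]
  exact ⟨fun h => lt_of_le_of_ne (Valued.integer.norm_le_one x) h, fun h => h.ne⟩

variable (F) in
-- The compact closed unit ball is covered by finitely many open balls of radius one, and integers
-- in one such ball have the same residue.
theorem finite_residueField : Finite 𝓀[F] := by
  have : ProperSpace F := .of_nontriviallyNormedField_of_weaklyLocallyCompactSpace F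
  obtain ⟨t, -, ht, hcov⟩ := (isCompact_closedBall (0 : F) 1).finite_cover_balls one_pos
  classical
  let g : F → 𝓀[F] := fun x =>
    if h : x ∈ 𝒪[F] then IsLocalRing.residue 𝒪[F] ⟨x, h⟩ else 0
  refine Set.finite_univ_iff.mp ((ht.image g).subset fun y _ => ?_)
  obtain ⟨x, rfl⟩ := IsLocalRing.residue_surjective y
  obtain ⟨c, hc, hxc⟩ := Set.mem_iUnion₂.mp (hcov (mem_closedBall_zero_iff.mpr
    (Valued.integer.norm_le_one x)))
  rw [mem_ball_iff_norm] at hxc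
  have hcO : c ∈ 𝒪[F] := by
    rw [Valued.integer.mem_iff]
    have : c = x - (x - c) := by ring
    rw [this]
    exact norm_sub_le' (Valued.integer.norm_le_one x) hxc.le
  refine ⟨c, hc, ?_⟩
  simp only [g, dif_pos hcO]
  rw [eq_comm, ← sub_eq_zero, ← map_sub]
  exact residue_eq_zero_iff_norm_lt_one.mpr hxc

/-- The residue field is finite of characteristic two, so every residue is a square. -/
theorem exists_norm_sub_sq_lt_one (h2 : ‖(2 : F)‖ < 1) {c : F} (hc : ‖c‖ ≤ 1) :
    ∃ d : F, ‖d‖ ≤ 1 ∧ ‖c - d ^ 2‖ < 1 := by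
  have := finite_residueField F
  have hch : ringChar 𝓀[F] = 2 := by
    have h20 : ((2 : ℕ) : 𝓀[F]) = 0 := by
      have : IsLocalRing.residue 𝒪[F] 2 = 0 := residue_eq_zero_iff_norm_lt_one.mpr h2
      exact_mod_cast (map_ofNat _ 2).symm.trans this
    exact (Nat.prime_two.eq_one_or_self_of_dvd _ (ringChar.dvd h20)).resolve_left
      (CharP.ringChar_ne_one)
  obtain ⟨y, hy⟩ := FiniteField.isSquare_of_char_two hch
    (IsLocalRing.residue 𝒪[F] ⟨c, Valued.integer.mem_iff.mpr hc⟩)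
  obtain ⟨d, rfl⟩ := IsLocalRing.residue_surjective y
  refine ⟨d, Valued.integer.norm_le_one d, ?_⟩
  rw [← map_mul, ← sub_eq_zero, ← map_sub] at hy
  rw [pow_two]
  exact residue_eq_zero_iff_norm_lt_one.mp hy

/-- On the residue field `y ↦ y² + y` is additive with kernel `{0, 1}`, so its image has index two;
`a` represents the other coset. -/
theorem exists_artinSchreier (h2 : ‖(2 : F)‖ < 1) : ∃ a : F, ‖a‖ ≤ 1 ∧
    (∀ y : F, ‖y‖ ≤ 1 → ‖y ^ 2 + y - a‖ = 1) ∧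
    ∀ b : F, ‖b‖ ≤ 1 → ∃ y : F, ‖y‖ ≤ 1 ∧ (‖y ^ 2 + y - b‖ < 1 ∨ ‖y ^ 2 + y + a - b‖ < 1) := by
  have := finite_residueField F
  have h20 : (2 : 𝓀[F]) = 0 := by
    have : IsLocalRing.residue 𝒪[F] 2 = 0 := residue_eq_zero_iff_norm_lt_one.mpr h2
    exact (map_ofNat _ 2).symm.trans this
  let φ : 𝓀[F] →+ 𝓀[F] :=
    AddMonoidHom.mk' (fun y => y ^ 2 + y) fun y z => by linear_combination y * z * h20
  have hker : Nat.card φ.ker = 2 := by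
    have : (φ.ker : Set 𝓀[F]) = {0, 1} := by
      ext y
      change y ^ 2 + y = 0 ↔ y = 0 ∨ y = 1
      constructor
      · intro h
        have : y * (y - 1) = 0 := by linear_combination h - y * h20
        exact (mul_eq_zero.mp this).imp_right sub_eq_zero.mp
      · rintro (rfl | rfl)
        · ring
        · linear_combination h20
    change Nat.card (φ.ker : Set 𝓀[F]) = 2
    rw [this, Nat.card_coe_set_eq, Set.ncard_pair zero_ne_one]
  have hind : φ.range.index = 2 := by
    have h1 := φ.range.card_mul_index
    have h2 := φ.ker.card_mul_index
    rw [AddSubgroup.index_ker, hker, ← h1, mul_comm] at h2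
    exact (Nat.eq_of_mul_eq_mul_left Nat.card_pos h2).symm
  obtain ⟨a, ha⟩ := AddSubgroup.index_eq_two_iff.mp hind
  obtain ⟨a, rfl⟩ := IsLocalRing.residue_surjective a
  have mem_lt : ∀ x : F, ∀ hx : ‖x‖ ≤ 1, ∀ r, r = x →
      IsLocalRing.residue 𝒪[F] ⟨x, Valued.integer.mem_iff.mpr hx⟩ = 0 → ‖r‖ < 1 := by
    rintro x hx _ rfl h
    exact residue_eq_zero_iff_norm_lt_one.mp h
  refine ⟨a, Valued.integer.norm_le_one a, fun y hy => ?_, fun b hb => ?_⟩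
  · let y' : 𝒪[F] := ⟨y, Valued.integer.mem_iff.mpr hy⟩
    refine le_antisymm (Valued.integer.norm_le_one (y' ^ 2 + y' - a)) ?_
    by_contra! hlt
    have h : IsLocalRing.residue 𝒪[F] (y' ^ 2 + y' - a) = 0 :=
      residue_eq_zero_iff_norm_lt_one.mpr hlt
    have hmem : IsLocalRing.residue 𝒪[F] a ∈ φ.range := by
      refine ⟨IsLocalRing.residue 𝒪[F] y', ?_⟩
      rw [map_sub, sub_eq_zero] at h
      simpa [φ] using h
    have := ha 0
    simp [hmem, zero_mem] at this
  · let b' : 𝒪[F] := ⟨b, Valued.integer.mem_iff.mpr hb⟩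
    rcases (ha (IsLocalRing.residue 𝒪[F] b')).or with h | h
    · obtain ⟨y, hy⟩ := h
      obtain ⟨y, rfl⟩ := IsLocalRing.residue_surjective y
      refine ⟨y, Valued.integer.norm_le_one y, Or.inr ?_⟩
      have : IsLocalRing.residue 𝒪[F] (y ^ 2 + y + a - b') = 0 := by
        change (IsLocalRing.residue 𝒪[F] y) ^ 2 + IsLocalRing.residue 𝒪[F] y = _ at hy
        simp only [map_add, map_sub, map_pow]
        linear_combination hy + IsLocalRing.residue 𝒪[F] a * h20
      exact residue_eq_zero_iff_norm_lt_one.mp this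
    · obtain ⟨y, hy⟩ := h
      obtain ⟨y, rfl⟩ := IsLocalRing.residue_surjective y
      refine ⟨y, Valued.integer.norm_le_one y, Or.inl ?_⟩
      have : IsLocalRing.residue 𝒪[F] (y ^ 2 + y - b') = 0 := by
        change (IsLocalRing.residue 𝒪[F] y) ^ 2 + IsLocalRing.residue 𝒪[F] y = _ at hy
        simp only [map_add, map_sub, map_pow]
        linear_combination hy
      exact residue_eq_zero_iff_norm_lt_one.mp this

/-- For a nonsquare `g` the form `g u² + g v²` represents `1`, and both of its terms are then
nonsquares; they serve as `a` and `1 - a`. -/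
theorem exists_nonsquare_add_nonsquare {K : Type*} [Field K] [Finite K] (h2 : ringChar K ≠ 2) :
    ∃ a : K, ¬ IsSquare a ∧ ¬ IsSquare (1 - a) ∧
      ∀ b : K, b ≠ 0 → ∃ y, y ≠ 0 ∧ (y ^ 2 = b ∨ a * y ^ 2 = b) := by
  classical
  have := Fintype.ofFinite K
  obtain ⟨g, hg⟩ := FiniteField.exists_nonsquare h2
  have hg0 : g ≠ 0 := fun h => hg (h ▸ IsSquare.zero)
  have hsq : ∀ z, z ≠ 0 → ¬ IsSquare (g * z ^ 2) := by
    rintro z hz ⟨r, hr⟩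
    exact hg ⟨r / z, by field_simp; linear_combination hr⟩
  obtain ⟨u, v, huv⟩ : ∃ u v : K, g * u ^ 2 + g * v ^ 2 = 1 := by
    have hd : (Polynomial.C g * Polynomial.X ^ 2 : Polynomial K).degree = 2 :=
      Polynomial.degree_C_mul_X_pow 2 hg0
    obtain ⟨u, v, h⟩ := FiniteField.exists_root_sum_quadratic (R := K)
      (f := Polynomial.C g * Polynomial.X ^ 2)
      (g := Polynomial.C g * Polynomial.X ^ 2 - 1) hd
      (by
        rw [Polynomial.degree_sub_eq_left_of_degree_lt, hd]
        rw [hd, Polynomial.degree_one]; norm_num)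
      (FiniteField.odd_card_of_char_ne_two h2)
    refine ⟨u, v, ?_⟩
    simp only [Polynomial.eval_mul, Polynomial.eval_C, Polynomial.eval_pow, Polynomial.eval_X,
      Polynomial.eval_sub, Polynomial.eval_one] at h
    linear_combination h
  have hu : u ≠ 0 := by
    rintro rfl
    refine hsq v ?_ ⟨1, by linear_combination huv⟩
    rintro rfl
    simp at huv
  have hv : v ≠ 0 := by
    rintro rfl
    exact hsq u hu ⟨1, by linear_combination huv⟩
  refine ⟨g * u ^ 2, hsq u hu, ?_, fun b hb => ?_⟩
  · rw [← huv, add_sub_cancel_left]; exact hsq v hv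
  · by_cases h : IsSquare b
    · obtain ⟨y, rfl⟩ := h
      exact ⟨y, left_ne_zero_of_mul hb, Or.inl (pow_two y)⟩
    · have h1 : IsSquare (g * u ^ 2 * b) := by
        rw [← quadraticChar_one_iff_isSquare
            (mul_ne_zero (mul_ne_zero hg0 (pow_ne_zero 2 hu)) hb), map_mul,
          quadraticChar_neg_one_iff_not_isSquare.mpr h,
          quadraticChar_neg_one_iff_not_isSquare.mpr (hsq u hu)]
        norm_num
      obtain ⟨r, hr⟩ := h1
      have hr0 : r ≠ 0 := by
        rintro rfl
        rw [mul_zero] at hr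
        exact mul_ne_zero (mul_ne_zero hg0 (pow_ne_zero 2 hu)) hb hr
      refine ⟨r / (g * u ^ 2), div_ne_zero hr0 (mul_ne_zero hg0 (pow_ne_zero 2 hu)), Or.inr ?_⟩
      field_simp
      linear_combination -hr

/-- In odd residue characteristic there are units `a`, `1 - a` which are not squares modulo the
maximal ideal, and every unit is, up to squares and principal units, `1` or `a`. -/
theorem exists_nonsquare_units (h2 : ‖(2 : F)‖ = 1) : ∃ a : F, ‖a‖ = 1 ∧ ‖1 - a‖ = 1 ∧
    (∀ y : F, ‖y‖ ≤ 1 → ‖y ^ 2 - a‖ = 1) ∧ (∀ y : F, ‖y‖ ≤ 1 → ‖y ^ 2 - (1 - a)‖ = 1) ∧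
    ∀ b : F, ‖b‖ = 1 → ∃ y : F, ‖y‖ = 1 ∧ (‖y ^ 2 - b‖ < 1 ∨ ‖a * y ^ 2 - b‖ < 1) := by
  have := finite_residueField F
  have h20 : (2 : 𝓀[F]) ≠ 0 := by
    intro h
    have : IsLocalRing.residue 𝒪[F] 2 = 0 := (map_ofNat _ 2).trans h
    exact (residue_eq_zero_iff_norm_lt_one.mp this).ne h2
  have hch : ringChar 𝓀[F] ≠ 2 := fun h => h20 (by
    have := ringChar.Nat.cast_ringChar (R := 𝓀[F]); rw [h] at this; exact_mod_cast this)
  obtain ⟨a, ha, ha', hb⟩ := exists_nonsquare_add_nonsquare hch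
  obtain ⟨a, rfl⟩ := IsLocalRing.residue_surjective a
  have key : ∀ x : 𝒪[F], IsLocalRing.residue 𝒪[F] x ≠ 0 → ‖(x : F)‖ = 1 := fun x hx =>
    le_antisymm (Valued.integer.norm_le_one x)
      (not_lt.mp fun h => hx (residue_eq_zero_iff_norm_lt_one.mpr h))
  have sq : ∀ x y : 𝒪[F], ¬ IsSquare (IsLocalRing.residue 𝒪[F] x) → ‖((y ^ 2 - x : 𝒪[F]) : F)‖ = 1 :=
    fun x y hx => key _ fun h => hx ⟨IsLocalRing.residue 𝒪[F] y, by
      rw [map_sub, map_pow] at h; linear_combination -h⟩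
  refine ⟨a, key a fun h => ha (h ▸ IsSquare.zero), key (1 - a) fun h => ha' ?_,
    fun y hy => sq a ⟨y, Valued.integer.mem_iff.mpr hy⟩ ha,
    fun y hy => sq (1 - a) ⟨y, Valued.integer.mem_iff.mpr hy⟩ (by rwa [map_sub, map_one]),
    fun b hb1 => ?_⟩
  · rw [map_sub, map_one] at h; rw [h]; exact IsSquare.zero
  · let b' : 𝒪[F] := ⟨b, Valued.integer.mem_iff.mpr hb1.le⟩
    obtain ⟨y, hy0, hy⟩ := hb (IsLocalRing.residue 𝒪[F] b') fun h =>
      (residue_eq_zero_iff_norm_lt_one.mp h).ne hb1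
    obtain ⟨y, rfl⟩ := IsLocalRing.residue_surjective y
    refine ⟨y, key y hy0, hy.imp (fun h => ?_) fun h => ?_⟩
    · refine residue_eq_zero_iff_norm_lt_one (x := y ^ 2 - b').mp ?_
      rw [map_sub, map_pow, h, sub_self]
    · refine residue_eq_zero_iff_norm_lt_one (x := a * y ^ 2 - b').mp ?_
      rw [map_sub, map_mul, map_pow, h, sub_self]

end ResidueField

/-! ### Nondegeneracy of symbols: reduction to units -/

namespace IsQuadraticSymbol

variable {F A : Type*} [NontriviallyNormedField F] [LocallyCompactSpace F] [IsUltrametricDist F]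
  [CharZero F] [CommGroup A] {k : F → F → A} (hk : IsQuadraticSymbol k)
  {π : F} (h0 : 0 < ‖π‖) (h1 : ‖π‖ < 1) (hmax : ∀ x : F, ‖x‖ < 1 → ‖x‖ ≤ ‖π‖)

include hk h0 h1 hmax in
theorem eq_one_of_unit_of_uniformizer {w : F} (hw : w ≠ 0) (hu : ∀ u : F, ‖u‖ = 1 → k w u = 1)
    (hπ : k w π = 1) {y : F} (hy : y ≠ 0) : k w y = 1 := by
  have hπ0 : π ≠ 0 := norm_pos_iff.mp h0
  obtain ⟨n, c, hc, rfl⟩ := exists_zpow_mul h0 h1 hmax hy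
  rw [hk.mul_right _ _ _ hw (zpow_ne_zero n hπ0) (right_ne_zero_of_mul hy), hu c hc, mul_one,
    hk.symm hw (zpow_ne_zero n hπ0), hk.zpow_left hπ0 hw, hk.symm hπ0 hw, hπ, one_zpow]

include hk h0 in
theorem zpow_uniformizer_of_odd {w c : F} (hw : w ≠ 0) (hc : c ≠ 0) (hwc : k w c = 1) {n : ℤ}
    (hn : Odd n) : k w (π ^ n * c) = k w π := by
  have hπ0 : π ≠ 0 := norm_pos_iff.mp h0
  obtain ⟨m, rfl⟩ := hn
  rw [hk.mul_right _ _ _ hw (zpow_ne_zero _ hπ0) hc, hwc, mul_one,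
    hk.symm hw (zpow_ne_zero _ hπ0), hk.zpow_left hπ0 hw, zpow_add, zpow_mul, zpow_one,
    show k π w ^ (2 : ℤ) = 1 from (zpow_ofNat _ 2).trans ((pow_two _).trans (hk.mul_self _ _)),
    one_zpow, one_mul, hk.symm hπ0 hw]

include hk h0 h1 hmax in
/-- The common end of the proofs of nondegeneracy: `δ` is orthogonal to all units. -/
theorem isSquare_of_orthogonal {δ : F} (hδ0 : δ ≠ 0) (hδ : ∀ u : F, ‖u‖ = 1 → k δ u = 1)
    (htriv : k δ π = 1 → ∀ u y : F, ‖u‖ = 1 → y ≠ 0 → k u y = 1)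
    (hsq : k δ π ≠ 1 → ∀ u : F, ‖u‖ = 1 → (∀ y, y ≠ 0 → k u y = 1) → IsSquare u)
    (hnt : ∃ x y, x ≠ 0 ∧ y ≠ 0 ∧ k x y ≠ 1) {c : F} (hc0 : c ≠ 0)
    (hc : ∀ y, y ≠ 0 → k c y = 1) : IsSquare c := by
  have hπ0 : π ≠ 0 := norm_pos_iff.mp h0
  have hne : ∀ u : F, ‖u‖ = 1 → u ≠ 0 := fun u hu => norm_ne_zero_iff.mp (hu ▸ one_ne_zero)
  -- If `k(δ, π) = 1` then all units lie in the radical. As `k(π, π) = k(π, -1)`, the symbol would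
  -- be trivial.
  have hδπ : k δ π ≠ 1 := by
    intro h
    obtain ⟨x, y, hx, hy, hxy⟩ := hnt
    have hu := htriv h
    refine hxy ?_
    rw [hk.symm hx hy]
    refine hk.eq_one_of_unit_of_uniformizer h0 h1 hmax hy
      (fun u h => by rw [hk.symm hy (hne u h)]; exact hu u y h hy) ?_ hx
    rw [hk.symm hy hπ0]
    refine hk.eq_one_of_unit_of_uniformizer h0 h1 hmax hπ0
      (fun u h => by rw [hk.symm hπ0 (hne u h)]; exact hu u π h hπ0) ?_ hy
    rw [hk.self_self hπ0, hk.symm hπ0 (neg_ne_zero.mpr one_ne_zero)]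
    exact hu _ _ (by rw [norm_neg, norm_one]) hπ0
  obtain ⟨n, d, hd, rfl⟩ := exists_zpow_mul h0 h1 hmax hc0
  rcases Int.even_or_odd' n with ⟨m, rfl | rfl⟩
  · have e : π ^ (2 * m) = (π ^ m) ^ 2 := by rw [mul_comm, zpow_mul]; norm_cast
    have hm : π ^ m ≠ 0 := zpow_ne_zero m hπ0
    rw [e] at hc ⊢
    obtain ⟨s, hs⟩ := hsq hδπ d hd fun y hy => by
      rw [← hc y hy, hk.sq_mul_left hm (hne d hd) hy]
    exact ⟨π ^ m * s, by rw [hs]; ring⟩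
  -- Odd valuation is excluded: `k(δ, c)` would equal `k(δ, π) ≠ 1`.
  · refine absurd ?_ hδπ
    rw [← hk.zpow_uniformizer_of_odd h0 hδ0 (hne d hd) (hδ d hd) ⟨m, rfl⟩, hk.symm hδ0 hc0]
    exact hc δ hδ0

end IsQuadraticSymbol

/-! ### Principal units modulo squares in residue characteristic two -/

section Dyadic

variable {F : Type*} [NontriviallyNormedField F] [LocallyCompactSpace F] [IsUltrametricDist F]

theorem isSquare_mul_of_norm_sub_lt {s x r : F} (hs : ‖s‖ = 1) (h : ‖s - x‖ < ‖r‖) :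
    ∃ z, ‖z‖ < ‖r‖ ∧ x = s * (1 - z) := by
  have hs0 : s ≠ 0 := norm_ne_zero_iff.mp (hs ▸ one_ne_zero)
  refine ⟨1 - x / s, ?_, by field_simp; ring⟩
  have : 1 - x / s = (s - x) / s := by field_simp
  rwa [this, norm_div, hs, div_one]

theorem unit_eq_sq_mul_one_sub (h2 : ‖(2 : F)‖ < 1) {c : F} (hc : ‖c‖ = 1) :
    ∃ d y : F, d ≠ 0 ∧ ‖y‖ < 1 ∧ c = d ^ 2 * (1 - y) := by
  obtain ⟨d, hd, hcd⟩ := exists_norm_sub_sq_lt_one h2 hc.le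
  have hd1 : ‖d ^ 2‖ = 1 := by
    have := norm_sub_eq_left (x := c) (y := c - d ^ 2) (by rwa [hc])
    rwa [sub_sub_cancel, hc] at this
  obtain ⟨z, hz, e⟩ := isSquare_mul_of_norm_sub_lt (r := 1) hd1
    (by rw [norm_sub_rev, norm_one]; exact hcd)
  refine ⟨d, z, ?_, by rwa [norm_one] at hz, e⟩
  rintro rfl
  simp at hd1

/-- Take `p = π^m` and `d` with `d² ≡ -x/p²` in the residue field. Then `(1 + dp)²` agrees with `1 -
x` up to terms smaller than `x`: the cross term `2dp` is small because `‖4‖ < ‖x‖ = ‖p‖²`. -/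
theorem one_sub_eq_sq_mul_of_even (h2 : ‖(2 : F)‖ < 1) {π x : F} (h0 : 0 < ‖π‖) {m : ℤ}
    (hx : ‖x‖ = ‖π‖ ^ (2 * m)) (hx1 : ‖x‖ < 1) (h4 : ‖(4 : F)‖ < ‖x‖) :
    ∃ s z : F, s ≠ 0 ∧ ‖z‖ < ‖x‖ ∧ 1 - x = s ^ 2 * (1 - z) := by
  have hπ0 : π ≠ 0 := norm_pos_iff.mp h0
  set p := π ^ m with hp
  have hp0 : p ≠ 0 := zpow_ne_zero m hπ0
  have hpp : 0 < ‖p‖ := norm_pos_iff.mpr hp0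
  have hx' : ‖x‖ = ‖p‖ ^ 2 := by
    rw [hx, hp, norm_zpow, mul_comm, zpow_mul]; norm_cast
  have hp1 : ‖p‖ < 1 := by rw [hx'] at hx1; exact (pow_lt_one_iff_of_nonneg hpp.le two_ne_zero).mp hx1
  have h2p : ‖(2 : F)‖ < ‖p‖ := by
    have : ‖(4 : F)‖ = ‖(2 : F)‖ ^ 2 := by rw [← norm_pow]; norm_num
    rw [this, hx'] at h4
    exact lt_of_pow_lt_pow_left₀ 2 hpp.le h4
  obtain ⟨d, hd, hcd⟩ := exists_norm_sub_sq_lt_one h2 (c := -x / p ^ 2) (by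
    rw [norm_div, norm_neg, norm_pow, hx', div_self (pow_ne_zero 2 hpp.ne')])
  have hdp : ‖d * p‖ < 1 := by
    rw [norm_mul]; exact (mul_le_of_le_one_left hpp.le hd).trans_lt hp1
  have hs : ‖1 + d * p‖ = 1 := by
    have := norm_one_sub (x := -(d * p)) (by rwa [norm_neg])
    rwa [sub_neg_eq_add] at this
  obtain ⟨z, hz, e⟩ := isSquare_mul_of_norm_sub_lt (s := (1 + d * p) ^ 2) (x := 1 - x) (r := x)
    (by rw [norm_pow, hs, one_pow]) (by
      have e : (1 + d * p) ^ 2 - (1 - x) = 2 * (d * p) + -((-x / p ^ 2 - d ^ 2) * p ^ 2) := by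
        field_simp; ring
      rw [e]
      refine norm_add_lt ?_ ?_
      · rw [norm_mul, norm_mul, hx', pow_two]
        calc ‖(2 : F)‖ * (‖d‖ * ‖p‖) ≤ ‖(2 : F)‖ * ‖p‖ :=
              mul_le_mul_of_nonneg_left (mul_le_of_le_one_left hpp.le hd) (norm_nonneg _)
          _ < ‖p‖ * ‖p‖ := mul_lt_mul_of_pos_right h2p hpp
      · rw [norm_neg, norm_mul, norm_pow, hx']
        exact mul_lt_of_lt_one_left (pow_pos hpp 2) hcd)
  refine ⟨_, z, ?_, hz, e⟩
  rw [← norm_ne_zero_iff, hs]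
  exact one_ne_zero

variable [CharZero F]

/-- From `(1 + 2y)² = 1 + 4(y² + y)`, the square class of `1 - x` is decided by the Artin–Schreier
class of `-x/4`; the local square theorem absorbs the remaining error. -/
theorem one_sub_eq_sq_or (h2 : ‖(2 : F)‖ < 1) {a : F} (ha1 : ‖a‖ ≤ 1)
    (ha : ∀ b : F, ‖b‖ ≤ 1 → ∃ y : F, ‖y‖ ≤ 1 ∧ (‖y ^ 2 + y - b‖ < 1 ∨ ‖y ^ 2 + y + a - b‖ < 1))
    {x : F} (h4 : ‖x‖ ≤ ‖(4 : F)‖) :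
    ∃ s : F, s ≠ 0 ∧ (1 - x = s ^ 2 ∨ 1 - x = s ^ 2 * (1 + 4 * a)) := by
  have h40 : (4 : F) ≠ 0 := by norm_num
  have h4p : 0 < ‖(4 : F)‖ := norm_pos_iff.mpr h40
  have h44 : ‖(4 : F)‖ < 1 := by
    have : ‖(4 : F)‖ = ‖(2 : F)‖ ^ 2 := by rw [← norm_pow]; norm_num
    rw [this]
    exact pow_lt_one₀ (norm_nonneg _) h2 two_ne_zero
  obtain ⟨y, hy, hyb⟩ := ha (-x / 4) (by
    rw [norm_div, norm_neg]; exact (div_le_one h4p).mpr h4)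
  have n1 : ∀ u v : F, ‖u‖ < 1 → ‖v‖ ≤ 1 → ‖1 + u * v‖ = 1 := fun u v hu hv => by
    have := norm_one_sub (x := -(u * v)) (by
      rw [norm_neg, norm_mul]; exact (mul_le_of_le_one_right (norm_nonneg _) hv).trans_lt hu)
    rwa [sub_neg_eq_add] at this
  have hs := n1 2 y h2 hy
  have hδ := n1 4 a h44 ha1
  have hs0 : 1 + 2 * y ≠ 0 := norm_ne_zero_iff.mp (hs ▸ one_ne_zero)
  have aux : ∀ r : F, ‖r‖ < 1 → ‖4 * r‖ < ‖(4 : F)‖ := fun r hr => by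
    rw [norm_mul]; exact mul_lt_of_lt_one_right h4p hr
  rcases hyb with hyb | hyb
  · obtain ⟨z, hz, e⟩ := isSquare_mul_of_norm_sub_lt (s := (1 + 2 * y) ^ 2) (x := 1 - x) (r := 4)
      (by rw [norm_pow, hs, one_pow]) (by
        have e : (1 + 2 * y) ^ 2 - (1 - x) = 4 * (y ^ 2 + y - -x / 4) := by field_simp; ring
        rw [e]
        exact aux _ hyb)
    obtain ⟨t, ht0, ht⟩ := exists_sq_eq_one_sub hz
    exact ⟨(1 + 2 * y) * t, mul_ne_zero hs0 ht0, Or.inl (by rw [e, ht]; ring)⟩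
  · obtain ⟨z, hz, e⟩ := isSquare_mul_of_norm_sub_lt (s := (1 + 2 * y) ^ 2 * (1 + 4 * a))
      (x := 1 - x) (r := 4) (by rw [norm_mul, norm_pow, hs, hδ, one_pow, one_mul]) (by
        have e : (1 + 2 * y) ^ 2 * (1 + 4 * a) - (1 - x) =
            4 * ((y ^ 2 + y + a - -x / 4) + 4 * ((y ^ 2 + y) * a)) := by field_simp; ring
        rw [e]
        refine aux _ (norm_add_lt hyb ?_)
        rw [norm_mul, norm_mul]
        refine (mul_le_of_le_one_right h4p.le (mul_le_one₀ (norm_add_le' ?_ hy) (norm_nonneg _)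
          ha1)).trans_lt h44
        rw [norm_pow]
        exact pow_le_one₀ (norm_nonneg _) hy)
    obtain ⟨t, ht0, ht⟩ := exists_sq_eq_one_sub hz
    exact ⟨(1 + 2 * y) * t, mul_ne_zero hs0 ht0, Or.inr (by rw [e, ht]; ring)⟩

/-- A strict decrease of the norm gains a factor `‖π‖`, so finitely many steps lead below `‖4‖`. -/
theorem level_induction {π : F} (h0 : 0 < ‖π‖) (h1 : ‖π‖ < 1)
    (hmax : ∀ x : F, ‖x‖ < 1 → ‖x‖ ≤ ‖π‖) {C : F → Prop} (hbase : ∀ x, ‖x‖ < ‖(4 : F)‖ → C x)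
    (hstep : ∀ x, ‖x‖ < 1 → ‖(4 : F)‖ ≤ ‖x‖ → (∀ z, ‖z‖ < ‖x‖ → C z) → C x) {x : F}
    (hx : ‖x‖ < 1) : C x := by
  have key : ∀ j : ℕ, ∀ x : F, ‖x‖ < 1 → ‖x‖ * ‖π‖ ^ j < ‖(4 : F)‖ → C x := by
    intro j
    induction j with
    | zero => intro x _ h; exact hbase x (by simpa using h)
    | succ j ih =>
      intro x hx h
      by_cases h4 : ‖x‖ < ‖(4 : F)‖
      · exact hbase x h4
      push Not at h4
      refine hstep x hx h4 fun z hz => ih z (hz.trans hx) (lt_of_le_of_lt ?_ h)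
      have hxp : 0 < ‖x‖ := (norm_nonneg z).trans_lt hz
      have := hmax (z / x) (by rw [norm_div]; exact (div_lt_one hxp).mpr hz)
      rw [norm_div, div_le_iff₀ hxp] at this
      calc ‖z‖ * ‖π‖ ^ j ≤ ‖π‖ * ‖x‖ * ‖π‖ ^ j :=
            mul_le_mul_of_nonneg_right this (pow_nonneg h0.le _)
        _ = ‖x‖ * ‖π‖ ^ (j + 1) := by ring
  obtain ⟨j, hj⟩ := exists_pow_lt_of_lt_one (norm_pos_iff.mpr (by norm_num : (4 : F) ≠ 0)) h1
  exact key j x hx ((mul_le_of_le_one_left (pow_nonneg h0.le _) hx.le).trans_lt hj)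

end Dyadic

/-! ### Nondegeneracy over nonarchimedean fields -/

namespace IsQuadraticSymbol

variable {F A : Type*} [NontriviallyNormedField F] [LocallyCompactSpace F] [IsUltrametricDist F]
  [CharZero F] [CommGroup A] {k : F → F → A} (hk : IsQuadraticSymbol k)

include hk in
-- The unit `δ = 1 + 4a`, with `a` outside the Artin–Schreier image, is orthogonal to all units. The
-- principal units `1 - x` are treated by induction on the size of `x`: even levels are deepened by
-- a square factor, and at odd levels `one_sub_one_sub` passes from `1 - x` to the deeper `1 - xy`.
theorem isSquare_of_orthogonal_dyadic (h2 : ‖(2 : F)‖ < 1)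
    (hnt : ∃ x y, x ≠ 0 ∧ y ≠ 0 ∧ k x y ≠ 1) {c : F} (hc0 : c ≠ 0)
    (hc : ∀ y, y ≠ 0 → k c y = 1) : IsSquare c := by
  obtain ⟨π, h0, h1, hmax⟩ := exists_uniformizer F
  obtain ⟨a, ha1, hay, ha⟩ := exists_artinSchreier h2
  have hπ0 : π ≠ 0 := norm_pos_iff.mp h0
  have hne : ∀ u : F, ‖u‖ = 1 → u ≠ 0 := fun u hu => norm_ne_zero_iff.mp (hu ▸ one_ne_zero)
  have ha1' : ‖a‖ = 1 := by simpa using hay 0 (by simp)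
  have h40 : (4 : F) ≠ 0 := by norm_num
  have h4p : 0 < ‖(4 : F)‖ := norm_pos_iff.mpr h40
  have h44 : ‖(4 : F)‖ < 1 := by
    have : ‖(4 : F)‖ = ‖(2 : F)‖ ^ 2 := by rw [← norm_pow]; norm_num
    rw [this]
    exact pow_lt_one₀ (norm_nonneg _) h2 two_ne_zero
  have h4a : ‖-(4 * a)‖ = ‖(4 : F)‖ := by rw [norm_neg, norm_mul, ha1', mul_one]
  set δ := 1 + 4 * a with hδdef
  have hδe : δ = 1 - -(4 * a) := by rw [hδdef]; ring
  have hδ1 : ‖δ‖ = 1 := by rw [hδe]; exact norm_one_sub (by rwa [h4a])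
  have hδ0 := hne δ hδ1
  -- With `x = -4a` and `‖y‖ < 1`, the element `1 - xy` is a square, so every factor on the right of
  -- `one_sub_one_sub` is trivial.
  have hδu : ∀ u : F, ‖u‖ = 1 → k δ u = 1 := by
    intro u hu
    obtain ⟨d, y, hd0, hy, rfl⟩ := unit_eq_sq_mul_one_sub h2 hu
    have hy0 := one_sub_ne_zero hy
    obtain ⟨s, hs0, hs⟩ := exists_sq_eq_one_sub (x := -(4 * a) * y) (by
      rw [norm_mul, h4a]; exact mul_lt_of_lt_one_right h4p hy)
    have hx0 : -(4 * a) ≠ 0 := neg_ne_zero.mpr (mul_ne_zero h40 (hne a ha1'))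
    rw [hk.sq_mul_right hd0 hδ0 hy0, hδe, hk.one_sub_one_sub hx0 (hδe ▸ hδ0) hy0
      (by rw [hs]; exact pow_ne_zero 2 hs0), hs, hk.symm (hδe ▸ hδ0) (pow_ne_zero 2 hs0),
      hk.sq_left hs0 (hδe ▸ hδ0), hk.sq_left hs0 hx0, hk.sq_left hs0 hy0,
      hk.sq_left hs0 (neg_ne_zero.mpr one_ne_zero)]
    simp
  refine hk.isSquare_of_orthogonal h0 h1 hmax hδ0 hδu (fun hδπ => ?_) (fun hδπ => ?_) hnt hc0 hc
  · have hδy : ∀ y, y ≠ 0 → k δ y = 1 := fun y hy =>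
      hk.eq_one_of_unit_of_uniformizer h0 h1 hmax hδ0 hδu hδπ hy
    have main : ∀ x : F, ‖x‖ < 1 → ∀ y, y ≠ 0 → k (1 - x) y = 1 := by
      intro x hx
      refine level_induction h0 h1 hmax (C := fun x => ∀ y, y ≠ 0 → k (1 - x) y = 1) ?_ ?_ hx
      · intro x hx y hy
        obtain ⟨s, hs0, hs⟩ := exists_sq_eq_one_sub hx
        rw [hs, hk.sq_left hs0 hy]
      · intro x hx hx4 ih y hy
        rcases hx4.eq_or_lt with hx4 | hx4
        · obtain ⟨s, hs0, hs | hs⟩ := one_sub_eq_sq_or h2 ha1 ha hx4.ge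
          · rw [hs, hk.sq_left hs0 hy]
          · rw [hs, hk.sq_mul_left hs0 hδ0 hy, hδy y hy]
        · have hx0 : x ≠ 0 := norm_pos_iff.mp (h4p.trans hx4)
          have h1x := one_sub_ne_zero hx
          obtain ⟨n, d, hd, hxd⟩ := exists_zpow_mul h0 h1 hmax hx0
          have hxn : ‖x‖ = ‖π‖ ^ n := by rw [hxd, norm_mul, hd, mul_one, norm_zpow]
          rcases Int.even_or_odd' n with ⟨m, rfl | rfl⟩
          · obtain ⟨s, z, hs0, hz, e⟩ := one_sub_eq_sq_mul_of_even h2 h0 hxn hx hx4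
            rw [e, hk.sq_mul_left hs0 (one_sub_ne_zero (hz.trans hx)) hy, ih z hz y hy]
          -- At an odd level `1 - xy` lies deeper, so the induction hypothesis makes `1 - x`
          -- orthogonal to units. The relation `k(1 - x, x) = 1`, with `x` of odd valuation, then
          -- gives `k(1 - x, π) = 1`.
          · have hu : ∀ u : F, ‖u‖ = 1 → k (1 - x) u = 1 := by
              intro u hu
              obtain ⟨d, y, hd0, hy, rfl⟩ := unit_eq_sq_mul_one_sub h2 hu
              have hy0 := one_sub_ne_zero hy
              have hxy : ‖x * y‖ < ‖x‖ := by
                rw [norm_mul]; exact mul_lt_of_lt_one_right (norm_pos_iff.mpr hx0) hy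
              have hxy0 := one_sub_ne_zero (hxy.trans hx)
              rw [hk.sq_mul_right hd0 h1x hy0, hk.one_sub_one_sub hx0 h1x hy0 hxy0,
                hk.symm h1x hxy0, ih _ hxy _ h1x, ih _ hxy _ hx0, ih _ hxy _ hy0,
                ih _ hxy _ (neg_ne_zero.mpr one_ne_zero)]
              simp
            refine hk.eq_one_of_unit_of_uniformizer h0 h1 hmax h1x hu ?_ hy
            rw [← hk.zpow_uniformizer_of_odd h0 h1x (hne d hd) (hu d hd) ⟨m, rfl⟩, ← hxd]
            exact hk.steinberg _ _ h1x hx0 (by ring)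
    intro u y hu hy
    obtain ⟨d, z, hd0, hz, rfl⟩ := unit_eq_sq_mul_one_sub h2 hu
    rw [hk.sq_mul_left hd0 (one_sub_ne_zero hz) hy, main z hz y hy]
  · have main : ∀ x : F, ‖x‖ < 1 → (∀ y, y ≠ 0 → k (1 - x) y = 1) → IsSquare (1 - x) := by
      intro x hx
      refine level_induction h0 h1 hmax
        (C := fun x => (∀ y, y ≠ 0 → k (1 - x) y = 1) → IsSquare (1 - x)) ?_ ?_ hx
      · intro x hx _
        obtain ⟨s, hs0, hs⟩ := exists_sq_eq_one_sub hx
        exact ⟨s, by rw [hs, pow_two]⟩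
      · intro x hx hx4 ih hort
        rcases hx4.eq_or_lt with hx4 | hx4
        · obtain ⟨s, hs0, hs | hs⟩ := one_sub_eq_sq_or h2 ha1 ha hx4.ge
          · exact ⟨s, by rw [hs, pow_two]⟩
          · refine absurd (hort π hπ0) ?_
            rwa [hs, hk.sq_mul_left hs0 hδ0 hπ0]
        · have hx0 : x ≠ 0 := norm_pos_iff.mp (h4p.trans hx4)
          have h1x := one_sub_ne_zero hx
          obtain ⟨n, d, hd, hxd⟩ := exists_zpow_mul h0 h1 hmax hx0
          have hxn : ‖x‖ = ‖π‖ ^ n := by rw [hxd, norm_mul, hd, mul_one, norm_zpow]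
          rcases Int.even_or_odd' n with ⟨m, rfl | rfl⟩
          · obtain ⟨s, z, hs0, hz, e⟩ := one_sub_eq_sq_mul_of_even h2 h0 hxn hx hx4
            obtain ⟨r, hr⟩ := ih z hz fun y hy => by
              rw [← hort y hy, e, hk.sq_mul_left hs0 (one_sub_ne_zero (hz.trans hx)) hy]
            exact ⟨s * r, by rw [e, hr]; ring⟩
          · exfalso
            -- At an odd level choose `y` so that `1 - xy = δ`. Every symbol in `one_sub_one_sub`
            -- but `k(δ, x) = k(δ, π)` is trivial, contradicting `k(δ, π) ≠ 1`.
            have hy : ‖-(4 * a) / x‖ < 1 := by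
              rw [norm_div, h4a]; exact (div_lt_one (h4p.trans hx4)).mpr hx4
            have hy0 := one_sub_ne_zero hy
            have hxy : 1 - x * (-(4 * a) / x) = δ := by rw [hδe]; field_simp
            have h := hk.one_sub_one_sub hx0 h1x hy0 (by rw [hxy]; exact hδ0)
            rw [hxy, hort _ hy0, hort _ hδ0, hδu _ (norm_one_sub hy),
              hδu (-1) (by rw [norm_neg, norm_one]), one_mul, mul_one, mul_one, hxd,
              hk.zpow_uniformizer_of_odd h0 hδ0 (hne d hd) (hδu d hd) ⟨m, rfl⟩] at h
            exact hδπ h.symm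
    intro u hu hort
    obtain ⟨d, z, hd0, hz, rfl⟩ := unit_eq_sq_mul_one_sub h2 hu
    obtain ⟨r, hr⟩ := main z hz fun y hy => by
      rw [← hort y hy, hk.sq_mul_left hd0 (one_sub_ne_zero hz) hy]
    exact ⟨d * r, by rw [hr]; ring⟩

include hk in
-- Up to squares the only units are `1` and `a`, and `1 - a` is in the class of `a`. So the
-- Steinberg relation reads `k(a, a) = 1`, and `a` is the unit orthogonal to all units.
theorem isSquare_of_orthogonal_odd (h2 : ‖(2 : F)‖ = 1)
    (hnt : ∃ x y, x ≠ 0 ∧ y ≠ 0 ∧ k x y ≠ 1) {c : F} (hc0 : c ≠ 0)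
    (hc : ∀ y, y ≠ 0 → k c y = 1) : IsSquare c := by
  obtain ⟨π, h0, h1, hmax⟩ := exists_uniformizer F
  obtain ⟨a, ha1, ha1', hay, hay', ha⟩ := exists_nonsquare_units h2
  have hπ0 : π ≠ 0 := norm_pos_iff.mp h0
  have hne : ∀ u : F, ‖u‖ = 1 → u ≠ 0 := fun u hu => norm_ne_zero_iff.mp (hu ▸ one_ne_zero)
  have ha0 := hne a ha1
  have h4 : ‖(4 : F)‖ = 1 := by
    have : ‖(4 : F)‖ = ‖(2 : F)‖ ^ 2 := by rw [← norm_pow]; norm_num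
    rw [this, h2, one_pow]
  have hunit : ∀ u : F, ‖u‖ = 1 → ∃ s : F, s ≠ 0 ∧ ‖s‖ = 1 ∧ (u = s ^ 2 ∨ u = s ^ 2 * a) := by
    intro u hu
    obtain ⟨y, hy, h⟩ := ha u hu
    have hn : ∀ t z : F, ‖z‖ < ‖(4 : F)‖ → 1 - z = t ^ 2 → ‖t‖ = 1 := fun t z hz e => by
      have := norm_one_sub (h4 ▸ hz)
      rw [e, norm_pow] at this
      exact (pow_eq_one_iff_of_nonneg (norm_nonneg t) two_ne_zero).mp this
    rcases h with h | h
    · obtain ⟨z, hz, e⟩ := isSquare_mul_of_norm_sub_lt (r := 4)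
        (by rw [norm_pow, hy, one_pow]) (h4.symm ▸ h)
      obtain ⟨t, ht0, ht⟩ := exists_sq_eq_one_sub hz
      exact ⟨y * t, mul_ne_zero (hne y hy) ht0, by rw [norm_mul, hy, hn t z hz ht, one_mul],
        Or.inl (by rw [e, ht]; ring)⟩
    · obtain ⟨z, hz, e⟩ := isSquare_mul_of_norm_sub_lt (r := 4)
        (by rw [norm_mul, norm_pow, ha1, hy, one_pow, one_mul]) (h4.symm ▸ h)
      obtain ⟨t, ht0, ht⟩ := exists_sq_eq_one_sub hz
      exact ⟨y * t, mul_ne_zero (hne y hy) ht0, by rw [norm_mul, hy, hn t z hz ht, one_mul],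
        Or.inr (by rw [e, ht]; ring)⟩
  have haa : k a a = 1 := by
    obtain ⟨s, hs0, hs1, h | h⟩ := hunit (1 - a) ha1'
    · have := hay' s hs1.le
      rw [h, sub_self, norm_zero] at this
      exact absurd this zero_ne_one
    · have := hk.steinberg a (1 - a) ha0 (hne _ ha1') (by ring)
      rwa [h, hk.sq_mul_right hs0 ha0 ha0] at this
  have hau : ∀ u : F, ‖u‖ = 1 → k a u = 1 := by
    intro u hu
    obtain ⟨s, hs0, -, rfl | rfl⟩ := hunit u hu
    · rw [hk.symm ha0 (pow_ne_zero 2 hs0), hk.sq_left hs0 ha0]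
    · rw [hk.sq_mul_right hs0 ha0 ha0, haa]
  refine hk.isSquare_of_orthogonal h0 h1 hmax ha0 hau (fun haπ u y hu hy => ?_)
    (fun haπ u hu hort => ?_) hnt hc0 hc
  · obtain ⟨s, hs0, -, rfl | rfl⟩ := hunit u hu
    · exact hk.sq_left hs0 hy
    · rw [hk.sq_mul_left hs0 ha0 hy]
      exact hk.eq_one_of_unit_of_uniformizer h0 h1 hmax ha0 hau haπ hy
  · obtain ⟨s, hs0, -, rfl | rfl⟩ := hunit u hu
    · exact ⟨s, pow_two s⟩
    · refine absurd (hort π hπ0) ?_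
      rwa [hk.sq_mul_left hs0 ha0 hπ0]

end IsQuadraticSymbol

/-! ### Archimedean local fields -/

section Archimedean

variable {F : Type*} [NontriviallyNormedField F] [LocallyCompactSpace F] [CharZero F]

/-- By Ostrowski's theorem an absolute value on `ℚ` that is unbounded on `ℕ` is a power of the usual
one. -/
theorem uniformContinuous_ratCast (h : ¬ ∀ n : ℕ, ‖(n : F)‖ ≤ 1) :
    UniformContinuous (Rat.castHom F) := by
  let f : AbsoluteValue ℚ ℝ := (NormedField.toAbsoluteValue F).comp (Rat.castHom F).injective
  have hf : ∀ q : ℚ, f q = ‖(q : F)‖ := fun _ => rfl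
  have hfr : f.IsEquiv Rat.AbsoluteValue.real :=
    Rat.AbsoluteValue.equiv_real_of_unbounded (f := f) (by simpa [hf] using h)
  obtain ⟨c, hc, e⟩ := AbsoluteValue.isEquiv_iff_exists_rpow_eq.mp hfr.symm
  refine uniformContinuous_of_continuousAt_zero (Rat.castHom F) ?_
  rw [ContinuousAt, map_zero, tendsto_zero_iff_norm_tendsto_zero]
  have e' : (fun q : ℚ => ‖Rat.castHom F q‖) = fun q : ℚ => |(q : ℝ)| ^ c := by
    funext q
    have := congrFun e q
    rw [hf] at this
    rw [Rat.coe_castHom, ← this]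
    simp
  rw [e']
  have hcont : Continuous fun q : ℚ => |(q : ℝ)| ^ c :=
    (Real.continuous_rpow_const hc.le).comp (continuous_abs.comp Rat.continuous_coe_real)
  have := hcont.tendsto 0
  simpa [Real.zero_rpow hc.ne'] using this

/-- The map `ℚ → F` extends to `ℝ`; local compactness makes `F` finite-dimensional over `ℝ`, hence
isomorphic to `ℝ` or `ℂ`. -/
theorem isSquare_or_isSquare_neg (h : ¬ ∀ n : ℕ, ‖(n : F)‖ ≤ 1) (x : F) :
    IsSquare x ∨ IsSquare (-x) := by
  have : ProperSpace F := .of_nontriviallyNormedField_of_weaklyLocallyCompactSpace F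
  have hu := uniformContinuous_ratCast h
  have ue : IsUniformInducing (Rat.castHom ℝ) := Rat.isUniformEmbedding_coe_real.isUniformInducing
  have dr : DenseRange (Rat.castHom ℝ) := Rat.denseRange_cast
  let φ : ℝ →+* F := IsDenseInducing.extendRingHom ue dr hu
  have hφ : Continuous φ := (uniformContinuous_uniformly_extend ue dr hu).continuous
  let _ : Algebra ℝ F := φ.toAlgebra
  have : ContinuousSMul ℝ F := ⟨(hφ.comp continuous_fst).mul continuous_snd⟩
  have : FiniteDimensional ℝ F := FiniteDimensional.of_locallyCompactSpace ℝ
  rcases Real.nonempty_algEquiv_or F with ⟨⟨e⟩⟩ | ⟨⟨e⟩⟩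
  · rcases le_total 0 (e x) with h | h
    · refine Or.inl ⟨e.symm (√(e x)), ?_⟩
      rw [← map_mul, Real.mul_self_sqrt h, e.symm_apply_apply]
    · refine Or.inr ⟨e.symm (√(-(e x))), ?_⟩
      rw [← map_mul, Real.mul_self_sqrt (neg_nonneg.mpr h), map_neg, e.symm_apply_apply]
  · obtain ⟨z, hz⟩ := IsAlgClosed.exists_pow_nat_eq (e x) two_pos
    exact Or.inl ⟨e.symm z, by rw [← map_mul, ← pow_two, hz, e.symm_apply_apply]⟩

end Archimedean

/-! ### Nondegeneracy over an arbitrary local field -/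

namespace IsQuadraticSymbol

variable {F A : Type*} [NontriviallyNormedField F] [LocallyCompactSpace F] [CharZero F]
  [CommGroup A] {k : F → F → A} (hk : IsQuadraticSymbol k)

include hk in
-- If `c` is not a square then `-c` is, so `-1` lies in the radical. Every element being a square up
-- to sign, the symbol would be trivial.
theorem isSquare_of_orthogonal_archimedean (h : ¬ ∀ n : ℕ, ‖(n : F)‖ ≤ 1)
    (hnt : ∃ x y, x ≠ 0 ∧ y ≠ 0 ∧ k x y ≠ 1) {c : F} (hc0 : c ≠ 0)
    (hc : ∀ y, y ≠ 0 → k c y = 1) : IsSquare c := by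
  rcases isSquare_or_isSquare_neg h c with hsq | ⟨r, hr⟩
  · exact hsq
  exfalso
  have hr0 : r ≠ 0 := by
    rintro rfl
    rw [mul_zero, neg_eq_zero] at hr
    exact hc0 hr
  have h1 : (-1 : F) ≠ 0 := neg_ne_zero.mpr one_ne_zero
  have hcr : c = r ^ 2 * (-1) := by linear_combination -hr
  have hneg : ∀ y, y ≠ 0 → k (-1) y = 1 := fun y hy => by
    rw [← hc y hy, hcr, hk.sq_mul_left hr0 h1 hy]
  obtain ⟨x, y, hx, hy, hxy⟩ := hnt
  refine hxy ?_
  rcases isSquare_or_isSquare_neg h x with ⟨s, hs⟩ | ⟨s, hs⟩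
  · have hs0 : s ≠ 0 := by rintro rfl; simp [hx] at hs
    rw [hs, ← pow_two, hk.sq_left hs0 hy]
  · have hs0 : s ≠ 0 := by rintro rfl; simp [hx] at hs
    have : x = s ^ 2 * (-1) := by linear_combination -hs
    rw [this, hk.sq_mul_left hs0 h1 hy, hneg y hy]

include hk in
/-- Nontrivial quadratic Steinberg symbols on a local field are nondegenerate. -/
theorem isSquare_of_orthogonal_localField (hnt : ∃ x y, x ≠ 0 ∧ y ≠ 0 ∧ k x y ≠ 1) {c : F}
    (hc0 : c ≠ 0) (hc : ∀ y, y ≠ 0 → k c y = 1) : IsSquare c := by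
  by_cases h : ∀ n : ℕ, ‖(n : F)‖ ≤ 1
  · have : IsUltrametricDist F :=
      IsUltrametricDist.isUltrametricDist_of_forall_norm_natCast_le_one h
    rcases (show ‖(2 : F)‖ ≤ 1 by exact_mod_cast h 2).lt_or_eq with h2 | h2
    · exact hk.isSquare_of_orthogonal_dyadic h2 hnt hc0 hc
    · exact hk.isSquare_of_orthogonal_odd h2 hnt hc0 hc
  · exact hk.isSquare_of_orthogonal_archimedean h hnt hc0 hc

end IsQuadraticSymbol

/-- Nontrivial Steinberg symbols with values in `μ₂` on a local field are nondegenerate. -/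
theorem isSquare_of_steinberg {F A : Type*} [NontriviallyNormedField F] [LocallyCompactSpace F]
    [CharZero F] [CommGroup A] (hA : ∀ a : A, a * a = 1) (κ : Fˣ →* Fˣ →* A)
    (hκ : ∀ s t : Fˣ, (s : F) + t = 1 → κ s t = 1) (hnt : ∃ s t, κ s t ≠ 1) {c : Fˣ}
    (hc : ∀ s, κ s c = 1) : IsSquare c := by
  classical
  -- The value `1` at zero arguments matters only for `mul_self`, which is imposed without a
  -- nonvanishing condition.
  let k : F → F → A := fun x y =>
    if h : x ≠ 0 ∧ y ≠ 0 then κ (Units.mk0 x h.1) (Units.mk0 y h.2) else 1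
  have hk1 : ∀ (x y : F) (hx : x ≠ 0) (hy : y ≠ 0),
      k x y = κ (Units.mk0 x hx) (Units.mk0 y hy) := fun x y hx hy => dif_pos ⟨hx, hy⟩
  have hk : IsQuadraticSymbol k := by
    refine ⟨fun x x' y hx hx' hy => ?_, fun x y y' hx hy hy' => ?_, fun x y hx hy h => ?_,
      fun x y => hA _⟩
    · rw [hk1 _ _ (mul_ne_zero hx hx') hy, hk1 _ _ hx hy, hk1 _ _ hx' hy, Units.mk0_mul, map_mul,
        MonoidHom.mul_apply]
    · rw [hk1 _ _ hx (mul_ne_zero hy hy'), hk1 _ _ hx hy, hk1 _ _ hx hy', Units.mk0_mul, map_mul]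
    · rw [hk1 _ _ hx hy]; exact hκ _ _ h
  obtain ⟨s, t, hst⟩ := hnt
  obtain ⟨r, hr⟩ := hk.isSquare_of_orthogonal_localField
    ⟨s, t, s.ne_zero, t.ne_zero, by rwa [hk1 _ _ s.ne_zero t.ne_zero, Units.mk0_val, Units.mk0_val]⟩
    c.ne_zero fun y hy => by
      rw [hk.symm c.ne_zero hy, hk1 _ _ hy c.ne_zero, Units.mk0_val]; exact hc _
  have hr0 : r ≠ 0 := by rintro rfl; simp at hr
  exact ⟨Units.mk0 r hr0, Units.ext hr⟩

/-! ### Simply laced roots and their root vectors -/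

section Roots

variable {F L : Type*} [Field F] [CharZero F] [LieRing L] [LieAlgebra F L]
  [FiniteDimensional F L] [IsKilling F L] {H : LieSubalgebra F L} [H.IsCartanSubalgebra]
  [LieModule.IsTriangularizable F H L]

theorem root_ext {α β : H.root} (h : ∀ x, α.1 x = β.1 x) : α = β :=
  Subtype.ext (LieModule.Weight.ext h)

theorem negRoot_apply (α : H.root) (x : H) : (negRoot α).1 x = -α.1 x := rfl

/-- The reflection of the root `β` in the root `α`. -/
noncomputable def reflect (α β : H.root) : H.root := (rootSystem H).reflectionPerm α β

theorem reflect_apply (α β : H.root) (x : H) :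
    (reflect α β).1 x = β.1 x - (rootSystem H).pairingIn ℤ β α * α.1 x := by
  have h : (rootSystem H).root (reflect α β) = (rootSystem H).root β -
      (rootSystem H).pairingIn ℤ β α • (rootSystem H).root α := by
    rw [reflect, RootPairing.root_reflectionPerm, RootPairing.reflection_apply_root' ℤ]
  have := LinearMap.congr_fun h x
  simpa using this

theorem reflect_reflect (α β : H.root) : reflect α (reflect α β) = β :=
  (rootSystem H).reflectionPerm_involutive α β

theorem reflect_self (α : H.root) : reflect α α = negRoot α := by
  refine root_ext fun x => ?_
  rw [reflect_apply, pairingIn_self, negRoot_apply]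
  push_cast
  ring

theorem reflect_negRoot (α β : H.root) : reflect α (negRoot β) = negRoot (reflect α β) := by
  refine root_ext fun x => ?_
  rw [reflect_apply, pairingIn_negRoot_left, negRoot_apply, negRoot_apply, reflect_apply]
  push_cast
  ring

theorem pairingIn_of_apply_eq {α β γ : H.root} {m n : ℤ}
    (h : ∀ x, γ.1 x = m * α.1 x + n * β.1 x) (δ : H.root) :
    (rootSystem H).pairingIn ℤ γ δ =
      m * (rootSystem H).pairingIn ℤ α δ + n * (rootSystem H).pairingIn ℤ β δ := by
  apply Int.cast_injective (α := F)
  push_cast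
  rw [← pairing_eq_cast, ← pairing_eq_cast, ← pairing_eq_cast, h]

/-- Any two nonproportional roots pair to `0`, `1` or `-1`. -/
def HasSimplyLacedRoots (H : LieSubalgebra F L) [H.IsCartanSubalgebra]
    [LieModule.IsTriangularizable F H L] : Prop :=
  ∀ α β : H.root, β ≠ α → β ≠ negRoot α →
    ((rootSystem H).pairingIn ℤ β α, (rootSystem H).pairingIn ℤ α β) ∈
      ({(0, 0), (1, 1), (-1, -1)} : Set (ℤ × ℤ))

/-- Adjacent simple roots have equal length, both Cartan entries being `-1`. Connectedness of the
diagram and reflections extend this to all roots, and nonproportional roots of equal length pair to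
`0` or `±1`. -/
theorem hasSimplyLacedRoots_of_isSimplyLaced [(rootSystem H).IsIrreducible]
    (b : (rootSystem H).Base) (hb : b.cartanMatrix.IsSimplyLaced) : HasSimplyLacedRoots H := by
  let Q := ((rootSystem H).posRootForm ℤ).toInvariantForm
  let len : H.root → F := fun α => Q.form ((rootSystem H).root α) ((rootSystem H).root α)
  have hrefl : ∀ α β, len ((rootSystem H).reflectionPerm α β) = len β := by
    intro α β
    simp only [len, RootPairing.root_reflectionPerm, Q.apply_reflection_reflection]
  have hsimple : ∀ i j : b.support, len i = len j := by
    intro i j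
    refine b.induction_on_cartanMatrix (fun j => len i = len j) (i := i) rfl ?_
    intro k l hk hkl
    by_cases hne : k = l
    · rw [hk, hne]
    rw [hk]
    have h1 : b.cartanMatrix l k = -1 := (hb (Ne.symm hne)).resolve_left hkl
    have h2 : b.cartanMatrix k l = -1 :=
      (hb hne).resolve_left fun h => hkl (b.cartanMatrix_apply_eq_zero_iff_symm.mp h)
    have := Q.pairing_mul_eq_pairing_mul_swap (k : H.root) l
    rw [← (rootSystem H).algebraMap_pairingIn ℤ, ← (rootSystem H).algebraMap_pairingIn ℤ] at this
    change algebraMap ℤ F (b.cartanMatrix l k) * _ = algebraMap ℤ F (b.cartanMatrix k l) * _ at this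
    rw [h1, h2] at this
    exact mul_left_cancel₀ (by simp) this
  have hall : ∀ α (i : b.support), len α = len i := by
    intro α i
    refine b.induction_reflect α (p := fun α => len α = len i) ?_ ?_ ?_
    · intro α h; rw [hrefl, h]
    · intro j hj; exact hsimple ⟨j, hj⟩ i
    · intro α j h _; rw [hrefl, h]
  intro α β hne hne'
  have hlen : len β = len α := by
    have : Nonempty H.root := ⟨α⟩
    obtain ⟨i, hi⟩ := b.support_nonempty
    rw [hall β ⟨i, hi⟩, hall α ⟨i, hi⟩]
  refine (rootSystem H).pairingIn_pairingIn_mem_set_of_length_eq_of_ne (B := Q) hlen hne ?_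
  intro h
  refine hne' (root_ext fun x => ?_)
  have := LinearMap.congr_fun h x
  simpa [negRoot_apply] using this

theorem abs_pairingIn_le_two (hsl : HasSimplyLacedRoots H) (α β : H.root) :
    |(rootSystem H).pairingIn ℤ β α| ≤ 2 := by
  by_cases h1 : β = α
  · rw [h1, pairingIn_self]; norm_num
  by_cases h2 : β = negRoot α
  · rw [h2, pairingIn_negRoot_left, pairingIn_self]; norm_num
  have := hsl α β h1 h2
  simp only [Set.mem_insert_iff, Set.mem_singleton_iff, Prod.mk.injEq] at this
  rcases this with h | h | h <;> rw [h.1] <;> norm_num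

namespace ChevalleyBasis

variable (B : ChevalleyBasis H) (V : Type*) [AddCommGroup V] [Module F V] [LieRingModule L V]
  [LieModule F L V] [FiniteDimensional F V]

theorem lie_eq_zero_or_exists_root {α β : H.root} (hne : β ≠ negRoot α) {x y : L}
    (hx : x ∈ rootSpace H α.1) (hy : y ∈ rootSpace H β.1) :
    ⁅x, y⁆ = 0 ∨ ∃ γ : H.root, ∀ z, γ.1 z = α.1 z + β.1 z := by
  by_contra! h
  obtain ⟨h0, h⟩ := h
  have hmem : ⁅x, y⁆ ∈ rootSpace H ((α.1 : H → F) + β.1) :=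
    lie_mem_genWeightSpace_of_mem_genWeightSpace hx hy
  have hbot : rootSpace H ((α.1 : H → F) + β.1) ≠ ⊥ := by
    intro hb
    rw [hb] at hmem
    exact h0 hmem
  let δ : LieModule.Weight F H L := ⟨(α.1 : H → F) + β.1, hbot⟩
  have hδ : δ.IsNonZero := by
    intro hz
    refine hne (root_ext fun z => ?_)
    have := congrFun hz z
    change α.1 z + β.1 z = 0 at this
    rw [negRoot_apply]
    linear_combination this
  obtain ⟨z, hz⟩ := h ⟨δ, by
    simpa only [LieSubalgebra.root, Finset.mem_filter, Finset.mem_univ, true_and] using hδ⟩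
  exact hz rfl

theorem lie_X_X_eq (α β : H.root) (hne : β ≠ negRoot α) :
    ⁅B.X α, B.X β⁆ = 0 ∨ ∃ (γ : H.root) (c : F), (∀ z, γ.1 z = α.1 z + β.1 z) ∧
      ⁅B.X α, B.X β⁆ = c • B.X γ := by
  refine (lie_eq_zero_or_exists_root hne (B.X_mem α) (B.X_mem β)).imp_right ?_
  rintro ⟨γ, hγ⟩
  rcases B.lie_X_X α β γ (funext hγ) with h | h
  · exact ⟨γ, _, hγ, by rw [h, ← Nat.cast_smul_eq_nsmul F]⟩
  · exact ⟨γ, -_, hγ, by rw [h, ← Nat.cast_smul_eq_nsmul F, neg_smul]⟩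

theorem rep_mul_sub (α : H.root) (y : L) :
    B.rep V α * LieModule.toEnd F L V y - LieModule.toEnd F L V y * B.rep V α =
      LieModule.toEnd F L V ⁅B.X α, y⁆ := by
  ext v
  simp [rep]

/-- For `β ≠ ±α`, a root `2α + β` would pair with `α` to `4 + ⟨β,α⟩ ≥ 3`. -/
theorem lie_lie_X_eq_zero (hsl : HasSimplyLacedRoots H) {α β : H.root} (hne : β ≠ negRoot α) :
    ⁅B.X α, ⁅B.X α, B.X β⁆⁆ = 0 := by
  rcases B.lie_X_X_eq α β hne with h | ⟨γ, c, hγ, h⟩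
  · rw [h, lie_zero]
  have hp := abs_pairingIn_le_two hsl α γ
  have hγα := pairingIn_of_apply_eq (m := 1) (n := 1) (fun x => by rw [hγ]; push_cast; ring) α
    (α := α) (β := β) (γ := γ)
  rw [pairingIn_self] at hγα
  by_cases h1 : β = α
  · rw [h1, lie_self, lie_zero]
  have h2 := hsl α β h1 hne
  simp only [Set.mem_insert_iff, Set.mem_singleton_iff, Prod.mk.injEq] at h2
  have hne' : γ ≠ negRoot α := by
    rintro rfl
    rw [pairingIn_negRoot_left, pairingIn_self] at hγα
    omega
  rw [h, lie_smul]
  rcases B.lie_X_X_eq α γ hne' with h' | ⟨δ, d, hδ, -⟩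
  · rw [h', smul_zero]
  · have hp' := abs_pairingIn_le_two hsl α δ
    have hδα := pairingIn_of_apply_eq (m := 1) (n := 1) (fun x => by rw [hδ]; push_cast; ring) α
      (α := α) (β := γ) (γ := δ)
    rw [pairingIn_self] at hδα
    rw [abs_le] at hp hp'
    omega

theorem nilExp_mul_of_commutator {E X Y : Module.End F V} (hE : IsNilpotent E)
    (h1 : E * X - X * E = Y) (h2 : E * Y = Y * E) : nilExp E * X = (X + Y) * nilExp E := by
  let _ : Module ℚ (Module.End F V) := Module.compHom (Module.End F V) (algebraMap ℚ F)
  have := exp_mul_of_commutator (d := 0) hE h1 (by rw [h2, sub_self, smul_zero]) (Commute.zero_right E)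
  rw [add_zero] at this
  exact this

/-- The action of `x_α(s)` on `X_β`. -/
theorem toEnd_x_mul (hsl : HasSimplyLacedRoots H) {α β : H.root} (hne : β ≠ negRoot α) (s : F) :
    B.toEnd (B.x V α (Multiplicative.ofAdd s)) * B.rep V β =
      (B.rep V β + s • LieModule.toEnd F L V ⁅B.X α, B.X β⁆) *
        B.toEnd (B.x V α (Multiplicative.ofAdd s)) := by
  rw [toEnd_x]
  have h1 := B.rep_mul_sub V α (B.X β)
  have h2 := B.rep_mul_sub V α ⁅B.X α, B.X β⁆
  rw [B.lie_lie_X_eq_zero hsl hne, map_zero, sub_eq_zero] at h2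
  refine nilExp_mul_of_commutator V (B.isNilpotent_toEnd V α s) ?_ ?_
  · rw [← h1, smul_mul_assoc, mul_smul_comm, ← smul_sub]; rfl
  · simp only [smul_mul_assoc, mul_smul_comm, h2]

variable {V} in
-- Put `Y = [X_α, X_β]`. Conjugating `X_β` by `x_α(t)` gives `X_β + tY`; then `x_{-α}(-t⁻¹)` cancels
-- `X_β`, because `[X_{-α}, Y] = X_β`; the last `x_α(t)` fixes `tY`.
theorem toEnd_w_mul_of_pairingIn_eq_neg_one (hsl : HasSimplyLacedRoots H) {α β : H.root}
    (hp : (rootSystem H).pairingIn ℤ β α = -1) (t : Fˣ) :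
    B.toEnd (B.w α t : B.group V) * B.rep V β =
      (t : F) • (LieModule.toEnd F L V ⁅B.X α, B.X β⁆ * B.toEnd (B.w α t : B.group V)) := by
  have hne : β ≠ negRoot α := by
    rintro rfl
    rw [pairingIn_negRoot_left, pairingIn_self] at hp
    omega
  have hne' : β ≠ negRoot (negRoot α) := by
    rw [negRoot_negRoot]
    rintro rfl
    rw [pairingIn_self] at hp
    omega
  have hFX : ⁅B.X (negRoot α), B.X β⁆ = 0 := by
    rcases B.lie_X_X_eq _ _ hne' with h | ⟨γ, c, hγ, -⟩
    · exact h
    · have := pairingIn_of_apply_eq (m := -1) (n := 1) (α := α) (β := β) (γ := γ)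
        (fun x => by rw [hγ, negRoot_apply]; push_cast; ring) α
      have h3 := abs_pairingIn_le_two hsl α γ
      rw [pairingIn_self] at this
      rw [abs_le] at h3
      omega
  have hFY : ⁅B.X (negRoot α), ⁅B.X α, B.X β⁆⁆ = B.X β := by
    rw [leibniz_lie, hFX, lie_zero, add_zero, ← lie_skew (B.X (negRoot α)) (B.X α), B.lie_X_neg, neg_lie, lie_H_X,
      pairing_eq_cast, hp]
    simp
  have hX := B.toEnd_x_mul V hsl hne t
  set Y := LieModule.toEnd F L V ⁅B.X α, B.X β⁆ with hYdef
  have hY : B.toEnd (B.x V α (Multiplicative.ofAdd (t : F))) * Y =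
      Y * B.toEnd (B.x V α (Multiplicative.ofAdd (t : F))) := by
    have h2 := B.rep_mul_sub V α ⁅B.X α, B.X β⁆
    rw [B.lie_lie_X_eq_zero hsl hne, map_zero, sub_eq_zero] at h2
    have := nilExp_mul_of_commutator V (X := Y) (Y := 0) (B.isNilpotent_toEnd V α t)
      (by simp only [smul_mul_assoc, mul_smul_comm]; rw [sub_eq_zero]; exact congrArg _ h2)
      (by simp)
    rwa [add_zero] at this
  set u : F := -(t⁻¹ : Fˣ) with hu
  have hFX' : B.toEnd (B.x V (negRoot α) (Multiplicative.ofAdd u)) * B.rep V β =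
      B.rep V β * B.toEnd (B.x V (negRoot α) (Multiplicative.ofAdd u)) := by
    have := B.toEnd_x_mul V hsl hne' u
    rwa [hFX, map_zero, smul_zero, add_zero] at this
  have hFY' : B.toEnd (B.x V (negRoot α) (Multiplicative.ofAdd u)) * Y =
      (Y + u • B.rep V β) * B.toEnd (B.x V (negRoot α) (Multiplicative.ofAdd u)) := by
    have h1 := B.rep_mul_sub V (negRoot α) ⁅B.X α, B.X β⁆
    have h2 := B.rep_mul_sub V (negRoot α) (B.X β)
    rw [hFX, map_zero, sub_eq_zero] at h2
    rw [hFY] at h1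
    refine nilExp_mul_of_commutator V (B.isNilpotent_toEnd V _ u) ?_ ?_
    · rw [smul_mul_assoc, mul_smul_comm, ← smul_sub]; exact congrArg _ h1
    · simp only [smul_mul_assoc, mul_smul_comm]; exact congrArg _ (congrArg _ h2)
  rw [w, map_mul, map_mul, mul_assoc, mul_assoc, hX, ← mul_assoc (B.toEnd (B.x V (negRoot α) _)),
    mul_add, mul_smul_comm, hFX', hFY', ← smul_mul_assoc, ← add_mul, smul_add, smul_smul]
  have : (t : F) * u = -1 := by rw [hu, mul_neg, Units.mul_inv]
  rw [this, neg_one_smul, add_comm (_ • _), ← add_assoc, add_neg_cancel, zero_add, mul_assoc,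
    ← mul_assoc (B.toEnd (B.x V α _)), mul_smul_comm, hY]
  simp only [smul_mul_assoc, mul_assoc, hu]

end ChevalleyBasis

end Roots

/-! ### An injective integral grading of the roots -/

section Grading

variable {F L : Type*} [Field F] [CharZero F] [LieRing L] [LieAlgebra F L]
  [FiniteDimensional F L] [IsKilling F L] {H : LieSubalgebra F L} [H.IsCartanSubalgebra]
  [LieModule.IsTriangularizable F H L]

/-- There is an injective integral grading of the roots, given by evaluation at an element of the
Cartan subalgebra, for which the positive roots are those of positive degree. -/
theorem exists_grading (b : (rootSystem H).Base) : ∃ (D : H) (f : H.root → ℤ),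
    (∀ α, α.1 D = f α) ∧ Function.Injective f ∧ ∀ α, b.IsPos α ↔ 0 < f α := by
  classical
  choose a ha hpos hsum using b.exists_root_eq_sum_int
  have hinj : ∀ α β : H.root, (∀ j ∈ b.support, a α j = a β j) → α = β := by
    intro α β h
    apply (rootSystem H).root.injective
    rw [hsum α, hsum β]
    exact Finset.sum_congr rfl fun j hj => by rw [h j hj]
  let e : H.root → ℕ := fun α => (Finite.equivFin H.root α : ℕ)
  have he : Function.Injective e := Fin.val_injective.comp (Finite.equivFin H.root).injective
  -- The degree of `α` will be `p α` at a positive integer. Avoiding the roots of all differences `p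
  -- α - p β` gives injectivity, and positivity of the integer preserves signs.
  let p : H.root → Polynomial ℤ := fun α =>
    ∑ j ∈ b.support, Polynomial.C (a α j) * Polynomial.X ^ e j
  have hp : Function.Injective p := by
    intro α β h
    refine hinj α β fun j hj => ?_
    have hc : ∀ α, (p α).coeff (e j) = a α j := by
      intro α
      simp only [p, Polynomial.finsetSum_coeff, Polynomial.coeff_C_mul, Polynomial.coeff_X_pow]
      rw [Finset.sum_eq_single_of_mem j hj]
      · simp
      · intro k _ hk
        rw [if_neg (fun h => hk (he h).symm), mul_zero]
    rw [← hc α, ← hc β, h]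
  -- For `α = β` the difference is zero, whose `roots` are empty by convention, so the diagonal
  -- excludes nothing.
  let bad : Finset ℤ := Finset.univ.biUnion fun α => Finset.univ.biUnion fun β =>
    (p α - p β).roots.toFinset
  obtain ⟨_, ⟨N, rfl⟩, hN⟩ := (Set.infinite_range_of_injective
    (f := fun n : ℕ => (n : ℤ) + 1) fun m n h => by simpa using h).exists_notMem_finset bad
  have hN' : ∀ α β, (p α).eval ((N : ℤ) + 1) = (p β).eval ((N : ℤ) + 1) → α = β := by
    intro α β h
    by_contra hne
    refine hN (Finset.mem_biUnion.mpr ⟨α, Finset.mem_univ _, Finset.mem_biUnion.mpr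
      ⟨β, Finset.mem_univ _, ?_⟩⟩)
    rw [Multiset.mem_toFinset, Polynomial.mem_roots (sub_ne_zero.mpr fun h => hne (hp h)),
      Polynomial.IsRoot, Polynomial.eval_sub, h, sub_self]
  have hev : ∀ α, (p α).eval ((N : ℤ) + 1) = ∑ j ∈ b.support, a α j * ((N : ℤ) + 1) ^ e j := by
    intro α
    simp [p, Polynomial.eval_finsetSum]
  let D : H := (Module.evalEquiv F H).symm
    (b.toWeightBasis.constr F fun j : b.support => ((N : F) + 1) ^ e j)
  refine ⟨D, fun α => (p α).eval ((N : ℤ) + 1), fun α => ?_, fun α β h => hN' α β h, fun α => ?_⟩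
  · have hD : ∀ j ∈ b.support, (rootSystem H).root j D = ((N : F) + 1) ^ e j := by
      intro j hj
      rw [Module.apply_evalEquiv_symm_apply, ← b.toWeightBasis_apply ⟨j, hj⟩,
        Module.Basis.constr_basis]
    have h1 : (rootSystem H).root α D = α.1 D := rfl
    change _ = (((p α).eval ((N : ℤ) + 1) : ℤ) : F)
    rw [← h1, hsum α, LinearMap.sum_apply, hev]
    push_cast
    refine Finset.sum_congr rfl fun j hj => ?_
    rw [LinearMap.smul_apply, hD j hj, zsmul_eq_mul]
  · have hle : ∀ j, (1 : ℤ) ≤ ((N : ℤ) + 1) ^ e j := fun j => one_le_pow₀ (by omega)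
    change 0 < b.height α ↔ 0 < (p α).eval ((N : ℤ) + 1)
    have h0 := b.height_ne_zero α
    rw [hev]
    rw [RootPairing.Base.height_eq_sum (hsum α)] at h0 ⊢
    rcases hpos α with h | h
    · have hs : ∑ j ∈ b.support, a α j ≤ ∑ j ∈ b.support, a α j * ((N : ℤ) + 1) ^ e j :=
        Finset.sum_le_sum fun j _ => le_mul_of_one_le_right (h.le j) (hle j)
      have hn : 0 ≤ ∑ j ∈ b.support, a α j := Finset.sum_nonneg fun j _ => h.le j
      omega
    · have hs : ∑ j ∈ b.support, a α j * ((N : ℤ) + 1) ^ e j ≤ ∑ j ∈ b.support, a α j :=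
        Finset.sum_le_sum fun j _ => mul_le_of_one_le_right (h.le j) (hle j)
      have hn : ∑ j ∈ b.support, a α j ≤ 0 := Finset.sum_nonpos fun j _ => h.le j
      omega

end Grading

/-! ### Weyl elements permute the root groups; commutator relations -/

section WeylAction

variable {F L : Type*} [Field F] [CharZero F] [LieRing L] [LieAlgebra F L]
  [FiniteDimensional F L] [IsKilling F L] {H : LieSubalgebra F L} [H.IsCartanSubalgebra]
  [LieModule.IsTriangularizable F H L] {B : ChevalleyBasis H}
  {V : Type*} [AddCommGroup V] [Module F V] [LieRingModule L V]
  [LieModule F L V] [FiniteDimensional F V]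

namespace ChevalleyBasis

/-- If `X_α` acted as zero, so would the coroot of `α`. All weights of `V`, hence all integral
weights, would vanish on it, whereas `α` takes the value `2`. -/
theorem rep_ne_zero (hV : HasFullWeightLattice H V) (α : H.root) : B.rep V α ≠ 0 := by
  intro h0
  have hcor : repCoroot H V α = 0 := by
    have := (B.isNilpotentSlTwo V α).e_mul_f
    simp only [h0, zero_mul, mul_zero, sub_self] at this
    exact this.symm
  have hmem := hV (LieModule.Weight.toLinear F H L α.1) fun β =>
    ⟨_, pairing_eq_cast α β⟩
  have : LieModule.Weight.toLinear F H L α.1 (coroot α.1) = 0 := by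
    refine AddSubgroup.closure_induction (p := fun (μ : Module.Dual F H) _ => μ (coroot α.1) = 0)
      ?_ rfl (fun μ ν _ _ hμ hν => ?_) (fun μ _ hμ => ?_) hmem
    · intro μ hμ
      by_contra hne
      refine hμ ((LieSubmodule.eq_bot_iff _).mpr fun v hv => ?_)
      have h1 := (LieModule.mem_weightSpace (μ : H → F) v).mp hv (coroot α.1)
      have h2 : ⁅(coroot α.1 : H), v⁆ = repCoroot H V α v := rfl
      rw [h2, hcor, LinearMap.zero_apply] at h1
      exact (smul_eq_zero.mp h1.symm).resolve_left hne
    · rw [LinearMap.add_apply, hμ, hν, add_zero]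
    · rw [LinearMap.neg_apply, hμ, neg_zero]
  have h2 : α.1 (coroot α.1) = 2 := root_apply_coroot (isNonZero_root α)
  exact two_ne_zero (h2.symm.trans this)

variable (B) in
/-- Conjugation by `g` maps the root vector `X_α` to a nonzero multiple of `X_β`. -/
def MapsRoot (g : B.group V) (α β : H.root) : Prop :=
  ∃ c : F, c ≠ 0 ∧ B.toEnd g * B.rep V α = c • (B.rep V β * B.toEnd g)

theorem MapsRoot.inv {g : B.group V} {α β : H.root} (h : B.MapsRoot g α β) :
    B.MapsRoot g⁻¹ β α := by
  obtain ⟨c, hc, h⟩ := h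
  refine ⟨c⁻¹, inv_ne_zero hc, ?_⟩
  have e : B.toEnd g⁻¹ * (B.toEnd g * B.rep V α) * B.toEnd g⁻¹ =
      c • (B.toEnd g⁻¹ * B.rep V β * (B.toEnd g * B.toEnd g⁻¹)) := by
    rw [h]; simp only [mul_smul_comm, smul_mul_assoc, mul_assoc]
  rw [B.toEnd_mul_inv, mul_one, ← mul_assoc, B.toEnd_inv_mul, one_mul] at e
  rw [e, smul_smul, inv_mul_cancel₀ hc, one_smul]

theorem MapsRoot.mul {g g' : B.group V} {α β γ : H.root} (h : B.MapsRoot g β γ)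
    (h' : B.MapsRoot g' α β) : B.MapsRoot (g * g') α γ := by
  obtain ⟨c, hc, h⟩ := h
  obtain ⟨c', hc', h'⟩ := h'
  refine ⟨c' * c, mul_ne_zero hc' hc, ?_⟩
  rw [map_mul, mul_assoc, h', mul_smul_comm, ← mul_assoc, h, smul_mul_assoc, smul_smul, mul_assoc]

theorem mul_rep_eq_zero {g : B.group V} {Y : Module.End F V} (h : Y * B.toEnd g = 0) : Y = 0 := by
  have : Y * B.toEnd g * B.toEnd g⁻¹ = 0 := by rw [h, zero_mul]
  rwa [mul_assoc, B.toEnd_mul_inv, mul_one] at this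

/-- The scalars by which an element of the group acts on opposite root vectors are inverse to each
other. -/
theorem exists_unit_of_mapsRoot (hV : HasFullWeightLattice H V) {g : B.group V} {α β : H.root}
    (h : B.MapsRoot g α β) (h' : B.MapsRoot g (negRoot α) (negRoot β)) :
    ∃ c : Fˣ, B.toEnd g * B.rep V α = (c : F) • (B.rep V β * B.toEnd g) ∧
      B.toEnd g * B.rep V (negRoot α) =
        ((c⁻¹ : Fˣ) : F) • (B.rep V (negRoot β) * B.toEnd g) := by
  obtain ⟨c, hc, h⟩ := h
  obtain ⟨c', hc', h'⟩ := h'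
  -- Conjugation takes the coroot of `α` to `c c'` times that of `β`; the eigenvalue `2` in `[h, e]
  -- = 2e` for both triples forces `c c' = 1`.
  have hcc : c * c' = 1 := by
    have e1 : B.toEnd g * repCoroot H V α = (c * c') • (repCoroot H V β * B.toEnd g) := by
      have i1 := (B.isNilpotentSlTwo V α).e_mul_f
      have i2 := (B.isNilpotentSlTwo V β).e_mul_f
      have i1' : repCoroot H V α = B.rep V α * B.rep V (negRoot α) -
        B.rep V (negRoot α) * B.rep V α := i1.symm
      have i2' : repCoroot H V β = B.rep V β * B.rep V (negRoot β) -
        B.rep V (negRoot β) * B.rep V β := i2.symm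
      rw [i1', i2', mul_sub, ← mul_assoc, ← mul_assoc, h, h', smul_mul_assoc, smul_mul_assoc,
        mul_assoc, mul_assoc, h, h', mul_smul_comm, mul_smul_comm, smul_smul, smul_smul,
        mul_comm c' c, ← smul_sub, sub_mul, mul_assoc, mul_assoc]
    have i1 : repCoroot H V α * B.rep V α - B.rep V α * repCoroot H V α = (2 : F) • B.rep V α := by
      rw [repCoroot, B.toEnd_mul_rep_sub V, root_apply_coroot (isNonZero_root α)]
    have i2 : repCoroot H V β * B.rep V β - B.rep V β * repCoroot H V β = (2 : F) • B.rep V β := by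
      rw [repCoroot, B.toEnd_mul_rep_sub V, root_apply_coroot (isNonZero_root β)]
    have e2 : B.toEnd g * (repCoroot H V α * B.rep V α - B.rep V α * repCoroot H V α) =
        (c * c' * c * 2) • (B.rep V β * B.toEnd g) := by
      have a1 : B.toEnd g * (repCoroot H V α * B.rep V α) =
          (c * c' * c) • (repCoroot H V β * B.rep V β * B.toEnd g) := by
        rw [← mul_assoc, e1, smul_mul_assoc, mul_assoc, h, mul_smul_comm, smul_smul,
          mul_assoc (repCoroot H V β)]
      have a2 : B.toEnd g * (B.rep V α * repCoroot H V α) =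
          (c * c' * c) • (B.rep V β * repCoroot H V β * B.toEnd g) := by
        rw [← mul_assoc, h, smul_mul_assoc, mul_assoc, e1, mul_smul_comm, smul_smul,
          mul_comm c (c * c'), mul_assoc (B.rep V β)]
      rw [mul_sub, a1, a2, ← smul_sub, ← sub_mul, i2, smul_mul_assoc, smul_smul]
    rw [i1, mul_smul_comm, h, smul_smul] at e2
    have e3 : (2 * c - c * c' * c * 2) • (B.rep V β * B.toEnd g) = 0 := by
      rw [sub_smul, e2, sub_self]
    rcases smul_eq_zero.mp e3 with e3 | e3
    · have : (2 * c) * (1 - c * c') = 0 := by linear_combination e3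
      rcases mul_eq_zero.mp this with h | h
      · exact absurd h (mul_ne_zero two_ne_zero hc)
      · linear_combination -h
    · exact absurd (mul_rep_eq_zero e3) (rep_ne_zero hV β)
  refine ⟨Units.mk0 c hc, h, ?_⟩
  rw [h']
  congr 1
  rw [Units.val_inv_eq_inv_val, Units.val_mk0]
  exact eq_inv_of_mul_eq_one_right hcc

theorem mapsRoot_h (α β : H.root) (t : Fˣ) : B.MapsRoot (B.h β t : B.group V) α α :=
  ⟨_, zpow_ne_zero _ t.ne_zero, B.toEnd_h_mul_rep α β t⟩

/-- If `⟨β,α⟩ = -1` the image is computed explicitly, and `⟨β,α⟩ = 1` follows by inverting that case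
for the reflected root. If `⟨β,α⟩ = 0`, neither `β + α` nor `β - α` is a root, so everything
commutes. The roots `±α` come from the `sl₂`-computation. -/
theorem mapsRoot_w (hsl : HasSimplyLacedRoots H) (hV : HasFullWeightLattice H V) (α β : H.root)
    (t : Fˣ) : B.MapsRoot (B.w α t : B.group V) β (reflect α β) := by
  have hinv : ∀ {β γ : H.root} {t : Fˣ}, B.MapsRoot (B.w α (-t) : B.group V) β γ →
      B.MapsRoot (B.w α t : B.group V) γ β := by
    intro β γ t h
    have := h.inv
    rwa [w_neg, inv_inv] at this
  have hself : ∀ t, B.MapsRoot (B.w α t : B.group V) α (negRoot α) := fun t =>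
    ⟨_, neg_ne_zero.mpr (pow_ne_zero 2 (t⁻¹).ne_zero), by
      simpa using B.toEnd_w_mul_rep (V := V) α t⟩
  have hneg : ∀ (β : H.root) (t : Fˣ), (rootSystem H).pairingIn ℤ β α = -1 →
      B.MapsRoot (B.w α t : B.group V) β (reflect α β) := by
    intro β t hp
    have hne : β ≠ negRoot α := by
      rintro rfl
      rw [pairingIn_negRoot_left, pairingIn_self] at hp
      omega
    have h := B.toEnd_w_mul_of_pairingIn_eq_neg_one (V := V) hsl hp t
    have hzero : B.toEnd (B.w α t : B.group V) * B.rep V β ≠ 0 := by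
      intro h0
      have : B.toEnd (B.w α t : B.group V)⁻¹ * (B.toEnd (B.w α t : B.group V) * B.rep V β) = 0 := by
        rw [h0, mul_zero]
      rw [← mul_assoc, B.toEnd_inv_mul, one_mul] at this
      exact rep_ne_zero hV β this
    rcases B.lie_X_X_eq α β hne with h0 | ⟨γ, c, hγ, hc⟩
    · rw [h0, map_zero, zero_mul, smul_zero] at h
      exact absurd h hzero
    · have hγ' : γ = reflect α β := root_ext fun x => by
        rw [hγ, reflect_apply, hp]; push_cast; ring
      rw [hc, map_smul, smul_mul_assoc, smul_smul] at h
      refine ⟨t * c, fun h0 => hzero ?_, hγ' ▸ h⟩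
      rw [h, h0, zero_smul]
  by_cases h1 : β = α
  · rw [h1, reflect_self]; exact hself t
  by_cases h2 : β = negRoot α
  · rw [h2, reflect_negRoot, reflect_self, negRoot_negRoot]; exact hinv (hself (-t))
  have h3 := hsl α β h1 h2
  simp only [Set.mem_insert_iff, Set.mem_singleton_iff, Prod.mk.injEq] at h3
  rcases h3 with ⟨hp, -⟩ | ⟨hp, -⟩ | ⟨hp, -⟩
  · have hβ : reflect α β = β := root_ext fun x => by rw [reflect_apply, hp]; push_cast; ring
    have hcomm : ∀ (δ : H.root) (s : F), δ = α ∨ δ = negRoot α →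
        B.toEnd (B.x V δ (Multiplicative.ofAdd s)) * B.rep V β =
          B.rep V β * B.toEnd (B.x V δ (Multiplicative.ofAdd s)) := by
      intro δ s hδ
      have hpδ : (rootSystem H).pairingIn ℤ β δ = 0 := by
        rcases hδ with rfl | rfl
        · exact hp
        · rw [pairingIn_negRoot_right, hp, neg_zero]
      have hβδ : β ≠ negRoot δ := by
        rintro rfl
        rw [pairingIn_negRoot_left, pairingIn_self] at hpδ
        omega
      have hlie : ⁅B.X δ, B.X β⁆ = 0 := by
        rcases B.lie_X_X_eq δ β hβδ with h | ⟨γ, c, hγ, -⟩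
        · exact h
        exfalso
        have hpγ := pairingIn_of_apply_eq (m := 1) (n := 1) (α := δ) (β := β) (γ := γ)
          (fun x => by rw [hγ]; push_cast; ring) δ
        rw [pairingIn_self, hpδ] at hpγ
        have hγδ : γ ≠ δ := by
          rintro rfl
          have h2 : β.1 (coroot β.1) = 2 := root_apply_coroot (isNonZero_root β)
          have h3 := hγ (coroot β.1)
          refine two_ne_zero (α := F) ?_
          rw [← h2]
          linear_combination -h3
        have hγδ' : γ ≠ negRoot δ := by
          rintro rfl
          rw [pairingIn_negRoot_left, pairingIn_self] at hpγ
          omega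
        have := hsl δ γ hγδ hγδ'
        simp only [Set.mem_insert_iff, Set.mem_singleton_iff, Prod.mk.injEq] at this
        omega
      have := B.toEnd_x_mul V hsl hβδ s
      rwa [hlie, map_zero, smul_zero, add_zero] at this
    rw [hβ]
    refine ⟨1, one_ne_zero, ?_⟩
    rw [one_smul, w, map_mul, map_mul, mul_assoc, mul_assoc, hcomm α _ (Or.inl rfl),
      ← mul_assoc (B.toEnd (B.x V (negRoot α) _)), hcomm (negRoot α) _ (Or.inr rfl), mul_assoc,
      ← mul_assoc (B.toEnd (B.x V α _)), hcomm α _ (Or.inl rfl)]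
    simp only [mul_assoc]
  · have hpr : (rootSystem H).pairingIn ℤ (reflect α β) α = -1 := by
      rw [pairingIn_of_apply_eq (m := 1) (n := -1) (α := β) (β := α)
        (fun x => by rw [reflect_apply, hp]; push_cast; ring), hp, pairingIn_self]
      norm_num
    have := hneg (reflect α β) (-t) hpr
    rw [reflect_reflect] at this
    exact hinv this
  · exact hneg β t hp

end ChevalleyBasis

variable {G : Type*} [Group G] {S : GroupExtension (rootsOfUnity 2 F) G (B.group V)}
  (hS : IsCentral S)

theorem xLift_mul_comm_of_lie_eq_zero {α β : H.root} (h : ⁅B.X α, B.X β⁆ = 0) (s t : F) :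
    xLift hS α s * xLift hS β t = xLift hS β t * xLift hS α s := by
  rw [← mul_inv_eq_iff_eq_mul]
  have := conj_xLift hS (g := xLift hS α s) (α := β) (β := β) (c := 1) (by
    have e : proj S (xLift hS α s) = nilExp (s • B.rep V α) := by
      rw [← B.toEnd_x, ← rightHom_xLift hS]; rfl
    have h2 := B.rep_mul_sub V α (B.X β)
    rw [h, map_zero] at h2
    have := ChevalleyBasis.nilExp_mul_of_commutator V (X := B.rep V β) (Y := 0)
      (B.isNilpotent_toEnd V α s)
      (by simp only [smul_mul_assoc, mul_smul_comm]; rw [← smul_sub]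
          exact (congrArg _ h2).trans (smul_zero s)) (by simp)
    rw [e, one_smul]
    rwa [add_zero] at this) t
  rwa [one_mul] at this

/-- Chevalley's commutator relation in the cover. -/
theorem xLift_conj_xLift (hsl : HasSimplyLacedRoots H) {α β : H.root} (hne : β ≠ negRoot α) :
    (∀ s t, xLift hS α s * xLift hS β t * (xLift hS α s)⁻¹ = xLift hS β t) ∨
    ∃ (γ : H.root) (c : F), (∀ z, γ.1 z = α.1 z + β.1 z) ∧ ∀ s t,
      xLift hS α s * xLift hS β t * (xLift hS α s)⁻¹ = xLift hS β t * xLift hS γ (c * s * t) := by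
  rcases B.lie_X_X_eq α β hne with h | ⟨γ, c, hγ, hc⟩
  · exact Or.inl fun s t => by
      rw [mul_inv_eq_iff_eq_mul]; exact xLift_mul_comm_of_lie_eq_zero hS h s t
  by_cases hc0 : c = 0
  · rw [hc0, zero_smul] at hc
    exact Or.inl fun s t => by
      rw [mul_inv_eq_iff_eq_mul]; exact xLift_mul_comm_of_lie_eq_zero hS hc s t
  -- This makes the right side a homomorphism in `t`, so that uniqueness of lifts applies.
  have hβγ : ⁅B.X β, B.X γ⁆ = 0 := by
    have hne' : α ≠ negRoot β := by
      rintro rfl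
      rw [negRoot_negRoot] at hne
      exact hne rfl
    have h1 := B.lie_lie_X_eq_zero hsl hne'
    rw [← lie_skew (B.X β) (B.X α), hc, lie_neg, lie_smul, neg_eq_zero] at h1
    exact (smul_eq_zero.mp h1).resolve_left hc0
  refine Or.inr ⟨γ, c, hγ, fun s t => ?_⟩
  let f₁ : Multiplicative F →* G :=
    (MulAut.conj (xLift hS α s)).toMonoidHom.comp (lift hS (B.x V β))
  let f₂ : Multiplicative F →* G := MonoidHom.mk' (fun t => xLift hS β t.toAdd *
    xLift hS γ (c * s * t.toAdd)) fun a b => by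
      rw [toAdd_mul, mul_add, xLift_add, xLift_add]
      exact Commute.mul_mul_mul_comm (xLift_mul_comm_of_lie_eq_zero hS hβγ _ _) _ _
  have : f₁ = f₂ := by
    refine hom_ext_of_rightHom hS (MonoidHom.ext fun a => ?_)
    change S.rightHom (xLift hS α s * xLift hS β a.toAdd * (xLift hS α s)⁻¹) =
      S.rightHom (xLift hS β a.toAdd * xLift hS γ (c * s * a.toAdd))
    rw [map_mul, map_mul, map_mul, map_inv, rightHom_xLift, rightHom_xLift, rightHom_xLift,
      mul_inv_eq_iff_eq_mul]
    apply B.toEnd_injective V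
    have hcomm : B.rep V β * B.rep V γ = B.rep V γ * B.rep V β := by
      have h2 := B.rep_mul_sub V β (B.X γ)
      rw [hβγ, map_zero, sub_eq_zero] at h2
      exact h2
    have hadd := nilExp_add (A := a.toAdd • B.rep V β) (B := (c * s * a.toAdd) • B.rep V γ)
      (((show Commute _ _ from hcomm).smul_left _).smul_right _)
      (B.isNilpotent_toEnd V β _) (B.isNilpotent_toEnd V γ _)
    rw [map_mul, map_mul, map_mul, B.toEnd_x V β, B.toEnd_x V γ, ← hadd]
    have hx := B.toEnd_x_mul V hsl hne s
    refine nilExp_conj (B.isNilpotent_toEnd V β _) ?_ ?_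
    · exact (((show Commute _ _ from hcomm).smul_left _).smul_right _).isNilpotent_add
        (B.isNilpotent_toEnd V β _) (B.isNilpotent_toEnd V γ _)
    · rw [mul_smul_comm, hx, hc, map_smul, smul_smul, ← smul_mul_assoc, smul_add, smul_smul]
      congr 3
      ring
  exact DFunLike.congr_fun this (Multiplicative.ofAdd t)

end WeylAction

/-! ### The induced grading of `End V` -/

section DegreeSpace

variable {F L : Type*} [Field F] [CharZero F] [LieRing L] [LieAlgebra F L]
  [FiniteDimensional F L] [IsKilling F L] {H : LieSubalgebra F L} [H.IsCartanSubalgebra]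
  [LieModule.IsTriangularizable F H L] {B : ChevalleyBasis H}
  (V : Type*) [AddCommGroup V] [Module F V] [LieRingModule L V]
  [LieModule F L V] [FiniteDimensional F V] (D : H)

/-- The commutator with the action of `D`. -/
noncomputable def degreeOperator : Module.End F (Module.End F V) :=
  LinearMap.mulLeft F (LieModule.toEnd F L V (D : L)) -
    LinearMap.mulRight F (LieModule.toEnd F L V (D : L))

/-- The endomorphisms of degree `k` with respect to `D`. -/
noncomputable def degreeSpace (k : ℤ) : Submodule F (Module.End F V) :=
  (degreeOperator V D).eigenspace (k : F)

/-- The sum of the spaces of endomorphisms whose degree lies in `s`. -/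
noncomputable def gradedPart (s : Set ℤ) : Submodule F (Module.End F V) :=
  ⨆ k ∈ s, degreeSpace V D k

variable {V D}

theorem mem_degreeSpace {k : ℤ} {A : Module.End F V} : A ∈ degreeSpace V D k ↔
    LieModule.toEnd F L V (D : L) * A - A * LieModule.toEnd F L V (D : L) = (k : F) • A :=
  Module.End.mem_eigenspace_iff

theorem mul_mem_degreeSpace {k l : ℤ} {A A' : Module.End F V} (h : A ∈ degreeSpace V D k)
    (h' : A' ∈ degreeSpace V D l) : A * A' ∈ degreeSpace V D (k + l) := by
  rw [mem_degreeSpace] at *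
  set d := LieModule.toEnd F L V (D : L)
  have : d * (A * A') - A * A' * d = (d * A - A * d) * A' + A * (d * A' - A' * d) := by
    noncomm_ring
  rw [this, h, h', smul_mul_assoc, mul_smul_comm, ← add_smul]
  push_cast
  rfl

theorem one_mem_degreeSpace : (1 : Module.End F V) ∈ degreeSpace V D 0 := by
  rw [mem_degreeSpace]; simp

theorem pow_mem_degreeSpace {k : ℤ} {A : Module.End F V} (h : A ∈ degreeSpace V D k) (n : ℕ) :
    A ^ n ∈ degreeSpace V D (n * k) := by
  induction n with
  | zero => simpa using one_mem_degreeSpace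
  | succ n ih =>
    rw [pow_succ]
    have := mul_mem_degreeSpace ih h
    rwa [show (n : ℤ) * k + k = ((n + 1 : ℕ) : ℤ) * k by push_cast; ring] at this

theorem mem_gradedPart {s : Set ℤ} {k : ℤ} (hk : k ∈ s) {A : Module.End F V}
    (h : A ∈ degreeSpace V D k) : A ∈ gradedPart V D s :=
  Submodule.mem_iSup_of_mem k (Submodule.mem_iSup_of_mem hk h)

theorem gradedPart_mono {s t : Set ℤ} (h : s ⊆ t) : gradedPart V D s ≤ gradedPart V D t :=
  biSup_mono fun _ hk => h hk

theorem mul_mem_gradedPart {s t u : Set ℤ} (h : ∀ i ∈ s, ∀ j ∈ t, i + j ∈ u)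
    {A A' : Module.End F V} (hA : A ∈ gradedPart V D s) (hA' : A' ∈ gradedPart V D t) :
    A * A' ∈ gradedPart V D u := by
  have h1 : gradedPart V D s ≤
      (gradedPart V D u).comap (LinearMap.mulRight F A') := by
    refine iSup₂_le fun i hi A hA => ?_
    have h2 : gradedPart V D t ≤ (gradedPart V D u).comap (LinearMap.mulLeft F A) :=
      iSup₂_le fun j hj A' hA' => mem_gradedPart (h i hi j hj) (mul_mem_degreeSpace hA hA')
    exact h2 hA'
  exact h1 hA

variable (V D) in
theorem iSupIndep_degreeSpace : iSupIndep (degreeSpace V D) :=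
  iSupIndep.comp (f := fun k : ℤ => (k : F)) (degreeOperator V D).eigenspaces_iSupIndep
    Int.cast_injective

theorem disjoint_gradedPart {s t : Set ℤ} (h : Disjoint s t) :
    Disjoint (gradedPart V D s) (gradedPart V D t) := by
  unfold gradedPart
  exact (iSupIndep_degreeSpace V D).disjoint_biSup_biSup h

variable {f : H.root → ℤ} (hf : ∀ α : H.root, α.1 D = f α)

include hf in
theorem rep_mem_degreeSpace (α : H.root) : B.rep V α ∈ degreeSpace V D (f α) := by
  rw [mem_degreeSpace, B.toEnd_mul_rep_sub V, hf]

include hf in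
theorem toEnd_x_sub_mem (α : H.root) (t : F) :
    B.toEnd (B.x V α (Multiplicative.ofAdd t)) - 1 - t • B.rep V α ∈
      gradedPart V D {k | ∃ n : ℕ, 2 ≤ n ∧ k = n * f α} := by
  obtain ⟨N, hN⟩ := B.isNilpotent_toEnd V α t
  have hN' : (t • B.rep V α) ^ (N + 2) = 0 := pow_eq_zero_of_le (by omega) hN
  rw [B.toEnd_x, nilExp_eq_sum hN', Finset.sum_range_succ', Finset.sum_range_succ']
  simp only [zero_add, Nat.factorial_zero, Nat.factorial_one, Nat.cast_one, inv_one, one_smul,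
    pow_zero, pow_one]
  rw [add_sub_cancel_right, add_sub_cancel_right]
  refine Submodule.sum_mem _ fun n _ => Submodule.smul_mem _ _ ?_
  rw [smul_pow]
  exact Submodule.smul_mem _ _ (mem_gradedPart
    (s := {k | ∃ n : ℕ, 2 ≤ n ∧ k = n * f α}) ⟨n + 1 + 1, by omega, rfl⟩ (pow_mem_degreeSpace (rep_mem_degreeSpace (B := B) (V := V) hf α) _))

include hf in
theorem toEnd_x_sub_one_mem {α : H.root} {m : ℤ} (hm : 1 ≤ m) (hα : m ≤ f α) (t : F) :
    B.toEnd (B.x V α (Multiplicative.ofAdd t)) - 1 ∈ gradedPart V D (Set.Ici m) := by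
  have h := gradedPart_mono (t := Set.Ici m) (by
    rintro _ ⟨n, hn, rfl⟩
    rw [Set.mem_Ici]
    have : (2 : ℤ) ≤ n := by exact_mod_cast hn
    nlinarith) (toEnd_x_sub_mem (B := B) (V := V) hf α t)
  have h2 := Submodule.smul_mem _ t
    (mem_gradedPart (s := Set.Ici m) hα (rep_mem_degreeSpace (B := B) (V := V) hf α))
  have := Submodule.add_mem _ h h2
  rwa [sub_add_cancel] at this

include hf in
/-- An element `x_α(t)` is nontrivial modulo elements of degrees different from that of `α`. -/
theorem eq_zero_of_toEnd_x_sub_one_mem (hV : HasFullWeightLattice H V) {α : H.root}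
    (h0 : f α ≠ 0) {t : F} {s : Set ℤ} (hs : f α ∉ s)
    (h : B.toEnd (B.x V α (Multiplicative.ofAdd t)) - 1 ∈ gradedPart V D s) : t = 0 := by
  -- The part of degree `f α` in `x_α(t) - 1` is exactly `t X_α`, the higher terms having degree `n
  -- f α` with `n ≥ 2`; independence of the degrees forces `t X_α = 0`.
  have h1 := gradedPart_mono (t := {f α}ᶜ) (fun k hk => by
    rintro rfl; exact hs hk) h
  have h2 := gradedPart_mono (t := {f α}ᶜ) (by
    rintro _ ⟨n, hn, rfl⟩
    rw [Set.mem_compl_singleton_iff]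
    intro h
    have : ((n : ℤ) - 1) * f α = 0 := by linear_combination h
    rcases mul_eq_zero.mp this with h | h
    · omega
    · exact h0 h) (toEnd_x_sub_mem (B := B) (V := V) hf α t)
  have h3 := Submodule.sub_mem _ h1 h2
  rw [sub_sub_cancel] at h3
  have h4 := Submodule.smul_mem _ t
    (mem_gradedPart (s := {f α}) rfl (rep_mem_degreeSpace (B := B) (V := V) hf α))
  have h5 := Submodule.disjoint_def.mp
    (disjoint_gradedPart (V := V) (D := D) (disjoint_compl_right (a := {f α}))) _ h4 h3
  exact (smul_eq_zero.mp h5).resolve_right (ChevalleyBasis.rep_ne_zero hV α)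

end DegreeSpace

/-! ### Unipotent groups in the cover -/

section RootGroup

variable {F L : Type*} [Field F] [CharZero F] [LieRing L] [LieAlgebra F L]
  [FiniteDimensional F L] [IsKilling F L] {H : LieSubalgebra F L} [H.IsCartanSubalgebra]
  [LieModule.IsTriangularizable F H L] {B : ChevalleyBasis H}
  {V : Type*} [AddCommGroup V] [Module F V] [LieRingModule L V]
  [LieModule F L V] [FiniteDimensional F V]
  {G : Type*} [Group G] {S : GroupExtension (rootsOfUnity 2 F) G (B.group V)}
  (hS : IsCentral S)

/-- The group generated by the `x_β(t)` with `β` in a set of roots. -/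
def rootGroup (Ψ : Set H.root) : Subgroup G :=
  Subgroup.closure {g | ∃ β ∈ Ψ, ∃ t : F, g = xLift hS β t}

theorem xLift_mem_rootGroup {Ψ : Set H.root} {β : H.root} (hβ : β ∈ Ψ) (t : F) :
    xLift hS β t ∈ rootGroup hS Ψ :=
  Subgroup.subset_closure ⟨β, hβ, t, rfl⟩

theorem rootGroup_mono {Ψ Ψ' : Set H.root} (h : Ψ ⊆ Ψ') : rootGroup hS Ψ ≤ rootGroup hS Ψ' :=
  Subgroup.closure_mono fun _ ⟨β, hβ, t, e⟩ => ⟨β, h hβ, t, e⟩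

theorem conj_mem_of_generators {g : G} {s : Set G} {K : Subgroup G}
    (h : ∀ x ∈ s, g * x * g⁻¹ ∈ K) {u : G} (hu : u ∈ Subgroup.closure s) : g * u * g⁻¹ ∈ K := by
  have : Subgroup.closure s ≤ K.comap (MulAut.conj g).toMonoidHom :=
    (Subgroup.closure_le _).mpr fun x hx => h x hx
  exact this hu

/-- `Ψ` contains all roots `α + β` with `β ∈ Ψ`, and does not contain `-α`. -/
structure IsStableUnder (α : H.root) (Ψ : Set H.root) : Prop where
  ne_neg : ∀ β ∈ Ψ, β ≠ negRoot α
  add_mem : ∀ β ∈ Ψ, ∀ γ : H.root, (∀ z, γ.1 z = α.1 z + β.1 z) → γ ∈ Ψ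

theorem xLift_conj_mem_rootGroup (hsl : HasSimplyLacedRoots H) {α : H.root} {Ψ : Set H.root}
    (h : IsStableUnder α Ψ) (s : F) {u : G} (hu : u ∈ rootGroup hS Ψ) :
    xLift hS α s * u * (xLift hS α s)⁻¹ ∈ rootGroup hS Ψ := by
  refine conj_mem_of_generators ?_ hu
  rintro _ ⟨β, hβ, t, rfl⟩
  rcases xLift_conj_xLift hS hsl (h.ne_neg β hβ) with e | ⟨γ, c, hγ, e⟩
  · rw [e]; exact xLift_mem_rootGroup hS hβ t
  · rw [e]
    exact mul_mem (xLift_mem_rootGroup hS hβ t)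
      (xLift_mem_rootGroup hS (h.add_mem β hβ γ hγ) _)

theorem conj_xLift_of_mapsRoot {g : G} {α β : H.root} (h : B.MapsRoot (S.rightHom g) α β) :
    ∃ c : F, c ≠ 0 ∧ ∀ t, g * xLift hS α t * g⁻¹ = xLift hS β (c * t) := by
  obtain ⟨c, hc, h⟩ := h
  exact ⟨c, hc, fun t => conj_xLift hS h t⟩

theorem conj_mem_rootGroup_of_mapsRoot {g : G} {Ψ Ψ' : Set H.root}
    (h : ∀ β ∈ Ψ, ∃ γ ∈ Ψ', B.MapsRoot (S.rightHom g) β γ) {u : G}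
    (hu : u ∈ rootGroup hS Ψ) : g * u * g⁻¹ ∈ rootGroup hS Ψ' := by
  refine conj_mem_of_generators ?_ hu
  rintro _ ⟨β, hβ, t, rfl⟩
  obtain ⟨γ, hγ, hm⟩ := h β hβ
  obtain ⟨c, -, e⟩ := conj_xLift_of_mapsRoot hS hm
  rw [e]
  exact xLift_mem_rootGroup hS hγ _

/-- Each `x_α(s)` normalizes the group of `Ψ`, so all factors from `α` can be collected on the left.
-/
theorem exists_eq_xLift_mul (hsl : HasSimplyLacedRoots H) {α : H.root} {Ψ : Set H.root}
    (h : IsStableUnder α Ψ) {u : G} (hu : u ∈ rootGroup hS (insert α Ψ)) :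
    ∃ t, ∃ u' ∈ rootGroup hS Ψ, u = xLift hS α t * u' := by
  have key : ∀ β ∈ insert α Ψ, ∀ (s : F) (y : G),
      (∃ t, ∃ u' ∈ rootGroup hS Ψ, y = xLift hS α t * u') →
      ∃ t, ∃ u' ∈ rootGroup hS Ψ, xLift hS β s * y = xLift hS α t * u' := by
    rintro β (rfl | hβ) s _ ⟨t, u', hu', rfl⟩
    · exact ⟨s + t, u', hu', by rw [xLift_add, mul_assoc]⟩
    · refine ⟨t, xLift hS α (-t) * xLift hS β s * (xLift hS α (-t))⁻¹ * u',
        mul_mem (xLift_conj_mem_rootGroup hS hsl h _ (xLift_mem_rootGroup hS hβ s)) hu', ?_⟩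
      rw [xLift_neg]; group
  induction hu using Subgroup.closure_induction_left with
  | one => exact ⟨0, 1, one_mem _, by rw [xLift_zero, one_mul]⟩
  | mul_left x hx y hy ih =>
    obtain ⟨β, hβ, s, rfl⟩ := hx
    exact key β hβ s y ih
  | inv_mul_cancel x hx y hy ih =>
    obtain ⟨β, hβ, s, rfl⟩ := hx
    rw [← xLift_neg]
    exact key β hβ (-s) y ih

variable {D : H} {f : H.root → ℤ} (hf : ∀ α : H.root, α.1 D = f α)

include hf in
theorem degree_add {α β γ : H.root} (h : ∀ z, γ.1 z = α.1 z + β.1 z) : f γ = f α + f β := by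
  apply Int.cast_injective (α := F)
  push_cast
  rw [← hf, ← hf, ← hf, h]

include hf in
theorem degree_negRoot (α : H.root) : f (negRoot α) = -f α := by
  apply Int.cast_injective (α := F)
  push_cast
  rw [← hf, ← hf, negRoot_apply]

include hf in
theorem proj_sub_one_mem {m : ℤ} (hm : 1 ≤ m) {u : G} (hu : u ∈ rootGroup hS {β | m ≤ f β}) :
    proj S u - 1 ∈ gradedPart V D (Set.Ici m) := by
  have hx : ∀ (β : H.root) (t : F), m ≤ f β →
      proj S (xLift hS β t) - 1 ∈ gradedPart V D (Set.Ici m) := by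
    intro β t hβ
    have := toEnd_x_sub_one_mem (B := B) (V := V) hf hm hβ t
    rwa [← rightHom_xLift hS] at this
  have hmul : ∀ x y : G, proj S x - 1 ∈ gradedPart V D (Set.Ici m) →
      proj S y - 1 ∈ gradedPart V D (Set.Ici m) →
      proj S (x * y) - 1 ∈ gradedPart V D (Set.Ici m) := by
    intro x y hx hy
    have e : proj S (x * y) - 1 =
        (proj S x - 1) * (proj S y - 1) + ((proj S x - 1) + (proj S y - 1)) := by
      rw [map_mul]; noncomm_ring
    rw [e]
    refine add_mem (mul_mem_gradedPart (fun i hi j hj => ?_) hx hy) (add_mem hx hy)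
    rw [Set.mem_Ici] at *
    omega
  induction hu using Subgroup.closure_induction_left with
  | one => rw [map_one, sub_self]; exact zero_mem _
  | mul_left x h y _ ih =>
    obtain ⟨β, hβ, t, rfl⟩ := h
    exact hmul _ _ (hx β t hβ) ih
  | inv_mul_cancel x h y _ ih =>
    obtain ⟨β, hβ, t, rfl⟩ := h
    rw [← xLift_neg]
    exact hmul _ _ (hx β _ hβ) ih

include hf in
/-- The unipotent group meets the kernel of the cover trivially. -/
theorem eq_one_of_mem_rootGroup (hsl : HasSimplyLacedRoots H) (hV : HasFullWeightLattice H V)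
    (hinj : Function.Injective f) {m : ℤ} (hm : 1 ≤ m) {u : G}
    (hu : u ∈ rootGroup hS {β | m ≤ f β}) (h1 : S.rightHom u = 1) : u = 1 := by
  obtain ⟨M, hM⟩ : ∃ M : ℤ, ∀ β, f β < M := by
    obtain ⟨M, hM⟩ := (Set.finite_range f).bddAbove
    exact ⟨M + 1, fun β => Int.lt_add_one_iff.mpr (hM ⟨β, rfl⟩)⟩
  -- Roots are peeled off by increasing degree, `n` bounding the number of degrees left. Injectivity
  -- of `f` leaves at most one root in degree `m`, and its parameter is detected there because the
  -- rest of `u` differs from `1` only in higher degrees.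
  have key : ∀ (n : ℕ) (m : ℤ), 1 ≤ m → M ≤ m + n → ∀ u ∈ rootGroup hS {β | m ≤ f β},
      S.rightHom u = 1 → u = 1 := by
    intro n
    induction n with
    | zero =>
      intro m _ hmM u hu _
      have : {β | m ≤ f β} = ∅ := by
        ext β
        have := hM β
        simp only [Set.mem_ofPred_eq, Set.mem_empty_iff_false, iff_false]
        push_cast at hmM
        omega
      rw [this, rootGroup] at hu
      simpa using hu
    | succ n ih =>
      intro m hm hmM u hu h1
      have ih' := ih (m + 1) (by omega) (by push_cast at hmM ⊢; omega)
      by_cases hα : ∃ α, f α = m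
      · obtain ⟨α, rfl⟩ := hα
        have hset : {β | f α ≤ f β} = insert α {β | f α + 1 ≤ f β} := by
          ext β
          rw [Set.mem_insert_iff, Set.mem_ofPred_eq, Set.mem_ofPred_eq]
          constructor
          · intro h
            rcases h.eq_or_lt with h | h
            · exact Or.inl (hinj h.symm)
            · exact Or.inr h
          · rintro (rfl | h)
            · exact le_rfl
            · omega
        have hst : IsStableUnder α {β | f α + 1 ≤ f β} := by
          refine ⟨fun β hβ h => ?_, fun β hβ γ hγ => ?_⟩
          · rw [Set.mem_ofPred_eq, h, degree_negRoot hf] at hβ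
            omega
          · rw [Set.mem_ofPred_eq] at hβ ⊢
            rw [degree_add hf hγ]
            omega
        rw [hset] at hu
        obtain ⟨t, u', hu', rfl⟩ := exists_eq_xLift_mul hS hsl hst hu
        have ht : t = 0 := by
          have hα0 : f α ≠ 0 := by omega
          have hni : f α ∉ Set.Ici (f α + 1) := by rw [Set.mem_Ici]; omega
          refine eq_zero_of_toEnd_x_sub_one_mem (B := B) (V := V) hf hV hα0 hni ?_
          have e : S.rightHom (xLift hS α t) = S.rightHom u'⁻¹ := by
            rw [map_mul] at h1
            rw [map_inv]
            exact eq_inv_of_mul_eq_one_left h1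
          rw [← rightHom_xLift hS, e]
          exact proj_sub_one_mem hS hf (by omega) (inv_mem hu')
        rw [ht, xLift_zero, one_mul] at h1 ⊢
        exact ih' u' hu' h1
      · refine ih' u ?_ h1
        refine rootGroup_mono hS (fun β hβ => ?_) hu
        rw [Set.mem_ofPred_eq] at hβ ⊢
        rcases hβ.eq_or_lt with h | h
        · exact absurd ⟨β, h.symm⟩ hα
        · exact h
  exact key (M - m).toNat m hm (by omega) u hu h1

end RootGroup

/-! ### The torus generated by simple roots -/

section SimpleTorus

variable {F L : Type*} [Field F] [CharZero F] [LieRing L] [LieAlgebra F L]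
  [FiniteDimensional F L] [IsKilling F L] {H : LieSubalgebra F L} [H.IsCartanSubalgebra]
  [LieModule.IsTriangularizable F H L] {B : ChevalleyBasis H}
  {V : Type*} [AddCommGroup V] [Module F V] [LieRingModule L V]
  [LieModule F L V] [FiniteDimensional F V]
  {G : Type*} [Group G] {S : GroupExtension (rootsOfUnity 2 F) G (B.group V)}
  (hS : IsCentral S) (b : (rootSystem H).Base)

theorem exists_weight_vector {μ : H → F} (hμ : LieModule.weightSpace V μ ≠ ⊥) :
    ∃ v : V, v ∈ LieModule.weightSpace V μ ∧ v ≠ 0 := by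
  by_contra! h
  exact hμ ((LieSubmodule.eq_bot_iff _).mpr h)

include B in
/-- The weights of the representation are integral on coroots. -/
theorem exists_int_of_weightSpace_ne_bot {μ : Module.Dual F H}
    (hμ : LieModule.weightSpace V (μ : H → F) ≠ ⊥) (α : H.root) :
    ∃ n : ℤ, μ (coroot α.1) = n := by
  obtain ⟨v, hv, hv0⟩ := exists_weight_vector hμ
  by_contra! hne
  refine hv0 ?_
  have h1 : v ∈ (ChevalleyBasis.repCoroot H V α).eigenspace (μ (coroot α.1)) :=
    Module.End.mem_eigenspace_iff.mpr ((LieModule.mem_weightSpace (μ : H → F) v).mp hv _)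
  have h2 : v ∈ ⨆ c ≠ μ (coroot α.1), (ChevalleyBasis.repCoroot H V α).eigenspace c := by
    obtain ⟨a, ha, ha'⟩ := B.exists_sum_weight_vectors α v
    rw [ha]
    refine Submodule.sum_mem _ fun n _ => ?_
    exact Submodule.mem_iSup_of_mem (n : F) (Submodule.mem_iSup_of_mem (hne n).symm
      (Module.End.mem_eigenspace_iff.mpr (ha' n)))
  exact Submodule.disjoint_def.mp ((ChevalleyBasis.repCoroot H V α).eigenspaces_iSupIndep _) v h1 h2

/-- The fundamental weights. -/
theorem exists_fundamental_weight [DecidableEq b.support] (j : b.support) :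
    ∃ ω : Module.Dual F H,
    (∀ α : H.root, ∃ n : ℤ, ω (coroot α.1) = n) ∧
    ∀ i : b.support, ω (coroot i.1.1) = ((Pi.single j 1 : b.support → ℤ) i : ℤ) := by
  have hval : ∀ i : b.support, b.toCoweightBasis.coord j (coroot i.1.1) =
      ((Pi.single j 1 : b.support → ℤ) i : ℤ) := by
    intro i
    have : b.toCoweightBasis i = coroot i.1.1 := b.toCoweightBasis_apply i
    rw [← this, Module.Basis.coord_apply, Module.Basis.repr_self, Finsupp.single_apply,
      Pi.single_apply]
    split_ifs <;> simp_all
  refine ⟨b.toCoweightBasis.coord j, fun α => ?_, hval⟩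
  have hmem : (rootSystem H).coroot α ∈ Submodule.span ℤ ((rootSystem H).coroot '' b.support) :=
    b.coroot_mem_span_int α
  change ∃ n : ℤ, b.toCoweightBasis.coord j ((rootSystem H).coroot α) = n
  refine Submodule.span_induction
    (p := fun (x : H) _ => ∃ n : ℤ, b.toCoweightBasis.coord j x = n) ?_ ?_ ?_ ?_ hmem
  · rintro _ ⟨i, hi, rfl⟩
    exact ⟨_, hval ⟨i, hi⟩⟩
  · exact ⟨0, by simp⟩
  · rintro x y _ _ ⟨m, hm⟩ ⟨n, hn⟩
    exact ⟨m + n, by rw [map_add, hm, hn]; push_cast; rfl⟩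
  · rintro a x _ ⟨m, hm⟩
    exact ⟨a * m, by rw [map_zsmul, hm, zsmul_eq_mul]; push_cast; rfl⟩

/-- The group generated by the `h_α(t)` with `α` simple. -/
def simpleTorus : Subgroup G :=
  Subgroup.closure {g | ∃ α ∈ b.support, ∃ t : Fˣ, g = hLift hS α t}

variable {b}

theorem hLift_mem_simpleTorus {α : H.root} (hα : α ∈ b.support) (t : Fˣ) :
    hLift hS α t ∈ simpleTorus hS b :=
  Subgroup.subset_closure ⟨α, hα, t, rfl⟩

theorem hLift_mul_comm_of_mul {α β : H.root}
    (hα : ∀ s t, hLift hS α (s * t) = hLift hS α s * hLift hS α t) (s t : Fˣ) :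
    hLift hS β s * hLift hS α t = hLift hS α t * hLift hS β s := by
  have h := hLift_conj_hLift hS α β s t
  rwa [mul_comm _ t, hα, mul_inv_cancel_right, mul_inv_eq_iff_eq_mul] at h

variable (hmul : ∀ α ∈ b.support, ∀ s t, hLift hS α (s * t) = hLift hS α s * hLift hS α t)

/-- The parametrisation of the torus, when all `h_α` with `α` simple are homomorphisms. -/
noncomputable def torusHom : (b.support → Fˣ) →* G :=
  letI := Classical.decEq b.support
  MonoidHom.noncommPiCoprod
    (fun i : b.support => MonoidHom.mk' (hLift hS i.1) (hmul i.1 i.2))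
    fun _ j _ s t => hLift_mul_comm_of_mul hS (hmul j.1 j.2) s t

theorem torusHom_mulSingle [DecidableEq b.support] (i : b.support) (t : Fˣ) :
    torusHom hS hmul (Pi.mulSingle i t) = hLift hS i.1 t := by
  have h : ‹DecidableEq b.support› = fun i j => Classical.propDecidable (i = j) :=
    Subsingleton.elim _ _
  rw [h]
  let _ : DecidableEq b.support := fun i j => Classical.propDecidable (i = j)
  exact MonoidHom.noncommPiCoprod_mulSingle (N := fun _ : b.support => Fˣ) _ i t

theorem exists_torusHom_eq {z : G} (hz : z ∈ simpleTorus hS b) :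
    ∃ τ, torusHom hS hmul τ = z := by
  classical
  have : simpleTorus hS b ≤ (torusHom hS hmul).range := by
    rw [simpleTorus, Subgroup.closure_le]
    rintro _ ⟨α, hα, t, rfl⟩
    exact ⟨Pi.mulSingle ⟨α, hα⟩ t, torusHom_mulSingle hS hmul ⟨α, hα⟩ t⟩
  exact this hz

theorem proj_torusHom_apply (τ : b.support → Fˣ) {v : V} {m : b.support → ℤ}
    (hv : ∀ i : b.support, ChevalleyBasis.repCoroot H V i.1 v = (m i : F) • v) :
    proj S (torusHom hS hmul τ) v = ((∏ i, τ i ^ m i : Fˣ) : F) • v := by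
  classical
  induction τ using Pi.mulSingle_induction with
  | one => simp
  | mul σ τ hσ hτ =>
    rw [map_mul, map_mul, Module.End.mul_apply, hτ, map_smul, hσ, smul_smul, ← Units.val_mul,
      ← Finset.prod_mul_distrib]
    congr 2
    exact Finset.prod_congr rfl fun i _ => by rw [Pi.mul_apply, mul_zpow, mul_comm]
  | mulSingle i t =>
    rw [torusHom_mulSingle, proj_hLift, B.toEnd_h_apply i.1 t (hv i),
      Finset.prod_eq_single i]
    · rw [Pi.mulSingle_eq_same, Units.val_zpow_eq_zpow_val]
    · intro j _ hj
      rw [Pi.mulSingle_eq_of_ne hj, one_zpow]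
    · intro h
      exact absurd (Finset.mem_univ i) h

include hmul in
/-- The torus meets the kernel of the cover trivially. -/
theorem eq_one_of_mem_simpleTorus (hV : HasFullWeightLattice H V) {z : G}
    (hz : z ∈ simpleTorus hS b) (h1 : S.rightHom z = 1) : z = 1 := by
  classical
  obtain ⟨τ, rfl⟩ := exists_torusHom_eq hS hmul hz
  suffices τ = 1 by rw [this, map_one]
  ext1 j
  obtain ⟨ω, hω, hω'⟩ := exists_fundamental_weight b j
  -- The `μ` whose character is trivial at `τ` form a group. It contains the weights of `V`, since
  -- `torusHom τ` acts trivially on `V`, hence also the fundamental weight `ω`, whose character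
  -- picks out the coordinate `τ j`.
  have key : ∃ m : b.support → ℤ, (∀ i : b.support, ω (coroot i.1.1) = m i) ∧
      ∏ i, τ i ^ m i = 1 := by
    refine AddSubgroup.closure_induction (p := fun (μ : Module.Dual F H) _ =>
      ∃ m : b.support → ℤ, (∀ i : b.support, μ (coroot i.1.1) = m i) ∧ ∏ i, τ i ^ m i = 1)
      ?_ ?_ ?_ ?_ (hV ω hω)
    · intro μ hμ
      choose m hm using fun i : b.support => exists_int_of_weightSpace_ne_bot (B := B) hμ i.1
      refine ⟨m, hm, ?_⟩
      obtain ⟨v, hv, hv0⟩ := exists_weight_vector hμ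
      have h2 := proj_torusHom_apply hS hmul τ (v := v) (m := m) fun i => by
        have := (LieModule.mem_weightSpace (μ : H → F) v).mp hv (coroot i.1.1)
        rw [hm] at this
        exact this
      have h3 : proj S (torusHom hS hmul τ) = 1 := by
        rw [proj, MonoidHom.comp_apply, h1, map_one]
      rw [h3, Module.End.one_apply] at h2
      have h4 : (1 - ((∏ i, τ i ^ m i : Fˣ) : F)) • v = 0 := by
        rw [sub_smul, one_smul, ← h2, sub_self]
      exact Units.ext (sub_eq_zero.mp ((smul_eq_zero.mp h4).resolve_right hv0)).symm
    · exact ⟨0, by simp, by simp⟩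
    · rintro μ ν _ _ ⟨m, hm, h⟩ ⟨n, hn, h'⟩
      refine ⟨m + n, fun i => ?_, ?_⟩
      · rw [LinearMap.add_apply, hm, hn, Pi.add_apply]; push_cast; rfl
      · simp only [Pi.add_apply, zpow_add, Finset.prod_mul_distrib, h, h', mul_one]
    · rintro μ _ ⟨m, hm, h⟩
      refine ⟨-m, fun i => ?_, ?_⟩
      · rw [LinearMap.neg_apply, hm, Pi.neg_apply]; push_cast; rfl
      · simp only [Pi.neg_apply, zpow_neg, Finset.prod_inv_distrib, h, inv_one]
  obtain ⟨m, hm, h⟩ := key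
  have hm' : m = Pi.single j 1 := by
    ext i
    have := (hm i).symm.trans (hω' i)
    exact_mod_cast this
  rw [hm', Finset.prod_eq_single j, Pi.single_eq_same, zpow_one] at h
  · rw [h]; rfl
  · intro i _ hi
    rw [Pi.single_eq_of_ne hi, zpow_zero]
  · intro h
    exact absurd (Finset.mem_univ j) h

theorem proj_hLift_mem_degreeSpace (D : H) (α : H.root) (t : Fˣ) :
    proj S (hLift hS α t) ∈ degreeSpace V D 0 := by
  have h : ChevalleyBasis.repCoroot H V α * LieModule.toEnd F L V (D : L) -
      LieModule.toEnd F L V (D : L) * ChevalleyBasis.repCoroot H V α =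
      ((0 : ℤ) : F) • LieModule.toEnd F L V (D : L) := by
    rw [Int.cast_zero, zero_smul]
    have e : ⁅(coroot α.1 : L), (D : L)⁆ = 0 := by
      rw [← LieSubalgebra.coe_bracket, trivial_lie_zero]; rfl
    ext v
    have := lie_lie (coroot α.1 : L) (D : L) v
    rw [e, zero_lie] at this
    exact this.symm
  rw [mem_degreeSpace, proj_hLift, B.toEnd_h_mul α t h]
  simp

include hmul in
theorem proj_mem_degreeSpace (D : H) {z : G} (hz : z ∈ simpleTorus hS b) :
    proj S z ∈ degreeSpace V D 0 := by
  classical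
  obtain ⟨τ, rfl⟩ := exists_torusHom_eq hS hmul hz
  clear hz
  induction τ using Pi.mulSingle_induction with
  | one => rw [map_one, map_one]; exact one_mem_degreeSpace
  | mul σ τ hσ hτ =>
    have := mul_mem_degreeSpace hσ hτ
    rwa [add_zero, ← map_mul, ← map_mul] at this
  | mulSingle i t =>
    rw [torusHom_mulSingle]
    exact proj_hLift_mem_degreeSpace hS D i.1 t

variable {D : H} {f : H.root → ℤ} (hf : ∀ α : H.root, α.1 D = f α)

include hf hmul in
-- The torus acts in degree zero, while a unipotent element differs from `1` only in positive
-- degrees, so the common image is trivial.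
theorem eq_one_of_rightHom_eq (hV : HasFullWeightLattice H V) {z u : G}
    (hz : z ∈ simpleTorus hS b) (hu : u ∈ rootGroup hS {β | 1 ≤ f β})
    (h : S.rightHom z = S.rightHom u) : z = 1 := by
  refine eq_one_of_mem_simpleTorus hS hmul hV hz ?_
  have h1 := proj_sub_one_mem hS hf le_rfl hu
  have h2 := sub_mem (proj_mem_degreeSpace hS hmul D hz) one_mem_degreeSpace
  have e : proj S z = proj S u := congrArg B.toEnd h
  rw [← e] at h1
  have h4 := mem_gradedPart (Set.mem_singleton (0 : ℤ)) h2
  have hd : Disjoint {(0 : ℤ)} (Set.Ici 1) := by simp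
  have h3 : proj S z - 1 = 0 := Submodule.disjoint_def.mp (disjoint_gradedPart hd) _ h4 h1
  apply B.toEnd_injective V
  rw [map_one]
  exact sub_eq_zero.mp h3

theorem mapsRoot_of_mem_simpleTorus {z : G} (hz : z ∈ simpleTorus hS b) (α : H.root) :
    B.MapsRoot (S.rightHom z) α α := by
  induction hz using Subgroup.closure_induction with
  | mem x hx =>
    obtain ⟨β, -, t, rfl⟩ := hx
    rw [rightHom_hLift]
    exact B.mapsRoot_h α β t
  | one => exact ⟨1, one_ne_zero, by rw [map_one, map_one, one_mul, mul_one, one_smul]⟩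
  | mul x y _ _ hx hy => rw [map_mul S.rightHom x y]; exact hx.mul hy
  | inv x _ hx => rw [map_inv S.rightHom x]; exact hx.inv

theorem wLift_conj_mem_simpleTorus {α : H.root} (hα : α ∈ b.support) (s : Fˣ) {z : G}
    (hz : z ∈ simpleTorus hS b) : wLift hS α s * z * (wLift hS α s)⁻¹ ∈ simpleTorus hS b := by
  have hle : simpleTorus hS b ≤ torus hS :=
    Subgroup.closure_mono fun _ ⟨β, _, t, e⟩ => ⟨β, t, e⟩
  obtain ⟨c, -, h⟩ := exists_conj_wLift hS (α := α) ⊤ (fun _ _ => trivial) (hle hz)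
  have e := wLift_conj_mul_inv hS h s
  rw [mul_inv_eq_iff_eq_mul] at e
  rw [e]
  exact mul_mem (mul_mem (hLift_mem_simpleTorus hS hα _)
    (inv_mem (hLift_mem_simpleTorus hS hα _))) hz

end SimpleTorus

/-! ### Words in reflections -/

section WeylWords

variable {F L : Type*} [Field F] [CharZero F] [LieRing L] [LieAlgebra F L]
  [FiniteDimensional F L] [IsKilling F L] {H : LieSubalgebra F L} [H.IsCartanSubalgebra]
  [LieModule.IsTriangularizable F H L]

theorem reflect_reflect_conj (α β γ : H.root) :
    reflect α (reflect β γ) = reflect (reflect α β) (reflect α γ) := by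
  apply (rootSystem H).root.injective
  have h := LinearEquiv.congr_fun ((rootSystem H).reflection_reflectionPerm (i := β) (j := α))
    ((rootSystem H).root (reflect α γ))
  simp only [reflect, RootPairing.root_reflectionPerm, LinearEquiv.mul_apply,
    RootPairing.reflection_same] at h ⊢
  exact h.symm

/-- The action of the product of the simple reflections in a list. -/
noncomputable def wordAct (l : List H.root) (β : H.root) : H.root := l.foldr reflect β

theorem wordAct_negRoot (l : List H.root) (β : H.root) :
    wordAct l (negRoot β) = negRoot (wordAct l β) := by
  induction l with
  | nil => rfl
  | cons α l ih =>
    change reflect α (wordAct l _) = negRoot (reflect α (wordAct l β))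
    rw [ih, reflect_negRoot]

theorem wordAct_reflect (l : List H.root) (α β : H.root) :
    wordAct l (reflect α β) = reflect (wordAct l α) (wordAct l β) := by
  induction l with
  | nil => rfl
  | cons γ l ih =>
    change reflect γ (wordAct l _) = reflect (reflect γ (wordAct l α)) (reflect γ (wordAct l β))
    rw [ih, reflect_reflect_conj]

theorem wordAct_append (l m : List H.root) (β : H.root) :
    wordAct (l ++ m) β = wordAct l (wordAct m β) := by
  simp only [wordAct, List.foldr_append]

theorem exists_wordAct_eq (l : List H.root) (β : H.root) : ∃ γ, wordAct l γ = β := by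
  induction l generalizing β with
  | nil => exact ⟨β, rfl⟩
  | cons α l ih =>
    obtain ⟨γ, hγ⟩ := ih (reflect α β)
    exact ⟨γ, by change reflect α (wordAct l γ) = β; rw [hγ, reflect_reflect]⟩

end WeylWords

/-! ### Exchange condition and Bruhat decomposition in the cover -/

section Bruhat

variable {F L : Type*} [Field F] [CharZero F] [LieRing L] [LieAlgebra F L]
  [FiniteDimensional F L] [IsKilling F L] {H : LieSubalgebra F L} [H.IsCartanSubalgebra]
  [LieModule.IsTriangularizable F H L] {B : ChevalleyBasis H}
  {V : Type*} [AddCommGroup V] [Module F V] [LieRingModule L V]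
  [LieModule F L V] [FiniteDimensional F V]
  {G : Type*} [Group G] {S : GroupExtension (rootsOfUnity 2 F) G (B.group V)}
  (hS : IsCentral S)

/-- The product of the `w_α(1)` over a list of roots. -/
noncomputable def word (l : List H.root) : G := (l.map fun α => wLift hS α 1).prod

theorem word_cons (α : H.root) (l : List H.root) :
    word hS (α :: l) = wLift hS α 1 * word hS l := by
  rw [word, List.map_cons, List.prod_cons]; rfl

theorem word_append (l m : List H.root) : word hS (l ++ m) = word hS l * word hS m := by
  rw [word, List.map_append, List.prod_append]; rfl

theorem wLift_eq_hLift_mul (α : H.root) (t : Fˣ) :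
    wLift hS α t = hLift hS α t * wLift hS α 1 := by
  rw [hLift, wLift_neg, inv_mul_cancel_right]

variable {b : (rootSystem H).Base}

theorem wLift_one_mul_wLift_mem {α : H.root} (hα : α ∈ b.support) (t : Fˣ) :
    wLift hS α 1 * wLift hS α t ∈ simpleTorus hS b := by
  have e2 : (hLift hS α (-1))⁻¹ = wLift hS α 1 * wLift hS α 1 := by
    rw [hLift, wLift_neg, mul_inv_rev, inv_inv]
  have e3 : wLift hS α 1 * wLift hS α t =
      wLift hS α (1 ^ 2 * t⁻¹) * wLift hS α 1 := by
    rw [← wLift_conj_wLift]; group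
  rw [e3, wLift_eq_hLift_mul, mul_assoc, ← e2]
  exact mul_mem (hLift_mem_simpleTorus hS hα _) (inv_mem (hLift_mem_simpleTorus hS hα _))

theorem mul_word_mem {l : List H.root} (hl : ∀ α ∈ l, α ∈ b.support) {z : G}
    (hz : z ∈ simpleTorus hS b) : ∃ z' ∈ simpleTorus hS b, z * word hS l = word hS l * z' := by
  induction l generalizing z with
  | nil => exact ⟨z, hz, by simp [word]⟩
  | cons α l ih =>
    have h1 := wLift_conj_mem_simpleTorus hS (hl α List.mem_cons_self) (-1) hz
    obtain ⟨z', hz', e⟩ := ih (fun β hβ => hl β (List.mem_cons_of_mem _ hβ)) h1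
    refine ⟨z', hz', ?_⟩
    rw [word_cons, mul_assoc, ← e, wLift_neg]
    group

variable (hsl : HasSimplyLacedRoots H) (hV : HasFullWeightLattice H V)

include hsl hV in
theorem mapsRoot_word (l : List H.root) (β : H.root) :
    B.MapsRoot (S.rightHom (word hS l)) β (wordAct l β) := by
  induction l with
  | nil => exact ⟨1, one_ne_zero, by simp [word, wordAct]⟩
  | cons α l ih =>
    rw [word_cons, map_mul S.rightHom, rightHom_wLift]
    exact (B.mapsRoot_w hsl hV α _ 1).mul ih

include hsl hV in
theorem word_conj_wLift (l : List H.root) (α : H.root) :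
    ∃ c : Fˣ, word hS l * wLift hS α 1 * (word hS l)⁻¹ = wLift hS (wordAct l α) c := by
  have h2 := mapsRoot_word hS hsl hV l (negRoot α)
  rw [wordAct_negRoot] at h2
  obtain ⟨c, h, h'⟩ := B.exists_unit_of_mapsRoot hV (mapsRoot_word hS hsl hV l α) h2
  exact ⟨c, by rw [conj_wLift hS h h', mul_one]⟩

variable {D : H} {f : H.root → ℤ} (hf : ∀ α : H.root, α.1 D = f α)
  (hpos : ∀ α, b.IsPos α ↔ 0 < f α)

include hf hpos in
-- A simple reflection permutes the positive roots other than its own.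
theorem eq_of_degree_reflect_neg {α β : H.root} (hα : α ∈ b.support) (hβ : 0 < f β)
    (h : f (reflect α β) < 0) : β = α := by
  by_contra hne
  have := (hpos _).mp (RootPairing.Base.IsPos.reflectionPerm ((hpos β).mpr hβ) hα hne)
  exact absurd this (not_lt.mpr h.le)

include hpos in
theorem degree_ne_zero (hf : ∀ α : H.root, α.1 D = f α) (α : H.root) : f α ≠ 0 := by
  rcases RootPairing.Base.IsPos.or_neg b α with h | h
  · exact ((hpos α).mp h).ne'
  · have h' := (hpos _).mp h
    have e : f ((rootSystem H).reflectionPerm α α) = -f α := by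
      rw [← degree_negRoot hf, ← reflect_self]; rfl
    change 0 < f ((rootSystem H).reflectionPerm α α) at h'
    omega

include hf hpos hsl hV in
/-- The exchange condition. -/
theorem exists_shorter_word {l : List H.root} (hl : ∀ α ∈ l, α ∈ b.support) {α : H.root}
    (hα : α ∈ b.support) (h : f (wordAct l α) < 0) :
    ∃ l' : List H.root, (∀ α ∈ l', α ∈ b.support) ∧ l'.length < l.length ∧
      (∀ β, wordAct l' β = wordAct l (reflect α β)) ∧
      ∃ z ∈ simpleTorus hS b, word hS l * wLift hS α 1 = word hS l' * z := by
  induction l with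
  | nil =>
    have := (hpos α).mp (RootPairing.Base.isPos_of_mem_support hα)
    change f α < 0 at h
    omega
  | cons γ l ih =>
    have hl' : ∀ α ∈ l, α ∈ b.support := fun β hβ => hl β (List.mem_cons_of_mem _ hβ)
    have hγ := hl γ List.mem_cons_self
    change f (reflect γ (wordAct l α)) < 0 at h
    rcases lt_or_ge (f (wordAct l α)) 0 with hneg | hge
    · obtain ⟨l', h1, h2, h3, z, hz, e⟩ := ih hl' hneg
      refine ⟨γ :: l', ?_, by simpa using h2, fun β => ?_, z, hz, ?_⟩
      · rintro β hβ
        rcases List.mem_cons.mp hβ with rfl | hβ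
        exacts [hγ, h1 β hβ]
      · change reflect γ (wordAct l' β) = reflect γ (wordAct l _)
        rw [h3]
      · rw [word_cons, word_cons, mul_assoc, e, mul_assoc]
    -- The letter `γ` is where the root turns negative, so `l` maps `α` to `γ` and `word l`
    -- conjugates `w_α(1)` to some `w_γ(c)`. Since `w_γ(1) w_γ(c)` lies in the torus, the letters
    -- `γ` and `α` disappear together.
    · have hgt := lt_of_le_of_ne hge (degree_ne_zero hpos hf _).symm
      have hα' := eq_of_degree_reflect_neg hf hpos hγ hgt h
      obtain ⟨c, hc⟩ := word_conj_wLift hS hsl hV l α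
      rw [hα'] at hc
      obtain ⟨z, hz, e⟩ := mul_word_mem hS hl' (wLift_one_mul_wLift_mem hS hγ c)
      refine ⟨l, hl', by simp, fun β => ?_, z, hz, ?_⟩
      · change _ = reflect γ (wordAct l _)
        rw [wordAct_reflect, hα', reflect_reflect]
      · rw [← e, word_cons, ← hc]
        group

include hf hpos hsl hV in
-- If a word preserving positivity ends in `α`, the part before `α` makes `α` negative. The exchange
-- condition then shortens the word until it is empty.
theorem word_mem_simpleTorus {l : List H.root} (hl : ∀ α ∈ l, α ∈ b.support)
    (h : ∀ α, 0 < f α → 0 < f (wordAct l α)) : word hS l ∈ simpleTorus hS b := by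
  generalize hn : l.length = n
  induction n using Nat.strong_induction_on generalizing l with
  | h n ih =>
    rcases List.eq_nil_or_concat l with rfl | ⟨m, α, rfl⟩
    · exact one_mem _
    · rw [List.concat_eq_append] at *
      have hα : α ∈ b.support := hl α (by simp)
      have hm : ∀ β ∈ m, β ∈ b.support := fun β hβ => hl β (by simp [hβ])
      have h1 := h α ((hpos α).mp (RootPairing.Base.isPos_of_mem_support hα))
      rw [wordAct_append] at h1
      change 0 < f (wordAct m (reflect α α)) at h1
      rw [reflect_self, wordAct_negRoot, degree_negRoot hf] at h1
      obtain ⟨l', h2, h3, h4, z, hz, e⟩ := exists_shorter_word hS hsl hV hf hpos hm hα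
        (by omega)
      have h5 : word hS l' ∈ simpleTorus hS b := by
        refine ih l'.length (by rw [← hn, List.length_append]; omega) h2 (fun β hβ => ?_) rfl
        rw [h4]
        have := h β hβ
        rwa [wordAct_append] at this
      have e2 : word hS [α] = wLift hS α 1 := by simp [word]
      rw [word_append, e2, e]
      exact mul_mem h5 hz

variable (b f) in
/-- The union of the double cosets `U n U`, for `n` a product of a word and an element of the
torus. -/
def bruhatSet : Set G :=
  {g | ∃ u ∈ rootGroup hS {β | 1 ≤ f β}, ∃ l : List H.root, (∀ α ∈ l, α ∈ b.support) ∧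
    ∃ z ∈ simpleTorus hS b, ∃ u' ∈ rootGroup hS {β | 1 ≤ f β}, g = u * (word hS l * z) * u'}

theorem simpleTorus_conj_mem_rootGroup (Ψ : Set H.root) {z u : G} (hz : z ∈ simpleTorus hS b)
    (hu : u ∈ rootGroup hS Ψ) : z * u * z⁻¹ ∈ rootGroup hS Ψ :=
  conj_mem_rootGroup_of_mapsRoot hS
    (fun β hβ => ⟨β, hβ, mapsRoot_of_mem_simpleTorus hS hz β⟩) hu

theorem simpleTorus_mul_mem_bruhatSet {z g : G} (hz : z ∈ simpleTorus hS b)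
    (hg : g ∈ bruhatSet hS b f) : z * g ∈ bruhatSet hS b f := by
  obtain ⟨u, hu, l, hl, t, ht, u', hu', rfl⟩ := hg
  obtain ⟨z', hz', e⟩ := mul_word_mem hS hl hz
  refine ⟨_, simpleTorus_conj_mem_rootGroup hS _ hz hu, l, hl, z' * t, mul_mem hz' ht, u', hu', ?_⟩
  rw [← mul_assoc (word hS l), ← e]
  group

theorem rootGroup_mul_mem_bruhatSet {v g : G} (hv : v ∈ rootGroup hS {β | 1 ≤ f β})
    (hg : g ∈ bruhatSet hS b f) : v * g ∈ bruhatSet hS b f := by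
  obtain ⟨u, hu, l, hl, t, ht, u', hu', rfl⟩ := hg
  exact ⟨_, mul_mem hv hu, l, hl, t, ht, u', hu', by simp only [mul_assoc]⟩

include hsl hV in
/-- An element `x_α(s)` can be moved past a word. -/
theorem exists_xLift_mul_word {l : List H.root} {α δ : H.root} (h : wordAct l δ = α) {z : G}
    (hz : z ∈ simpleTorus hS b) (s : F) :
    ∃ s', xLift hS α s * (word hS l * z) = word hS l * z * xLift hS δ s' := by
  have hm : B.MapsRoot (S.rightHom (word hS l * z)) δ α := by
    rw [map_mul S.rightHom, ← h]
    exact (mapsRoot_word hS hsl hV l δ).mul (mapsRoot_of_mem_simpleTorus hS hz δ)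
  obtain ⟨c, hc, e⟩ := conj_xLift_of_mapsRoot hS hm
  refine ⟨c⁻¹ * s, ?_⟩
  have := e (c⁻¹ * s)
  rw [mul_inv_cancel_left₀ hc] at this
  rw [← this]
  group

include hf hpos hsl hV in
-- Positive roots other than `α` stay positive under the reflection, so only a factor `x_α(s)` is an
-- obstacle. Let the word map `δ` to `α`. If `δ` is positive, `x_α(s)` moves to the right as an
-- `x_δ`. If `δ` is negative and `s ≠ 0`, write `x_α(s) = w_α(s) x_α(-s) x_{-α}(s⁻¹)`; the last
-- factor moves to the right as an `x_{-δ}`, and `w_α(1) w_α(s)` lies in the torus.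
theorem wLift_mul_mem_bruhatSet {α : H.root} (hα : α ∈ b.support) {g : G}
    (hg : g ∈ bruhatSet hS b f) : wLift hS α 1 * g ∈ bruhatSet hS b f := by
  obtain ⟨u, hu, l, hl, z, hz, u', hu', rfl⟩ := hg
  have hα0 : 0 < f α := (hpos α).mp (RootPairing.Base.isPos_of_mem_support hα)
  let Ψ : Set H.root := {β | 1 ≤ f β ∧ β ≠ α}
  have hΨ : {β | 1 ≤ f β} = insert α Ψ := by
    ext β
    simp only [Set.mem_insert_iff, Set.mem_ofPred_eq, Ψ]
    constructor
    · intro h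
      by_cases e : β = α
      exacts [Or.inl e, Or.inr ⟨h, e⟩]
    · rintro (rfl | h)
      exacts [hα0, h.1]
  have hst : IsStableUnder α Ψ := by
    refine ⟨fun β hβ h => ?_, fun β hβ γ hγ => ?_⟩
    · have := hβ.1
      rw [h, degree_negRoot hf] at this
      omega
    · have := degree_add hf hγ
      refine ⟨by have := hβ.1; omega, ?_⟩
      rintro rfl
      have := hβ.1
      omega
  have hw : ∀ {v}, v ∈ rootGroup hS Ψ →
      wLift hS α 1 * v * (wLift hS α 1)⁻¹ ∈ rootGroup hS {β | 1 ≤ f β} := by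
    intro v hv
    refine conj_mem_rootGroup_of_mapsRoot hS (fun β hβ => ⟨reflect α β, ?_, ?_⟩) hv
    · rw [Set.mem_ofPred_eq]
      by_contra hlt
      have h0 := degree_ne_zero hpos hf (reflect α β)
      have h1 : 0 < f β := hβ.1
      exact hβ.2 (eq_of_degree_reflect_neg hf hpos hα h1 (by omega))
    · rw [rightHom_wLift]
      exact B.mapsRoot_w hsl hV α β 1
  rw [hΨ] at hu
  obtain ⟨s, u₁, hu₁, rfl⟩ := exists_eq_xLift_mul hS hsl hst hu
  have h2 := hw (xLift_conj_mem_rootGroup hS hsl hst s hu₁)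
  have e : wLift hS α 1 * (xLift hS α s * u₁ * (word hS l * z) * u') =
      (wLift hS α 1 * (xLift hS α s * u₁ * (xLift hS α s)⁻¹) * (wLift hS α 1)⁻¹) *
        (wLift hS α 1 * (xLift hS α s * (word hS l * z)) * u') := by group
  rw [e]
  refine rootGroup_mul_mem_bruhatSet hS h2 ?_
  obtain ⟨δ, hδ⟩ := exists_wordAct_eq l α
  have hcons : ∀ {s' : F}, 0 < f δ →
      wLift hS α 1 * (word hS l * z * xLift hS δ s') * u' ∈ bruhatSet hS b f := by
    intro s' h0
    refine ⟨1, one_mem _, α :: l, ?_, z, hz, xLift hS δ s' * u',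
      mul_mem (xLift_mem_rootGroup hS (by exact h0) s') hu', ?_⟩
    · rintro β hβ
      rcases List.mem_cons.mp hβ with rfl | hβ
      exacts [hα, hl β hβ]
    · rw [word_cons]
      group
  rcases lt_or_gt_of_ne (degree_ne_zero hpos hf δ) with hneg | hgt
  · rcases eq_or_ne s 0 with rfl | hs
    · refine ⟨1, one_mem _, α :: l, ?_, z, hz, u', hu', ?_⟩
      · rintro β hβ
        rcases List.mem_cons.mp hβ with rfl | hβ
        exacts [hα, hl β hβ]
      · rw [word_cons, xLift_zero]
        group
    · let t : Fˣ := Units.mk0 s hs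
      have hδ' : wordAct l (negRoot δ) = negRoot α := by rw [wordAct_negRoot, hδ]
      obtain ⟨s', hs'⟩ := exists_xLift_mul_word hS hsl hV hδ' hz ((t⁻¹ : Fˣ) : F)
      have e2 : xLift hS α s = wLift hS α t * xLift hS α (-s) *
          xLift hS (negRoot α) ((t⁻¹ : Fˣ) : F) := by
        rw [wLift, xLift_neg, xLift_neg, Units.val_mk0]
        group
      have e3 : wLift hS α 1 * (xLift hS α s * (word hS l * z)) * u' =
          (wLift hS α 1 * wLift hS α t) * (xLift hS α (-s) *
            (1 * (word hS l * z) * (xLift hS (negRoot δ) s' * u'))) := by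
        rw [e2, mul_assoc _ _ (word hS l * z), hs']
        group
      rw [e3]
      refine simpleTorus_mul_mem_bruhatSet hS (wLift_one_mul_wLift_mem hS hα t)
        (rootGroup_mul_mem_bruhatSet hS (xLift_mem_rootGroup hS (by exact hα0) _)
          ⟨1, one_mem _, l, hl, z, hz, _,
            mul_mem (xLift_mem_rootGroup hS ?_ s') hu', rfl⟩)
      rw [Set.mem_ofPred_eq, degree_negRoot hf]
      omega
  · obtain ⟨s', hs'⟩ := exists_xLift_mul_word hS hsl hV hδ hz s
    rw [hs']
    exact hcons hgt

variable (b) in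
/-- The group generated by the `x_{±α}(t)` with `α` simple. -/
def simpleGroup : Subgroup G :=
  Subgroup.closure {g | ∃ α ∈ b.support, ∃ t : F,
    g = xLift hS α t ∨ g = xLift hS (negRoot α) t}

include hf hpos hsl hV in
-- The Bruhat set contains `1` and is stable under left multiplication by the generators:
-- `x_{-α}(t)` is conjugate to `x_α(-t)` by `w_α(1)`, so the preceding stability results cover it.
theorem mem_bruhatSet_of_mem_simpleGroup {g : G} (hg : g ∈ simpleGroup hS b) :
    g ∈ bruhatSet hS b f := by
  have key : ∀ α ∈ b.support, ∀ (t : F) (y : G), y ∈ bruhatSet hS b f →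
      xLift hS α t * y ∈ bruhatSet hS b f ∧ xLift hS (negRoot α) t * y ∈ bruhatSet hS b f := by
    intro α hα t y hy
    have hx : ∀ (t : F) (y : G), y ∈ bruhatSet hS b f → xLift hS α t * y ∈ bruhatSet hS b f :=
      fun t y hy => rootGroup_mul_mem_bruhatSet hS (xLift_mem_rootGroup hS
        ((hpos α).mp (RootPairing.Base.isPos_of_mem_support hα)) t) hy
    refine ⟨hx t y hy, ?_⟩
    have h1 := wLift_mul_mem_bruhatSet hS hsl hV hf hpos hα hy
    have h2 := wLift_mul_mem_bruhatSet hS hsl hV hf hpos hα (hx (-t) _ h1)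
    have h3 := simpleTorus_mul_mem_bruhatSet hS (hLift_mem_simpleTorus hS hα (-1)) h2
    have e := wLift_conj_xLift_neg hS α 1 t
    rw [Units.val_one, one_pow, neg_one_mul] at e
    have e2 : hLift hS α (-1) * (wLift hS α 1 * (xLift hS α (-t) * (wLift hS α 1 * y))) =
        xLift hS (negRoot α) t * y := by
      rw [← e, hLift, wLift_neg]
      group
    rwa [e2] at h3
  induction hg using Subgroup.closure_induction_left with
  | one => exact ⟨1, one_mem _, [], by simp, 1, one_mem _, 1, one_mem _, by simp [word]⟩
  | mul_left x hx y _ ih =>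
    obtain ⟨α, hα, t, rfl | rfl⟩ := hx
    exacts [(key α hα t y ih).1, (key α hα t y ih).2]
  | inv_mul_cancel x hx y _ ih =>
    obtain ⟨α, hα, t, rfl | rfl⟩ := hx <;> rw [← xLift_neg]
    exacts [(key α hα (-t) y ih).1, (key α hα (-t) y ih).2]

include hf hpos hsl hV in
-- If the word made a positive root negative, a nontrivial root element of negative degree would
-- have the same image as a unipotent element, which differs from `1` only in positive degrees.
theorem mem_simpleTorus_of_rightHom_eq {l : List H.root} (hl : ∀ α ∈ l, α ∈ b.support) {z u : G}
    (hz : z ∈ simpleTorus hS b) (hu : u ∈ rootGroup hS {β | 1 ≤ f β})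
    (h : S.rightHom (word hS l * z) = S.rightHom u) : word hS l * z ∈ simpleTorus hS b := by
  refine mul_mem (word_mem_simpleTorus hS hsl hV hf hpos hl fun β hβ => ?_) hz
  by_contra hle
  have h0 := degree_ne_zero hpos hf (wordAct l β)
  have hm : B.MapsRoot (S.rightHom (word hS l * z)) β (wordAct l β) := by
    rw [map_mul S.rightHom]
    exact (mapsRoot_word hS hsl hV l β).mul (mapsRoot_of_mem_simpleTorus hS hz β)
  obtain ⟨c, hc, e⟩ := conj_xLift_of_mapsRoot hS hm
  have e1 := e 1
  rw [mul_one] at e1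
  have h1 : u * xLift hS β 1 * u⁻¹ ∈ rootGroup hS {β | 1 ≤ f β} :=
    mul_mem (mul_mem hu (xLift_mem_rootGroup hS hβ 1)) (inv_mem hu)
  have h2 := proj_sub_one_mem hS hf le_rfl h1
  have e2 : S.rightHom (u * xLift hS β 1 * u⁻¹) = S.rightHom (xLift hS (wordAct l β) c) := by
    rw [← e1]
    simp only [map_mul S.rightHom, map_inv S.rightHom] at h ⊢
    rw [h]
  have e3 : proj S (u * xLift hS β 1 * u⁻¹) =
      B.toEnd (B.x V (wordAct l β) (Multiplicative.ofAdd c)) := by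
    rw [← rightHom_xLift hS]
    exact congrArg B.toEnd e2
  rw [e3] at h2
  refine hc (eq_zero_of_toEnd_x_sub_one_mem hf hV h0 ?_ h2)
  rw [Set.mem_Ici]
  omega

variable (hmul : ∀ α ∈ b.support, ∀ s t, hLift hS α (s * t) = hLift hS α s * hLift hS α t)

include hf hpos hsl hV hmul in
/-- If all `h_α` with `α` simple are homomorphisms, then the group generated by the `x_{±α}(t)`
with `α` simple meets the kernel of the cover trivially. -/
theorem eq_one_of_mem_simpleGroup (hinj : Function.Injective f) {g : G}
    (hg : g ∈ simpleGroup hS b) (h1 : S.rightHom g = 1) : g = 1 := by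
  obtain ⟨u, hu, l, hl, z, hz, u', hu', rfl⟩ :=
    mem_bruhatSet_of_mem_simpleGroup hS hsl hV hf hpos hg
  -- Modulo the kernel, the middle factor equals a unipotent element. It is therefore in the torus,
  -- then trivial, and the unipotent element `u u'` remains.
  have h2 : S.rightHom (word hS l * z) = S.rightHom (u⁻¹ * u'⁻¹) := by
    rw [map_mul S.rightHom, map_mul S.rightHom u] at h1
    rw [map_mul S.rightHom u⁻¹, map_inv S.rightHom, map_inv S.rightHom, eq_inv_mul_iff_mul_eq]
    exact eq_inv_of_mul_eq_one_left h1
  have hv := mul_mem (inv_mem hu) (inv_mem hu')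
  have h3 := mem_simpleTorus_of_rightHom_eq hS hsl hV hf hpos hl hz hv h2
  have h4 := eq_one_of_rightHom_eq hS hmul hf hV h3 hv h2
  rw [h4, mul_one] at h1 ⊢
  exact eq_one_of_mem_rootGroup hS hf hsl hV hinj le_rfl (mul_mem hu hu') h1

end Bruhat

/-! ### Triviality of the symbol splits the cover -/

section Splitting

variable {F L : Type*} [Field F] [CharZero F] [LieRing L] [LieAlgebra F L]
  [FiniteDimensional F L] [IsKilling F L] {H : LieSubalgebra F L} [H.IsCartanSubalgebra]
  [LieModule.IsTriangularizable F H L] {B : ChevalleyBasis H}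
  {V : Type*} [AddCommGroup V] [Module F V] [LieRingModule L V]
  [LieModule F L V] [FiniteDimensional F V]
  {G : Type*} [Group G] {S : GroupExtension (rootsOfUnity 2 F) G (B.group V)}
  (hS : IsCentral S) (b : (rootSystem H).Base)
  (hsl : HasSimplyLacedRoots H) (hV : HasFullWeightLattice H V)

include hsl hV in
theorem xLift_mem_simpleGroup (α : H.root) (t : F) : xLift hS α t ∈ simpleGroup hS b := by
  have hsimple : ∀ α ∈ b.support, (∀ t, xLift hS α t ∈ simpleGroup hS b) ∧
      ∀ t, xLift hS (negRoot α) t ∈ simpleGroup hS b := fun α hα =>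
    ⟨fun t => Subgroup.subset_closure ⟨α, hα, t, Or.inl rfl⟩,
      fun t => Subgroup.subset_closure ⟨α, hα, t, Or.inr rfl⟩⟩
  have hstep : ∀ α β : H.root, β ∈ b.support → (∀ t, xLift hS α t ∈ simpleGroup hS b) →
      ∀ t, xLift hS (reflect β α) t ∈ simpleGroup hS b := by
    intro α β hβ h t
    have hw : wLift hS β 1 ∈ simpleGroup hS b :=
      mul_mem (mul_mem ((hsimple β hβ).1 _) ((hsimple β hβ).2 _)) ((hsimple β hβ).1 _)
    have hm := B.mapsRoot_w hsl hV β α 1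
    rw [← rightHom_wLift hS] at hm
    obtain ⟨c, hc, e⟩ := conj_xLift_of_mapsRoot hS hm
    have := e (c⁻¹ * t)
    rw [mul_inv_cancel_left₀ hc] at this
    rw [← this]
    exact mul_mem (mul_mem hw (h _)) (inv_mem hw)
  have key : (∀ t, xLift hS α t ∈ simpleGroup hS b) ∧
      ∀ t, xLift hS (negRoot α) t ∈ simpleGroup hS b := by
    refine b.induction_reflect α (p := fun α => (∀ t, xLift hS α t ∈ simpleGroup hS b) ∧
      ∀ t, xLift hS (negRoot α) t ∈ simpleGroup hS b) (fun α h => ?_) hsimple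
      fun α β h hβ => ⟨hstep α β hβ h.1, ?_⟩
    · change (∀ t, xLift hS (reflect α α) t ∈ _) ∧ ∀ t, xLift hS (negRoot (reflect α α)) t ∈ _
      rw [reflect_self, negRoot_negRoot]
      exact ⟨h.2, h.1⟩
    · change ∀ t, xLift hS (negRoot (reflect β α)) t ∈ _
      rw [← reflect_negRoot]
      exact hstep _ β hβ h.2
  exact key.1 t

include hsl hV in
theorem exists_mem_simpleGroup_rightHom_eq (q : B.group V) :
    ∃ g ∈ simpleGroup hS b, S.rightHom g = q := by
  obtain ⟨q, hq⟩ := q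
  have h : B.group V ≤ ((simpleGroup hS b).map S.rightHom).map (B.group V).subtype := by
    refine (Subgroup.closure_le _).mpr ?_
    rintro _ ⟨α, t, rfl⟩
    exact ⟨_, ⟨_, xLift_mem_simpleGroup hS b hsl hV α t, rfl⟩, by rw [rightHom_xLift]; rfl⟩
  obtain ⟨_, ⟨g, hg, rfl⟩, e⟩ := h hq
  exact ⟨g, hg, Subtype.ext e⟩

include hsl hV in
/-- If all `h_α` with `α` simple are homomorphisms, then the cover splits. -/
theorem nonempty_splitting_of_hLift_mul
    (hmul : ∀ α ∈ b.support, ∀ s t, hLift hS α (s * t) = hLift hS α s * hLift hS α t) :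
    Nonempty S.Splitting := by
  obtain ⟨D, f, hf, hinj, hpos⟩ := exists_grading b
  have hker : ∀ g ∈ simpleGroup hS b, S.rightHom g = 1 → g = 1 := fun g hg h =>
    eq_one_of_mem_simpleGroup hS hsl hV hf hpos hmul hinj hg h
  -- The group generated by simple root elements maps bijectively onto the Chevalley group; the
  -- inverse map is the splitting.
  choose σ hσ hσ' using exists_mem_simpleGroup_rightHom_eq hS b hsl hV
  refine ⟨⟨MonoidHom.mk' σ fun p q => ?_, hσ'⟩⟩
  rw [← mul_inv_eq_one]
  refine hker _ (mul_mem (hσ _) (inv_mem (mul_mem (hσ _) (hσ _)))) ?_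
  rw [map_mul S.rightHom, map_inv S.rightHom, map_mul S.rightHom, hσ', hσ', hσ', mul_inv_cancel]

include hsl hV in
/-- Multiplicativity of `h_α` is invariant under the Weyl group. -/
theorem hLift_mul_reflect {α : H.root} (β : H.root)
    (h : ∀ s t, hLift hS α (s * t) = hLift hS α s * hLift hS α t) (s t : Fˣ) :
    hLift hS (reflect β α) (s * t) = hLift hS (reflect β α) s * hLift hS (reflect β α) t := by
  have h1 := B.mapsRoot_w hsl hV β α 1
  have h2 := B.mapsRoot_w hsl hV β (negRoot α) 1
  rw [reflect_negRoot] at h2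
  rw [← rightHom_wLift hS] at h1 h2
  obtain ⟨c, e1, e2⟩ := B.exists_unit_of_mapsRoot hV h1 h2
  set g := wLift hS β 1
  set γ := reflect β α
  let φ : Fˣ →* G := (MulAut.conj g).toMonoidHom.comp (MonoidHom.mk' (hLift hS α) h)
  -- Conjugation by `g` sends `h_α(u)` to `h_γ(c u) h_γ(c)⁻¹`. The choice `u = c⁻¹` gives `h_γ(c) =
  -- φ(c)`, so `h_γ` is the homomorphism `φ`.
  have hφ : ∀ u, hLift hS γ (c * u) = φ u * hLift hS γ c := by
    intro u
    have e3 : φ u = (g * wLift hS α u * g⁻¹) * (g * wLift hS α (-1) * g⁻¹) := by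
      change g * hLift hS α u * g⁻¹ = _
      rw [hLift]; group
    rw [e3, conj_wLift hS e1 e2, conj_wLift hS e1 e2, mul_neg_one, wLift_neg, wLift_mul_inv,
      inv_mul_cancel_right]
  have hc : hLift hS γ c = φ c := by
    have := hφ c⁻¹
    rw [mul_inv_cancel, hLift_one, map_inv, eq_inv_mul_iff_mul_eq, mul_one] at this
    exact this.symm
  have hγ : ∀ u, hLift hS γ u = φ u := by
    intro u
    have := hφ (c⁻¹ * u)
    rwa [mul_inv_cancel_left, hc, ← map_mul, mul_comm, mul_inv_cancel_left] at this
  rw [hγ, hγ, hγ, map_mul]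

include hsl in
theorem pairingIn_mul_self_of_odd {α β : H.root} (h : Odd ((rootSystem H).pairingIn ℤ α β)) :
    (rootSystem H).pairingIn ℤ α β * (rootSystem H).pairingIn ℤ α β = 1 ∧
      (rootSystem H).pairingIn ℤ β α * (rootSystem H).pairingIn ℤ β α = 1 := by
  have h1 : α ≠ β := by
    rintro rfl
    rw [pairingIn_self] at h
    exact absurd h (by decide)
  have h2 : α ≠ negRoot β := by
    rintro rfl
    rw [pairingIn_negRoot_left, pairingIn_self] at h
    exact absurd h (by decide)
  have h3 := hsl β α h1 h2
  simp only [Set.mem_insert_iff, Set.mem_singleton_iff, Prod.mk.injEq] at h3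
  rcases h3 with ⟨e, -⟩ | ⟨e, e'⟩ | ⟨e, e'⟩
  · rw [e] at h
    exact absurd h (by decide)
  · rw [e, e']; exact ⟨rfl, rfl⟩
  · rw [e, e']; exact ⟨rfl, rfl⟩

include hsl hV in
-- Invariance under reflections moves the property from `α` to some simple root, and
-- `hLift_mul_of_pairingIn` carries it along the edges of the connected diagram.
theorem hLift_mul_of_mem_support [(rootSystem H).IsIrreducible] (hb : b.cartanMatrix.IsSimplyLaced)
    {α : H.root} (h : ∀ s t, hLift hS α (s * t) = hLift hS α s * hLift hS α t) :
    ∀ β ∈ b.support, ∀ s t, hLift hS β (s * t) = hLift hS β s * hLift hS β t := by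
  have h0 : (∀ s t, hLift hS α (s * t) = hLift hS α s * hLift hS α t) →
      ∃ β ∈ b.support, ∀ s t, hLift hS β (s * t) = hLift hS β s * hLift hS β t := by
    refine b.induction_reflect α (p := fun α =>
      (∀ s t, hLift hS α (s * t) = hLift hS α s * hLift hS α t) →
      ∃ β ∈ b.support, ∀ s t, hLift hS β (s * t) = hLift hS β s * hLift hS β t)
      (fun α ih h => ?_) (fun α hα h => ⟨α, hα, h⟩) (fun α β ih _ h => ?_)
    · have := hLift_mul_reflect hS hsl hV α (α := reflect α α) h
      rw [reflect_reflect] at this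
      exact ih this
    · have := hLift_mul_reflect hS hsl hV β (α := reflect β α) h
      rw [reflect_reflect] at this
      exact ih this
  obtain ⟨γ, hγ, h⟩ := h0 h
  intro β hβ
  refine b.induction_on_cartanMatrix
    (fun i : b.support => ∀ s t, hLift hS i.1 (s * t) = hLift hS i.1 s * hLift hS i.1 t)
    (i := ⟨γ, hγ⟩) (j := ⟨β, hβ⟩) h fun i j hi hij => ?_
  rcases eq_or_ne i j with rfl | hne
  · exact hi
  · have h1 : (rootSystem H).pairingIn ℤ j.1 i.1 = -1 := (hb hne.symm).resolve_left hij
    have h2 := pairingIn_mul_self_of_odd hsl (α := j.1) (β := i.1) (by rw [h1]; decide)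
    exact hLift_mul_of_pairingIn hS h2.2 h2.1 hi

end Splitting

/-! ### Admissible sets and the main theorem -/

section Main

/-- Diagonal entries are `2`, so modulo two the sum counts the neighbours of `i` in `A`: there are
none if `i ∈ A`, and an even number otherwise. -/
theorem even_sum_cartanMatrix {ι R M N : Type*} [Finite ι] [Field R] [CharZero R]
    [AddCommGroup M] [Module R M] [AddCommGroup N] [Module R N] {P : RootPairing ι R M N}
    [P.IsCrystallographic] {b : P.Base} (hb : b.cartanMatrix.IsSimplyLaced) {A : Set b.support}
    (hA : IsAdmissible b A) {l : List b.support} (hl : l.Nodup) (hlA : ∀ i, i ∈ l ↔ i ∈ A)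
    (i : b.support) : Even (l.map fun j => b.cartanMatrix i j).sum := by
  classical
  rw [← List.sum_toFinset _ hl]
  by_cases hi : i ∈ A
  · refine Finset.even_sum _ fun j hj => ?_
    rcases eq_or_ne i j with rfl | hij
    · rw [b.cartanMatrix_apply_same]
      exact even_two
    · have := hA.1 i hi j ((hlA j).mp (List.mem_toFinset.mp hj))
      have h0 : b.cartanMatrix i j = 0 := by
        by_contra h
        exact this ⟨hij, h⟩
      rw [h0]
      exact Even.zero
  · have h1 : ∀ j ∈ l.toFinset, b.cartanMatrix i j =
        if (dynkinGraph b).Adj i j then -1 else 0 := by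
      intro j hj
      have hij : i ≠ j := by
        rintro rfl
        exact hi ((hlA i).mp (List.mem_toFinset.mp hj))
      split_ifs with h
      · exact (hb hij).resolve_left h.2
      · by_contra h0
        exact h ⟨hij, h0⟩
    have h2 : {j | j ∈ A ∧ (dynkinGraph b).Adj i j} =
        (l.toFinset.filter fun j => (dynkinGraph b).Adj i j : Finset b.support) := by
      ext j
      simp [hlA]
    have h3 := hA.2 i hi
    rw [h2, Set.ncard_coe_finset] at h3
    rw [Finset.sum_congr rfl h1, ← Finset.sum_filter, Finset.sum_const, nsmul_eq_mul]
    exact Even.mul_right (by exact_mod_cast h3) _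

end Main

end Metaplectic

theorem mainTheorem8
    {F : Type*} [NontriviallyNormedField F] [LocallyCompactSpace F] [CharZero F]
    {L : Type*} [LieRing L] [LieAlgebra F L] [FiniteDimensional F L] [LieAlgebra.IsSimple F L]
    {H : LieSubalgebra F L} [H.IsCartanSubalgebra] [LieModule.IsTriangularizable F H L]
    (b : (rootSystem H).Base) (hb : b.cartanMatrix.IsSimplyLaced)
    (B : Metaplectic.ChevalleyBasis H)
    {V : Type*} [AddCommGroup V] [Module F V] [LieRingModule L V] [LieModule F L V]
    [FiniteDimensional F V] (hV : Metaplectic.HasFullWeightLattice H V)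
    {G : Type*} [Group G] (S : GroupExtension (rootsOfUnity 2 F) G (B.group V))
    (hS : Metaplectic.IsCentral S) (hnt : IsEmpty S.Splitting) :
    Metaplectic.torusSq hS ≤ Metaplectic.torusCenter hS ∧
    Metaplectic.weylLift hS ≤ Subgroup.normalizer (Metaplectic.torus hS : Set G) ∧
    (∀ A : Set b.support, Metaplectic.IsAdmissible b A →
      ∀ l : List b.support, l.Nodup → (∀ i, i ∈ l ↔ i ∈ A) →
      ∀ (α : b.support) (t : Fˣ),
        Metaplectic.wLift hS α.1 1 * Metaplectic.hProd hS (l.map Subtype.val) t *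
            (Metaplectic.wLift hS α.1 1)⁻¹ * (Metaplectic.hProd hS (l.map Subtype.val) t)⁻¹ ∈
          Metaplectic.torusSq hS) ∧
    ∀ n ∈ Metaplectic.weylLift hS, ∀ z ∈ Metaplectic.torusCenter hS,
      n * z * n⁻¹ * z⁻¹ ∈ Metaplectic.torusSq hS := by
  have hsl := Metaplectic.hasSimplyLacedRoots_of_isSimplyLaced b hb
  refine ⟨Metaplectic.torusSq_le_torusCenter hS, Metaplectic.weylLift_le_normalizer hS,
    fun A hA l hl hlA α t => ?_, fun n hn => ?_⟩
  · refine Metaplectic.wLift_conj_hProd_mem_torusSq hS _ _ ?_ t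
    rw [List.map_map]
    exact Metaplectic.even_sum_cartanMatrix hb hA hl hlA α
  · refine Metaplectic.weylLift_conj_mul_inv_mem_torusSq hS ?_ hn
    rintro α ⟨β, hβ⟩ c hc
    obtain ⟨κ, hκ, hκ'⟩ := Metaplectic.exists_steinberg_symbol hS α β
      (Metaplectic.pairingIn_mul_self_of_odd hsl hβ).1
    refine Metaplectic.isSquare_of_steinberg (fun a => ?_) κ hκ' ?_ fun s => ?_
    · have := a.2
      rw [mem_rootsOfUnity, pow_two] at this
      exact Subtype.ext this
    -- A trivial symbol would make `h_β` multiplicative for every simple `β`, and the extension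
    -- would split.
    · by_contra! htriv
      have hmul := Metaplectic.hLift_mul_of_mem_support hS b hsl hV hb (α := α) fun s t => by
        rw [← hκ, htriv, map_one, one_mul]
      exact hnt.elim (Metaplectic.nonempty_splitting_of_hLift_mul hS b hsl hV hmul).some
    -- The relation `h_α(c s) = h_α(s) h_α(c)` says exactly that `κ(s, c) = 1`.
    · apply S.inl_injective
      have := hκ s c
      rw [mul_comm s c, hc, mul_eq_right] at this
      rw [this, map_one]
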